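/- **Setting.** For $u:\mathbb{R}\to\mathbb{C}$ put $\langle x\rangle=(1+x^2)^{1/2}$, $\|u\|_{L^{2,1}}=\|\langle x\rangle u\|_{L^2}$, $H^{1,1}(\mathbb{R})=\{u\in L^{2,1}:\ \partial_xu\in L^{2,1}\}$ with $\|u\|_{H^{1,1}}=(\|u\|_{L^{2,1}}^2+\|\partial_xu\|_{L^{2,1}}^2)^{1/2}$ and $\|u\|_{H^2\cap H^{1,1}}=\|u\|_{H^2}+\|u\|_{H^{1,1}}$ (derivatives are weak derivatives; functions in $H^2$ are represented by their $C^1$ representatives). Let $$Q_1(u)=\frac1{2i}\begin{bmatrix}|u|^2&u\\-2i\bar u_x-\bar u|u|^2&-|u|^2\end{bmatrix},\qquad Q_2(u)=\frac1{2i}\begin{bmatrix}|u|^2&-2iu_x+u|u|^2\\-\bar u&-|u|^2\end{bmatrix},$$ $e_1=[1,0]^t$, $e_2=[0,1]^t$. For $u\in H^{1,1}(\mathbb{R})$ and $z\in\mathbb{R}$ the Jost functions $m_\pm(\cdot;z),n_\pm(\cdot;z)\in L^\infty(\mathbb{R})$ with values in $\mathbb{C}^2$ are the bounded solutions of $$m_\pm(x;z)=e_1+\int_{\pm\infty}^x\begin{bmatrix}1&0\\0&e^{2iz(x-y)}\end{bmatrix}Q_1(u(y))\,m_\pm(y;z)\,dy,\qquad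 n_\pm(x;z)=e_2+\int_{\pm\infty}^x\begin{bmatrix}e^{-2iz(x-y)}&0\\0&1\end{bmatrix}Q_2(u(y))\,n_\pm(y;z)\,dy .$$ Put $m_\pm^\infty(x)=e^{\frac1{2i}\int_{\pm\infty}^x|u|^2dy}$, $n_\pm^\infty(x)=e^{-\frac1{2i}\int_{\pm\infty}^x|u|^2dy}$ and $$q_\pm^{(1)}(x)=-\tfrac14m_\pm^\infty(x)\int_{\pm\infty}^x\Big[u\,\partial_y\bar u+\tfrac1{2i}|u|^4\Big]dy,\qquad q_\pm^{(2)}(x)=\tfrac1{2i}\partial_x\big(\bar u(x)\,m_\pm^\infty(x)\big),$$ $$s_\pm^{(1)}(x)=-\tfrac1{2i}\partial_x\big(u(x)\,n_\pm^\infty(x)\big),\qquad s_\pm^{(2)}(x)=-\tfrac14n_\pm^\infty(x)\int_{\pm\infty}^x\Big[\bar u\,\partial_yu-\tfrac1{2i}|u|^4\Big]dy,$$ $$\hat m_\pm(x;z)=z\,[m_\pm(x;z)-m_\pm^\infty(x)e_1]-(q_\pm^{(1)}(x)e_1+q_\pm^{(2)}(x)e_2),\qquad \hat n_\pm(x;z)=z\,[n_\pm(x;z)-n_\pm^\infty(x)e_2]-(s_\pm^{(1)}(x)e_1+s_\pm^{(2)}(x)e_2).$$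 Write $\mathbb{R}^+=[0,\infty)$ and $\mathbb{R}^-=(-\infty,0]$. **Lemma.** 1. If $u\in H^{1,1}(\mathbb{R})$, then for every $x\in\mathbb{R}^\pm$ the functions $m_\pm(x;\cdot)-m_\pm^\infty(x)e_1$ and $n_\pm(x;\cdot)-n_\pm^\infty(x)e_2$ belong to $H^1_z(\mathbb{R})$. 2. If $u\in H^2(\mathbb{R})\cap H^{1,1}(\mathbb{R})$, then for every $x\in\mathbb{R}$ the functions $\hat m_\pm(x;\cdot)$ and $\hat n_\pm(x;\cdot)$ belong to $L^2_z(\mathbb{R})$. 3. For every $U>0$ there is a constant $C(U)>0$ such that for all $u,\tilde u\in H^{1,1}(\mathbb{R})$ with $\|u\|_{H^{1,1}},\|\tilde u\|_{H^{1,1}}\le U$, with corresponding Jost functions $m_\pm,n_\pm$ and $\tilde m_\pm,\tilde n_\pm$, and for every $x\in\mathbb{R}^\pm$, $$\|m_\pm(x;\cdot)-m_\pm^\infty(x)e_1-\tilde m_\pm(x;\cdot)+\tilde m_\pm^\infty(x)e_1\|_{H^1}\le C(U)\|u-\tilde u\|_{H^{1,1}},$$ $$\|n_\pm(x;\cdot)-n_\pm^\infty(x)e_2-\tilde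 n_\pm(x;\cdot)+\tilde n_\pm^\infty(x)e_2\|_{H^1}\le C(U)\|u-\tilde u\|_{H^{1,1}}.$$ 4. For every $U>0$ there is a constant $C(U)>0$ such that for all $u,\tilde u\in H^2(\mathbb{R})\cap H^{1,1}(\mathbb{R})$ with $\|u\|_{H^2\cap H^{1,1}},\|\tilde u\|_{H^2\cap H^{1,1}}\le U$ and for every $x\in\mathbb{R}$, $$\|\hat m_\pm(x;\cdot)-\hat{\tilde m}_\pm(x;\cdot)\|_{L^2}+\|\hat n_\pm(x;\cdot)-\hat{\tilde n}_\pm(x;\cdot)\|_{L^2}\le C(U)\|u-\tilde u\|_{H^2\cap H^{1,1}}.$$ -/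

import Mathlib

open MeasureTheory Set
open scoped ContDiff Matrix

namespace KaupNewell

noncomputable section

/-! Weak derivatives and Sobolev spaces of functions of one real variable. Functions are honest
functions `ℝ → E`; membership in a space and the norms depend only on the a.e. class. -/

section Sobolev

variable {E : Type*} [NormedAddCommGroup E] [NormedSpace ℝ E]

/-- `g` is a weak derivative of `f` on the real line: `∫ φ' f = - ∫ φ g` for every real-valued
smooth compactly supported test function `φ`. -/
def HasWeakDeriv (f g : ℝ → E) : Prop :=
  LocallyIntegrable f volume ∧ LocallyIntegrable g volume ∧
    ∀ φ : ℝ → ℝ, ContDiff ℝ ∞ φ → HasCompactSupport φ →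
      ∫ x, deriv φ x • f x = -∫ x, φ x • g x

open Classical in
/-- The weak derivative of `f` (determined up to a.e. equality); zero if `f` has none. -/
def weakDeriv (f : ℝ → E) : ℝ → E :=
  if h : ∃ g, HasWeakDeriv f g then h.choose else 0

/-- The weak derivative is a weak derivative as soon as there is one. -/
theorem hasWeakDeriv_weakDeriv {f : ℝ → E} (h : ∃ g, HasWeakDeriv f g) :
    HasWeakDeriv f (weakDeriv f) := by
  unfold weakDeriv
  rw [dif_pos h]
  exact h.choose_spec

/-- The `L²` norm on the real line. -/
def l2Norm (f : ℝ → E) : ℝ := (eLpNorm f 2 volume).toReal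

/-- Multiplication by the weight `⟨x⟩ = (1 + x²)^{1/2}`. -/
def weighted (f : ℝ → E) : ℝ → E := fun x => Real.sqrt (1 + x ^ 2) • f x

/-- `f ∈ H¹(ℝ)`: `f ∈ L²` and its weak derivative exists and is in `L²`. -/
def MemH1 (f : ℝ → E) : Prop :=
  MemLp f 2 volume ∧ ∃ g, HasWeakDeriv f g ∧ MemLp g 2 volume

/-- `‖f‖_{H¹} = (‖f‖² + ‖f'‖²)^{1/2}`. -/
def h1Norm (f : ℝ → E) : ℝ := Real.sqrt (l2Norm f ^ 2 + l2Norm (weakDeriv f) ^ 2)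

/-- `f ∈ H²(ℝ)`: `f`, and its first and second weak derivatives, are in `L²`. -/
def MemH2 (f : ℝ → E) : Prop :=
  MemLp f 2 volume ∧ ∃ g, HasWeakDeriv f g ∧ MemH1 g

/-- `‖f‖_{H²} = (‖f‖² + ‖f'‖² + ‖f''‖²)^{1/2}`. -/
def h2Norm (f : ℝ → E) : ℝ :=
  Real.sqrt (l2Norm f ^ 2 + l2Norm (weakDeriv f) ^ 2 + l2Norm (weakDeriv (weakDeriv f)) ^ 2)

/-- `f ∈ L^{2,1}(ℝ)`: `⟨x⟩ f ∈ L²`. -/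
def MemL21 (f : ℝ → E) : Prop := MemLp (weighted f) 2 volume

/-- `f ∈ H^{1,1}(ℝ)`: both `f` and its weak derivative are in `L^{2,1}`. -/
def MemH11 (f : ℝ → E) : Prop :=
  MemL21 f ∧ ∃ g, HasWeakDeriv f g ∧ MemL21 g

/-- `‖f‖_{H^{1,1}} = (‖f‖²_{L^{2,1}} + ‖f'‖²_{L^{2,1}})^{1/2}`. -/
def h11Norm (f : ℝ → E) : ℝ :=
  Real.sqrt (l2Norm (weighted f) ^ 2 + l2Norm (weighted (weakDeriv f)) ^ 2)

/-- The norm of `H² ∩ H^{1,1}`. -/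
def h2h11Norm (f : ℝ → E) : ℝ := h2Norm f + h11Norm f

end Sobolev

/-- The end `-∞` or `+∞` of the line at which a Jost function is normalized. -/
inductive Side
  | minus
  | plus

/-- `∫_{±∞}^x f(y) dy`. -/
def Side.integral {E : Type*} [NormedAddCommGroup E] [NormedSpace ℝ E]
    (s : Side) (f : ℝ → E) (x : ℝ) : E :=
  match s with
  | .minus => ∫ y in Iic x, f y
  | .plus => -∫ y in Ioi x, f y

/-- The closed half-line reaching to the end `±∞`. -/
def Side.halfLine (s : Side) : Set ℝ :=
  match s with
  | .minus => Iic 0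
  | .plus => Ici 0

/-- `ℂ²` with its Hermitian norm. -/
abbrev C2 := EuclideanSpace ℂ (Fin 2)

/-- The first unit vector. -/
def e1 : C2 := !₂[1, 0]

/-- The second unit vector. -/
def e2 : C2 := !₂[0, 1]

/-- The potential `Q₁(u)`. -/
def Q1 (u : ℝ → ℂ) (y : ℝ) : Matrix (Fin 2) (Fin 2) ℂ :=
  (1 / (2 * Complex.I)) •
    !![(‖u y‖ : ℂ) ^ 2, u y;
      -2 * Complex.I * star (weakDeriv u y) - star (u y) * (‖u y‖ : ℂ) ^ 2, -(‖u y‖ : ℂ) ^ 2]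

/-- The potential `Q₂(u)`. -/
def Q2 (u : ℝ → ℂ) (y : ℝ) : Matrix (Fin 2) (Fin 2) ℂ :=
  (1 / (2 * Complex.I)) •
    !![(‖u y‖ : ℂ) ^ 2, -2 * Complex.I * weakDeriv u y + u y * (‖u y‖ : ℂ) ^ 2;
      -star (u y), -(‖u y‖ : ℂ) ^ 2]

/-- `diag(1, e^{2izt})`. -/
def expM (z t : ℝ) : Matrix (Fin 2) (Fin 2) ℂ :=
  !![1, 0; 0, Complex.exp (2 * Complex.I * z * t)]

/-- `diag(e^{-2izt}, 1)`. -/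
def expN (z t : ℝ) : Matrix (Fin 2) (Fin 2) ℂ :=
  !![Complex.exp (-2 * Complex.I * z * t), 0; 0, 1]

/-- `m ∈ L^∞(ℝ)` solves
`m(x) = e₁ + ∫_{±∞}^x diag(1, e^{2iz(x-y)}) Q₁(u(y)) m(y) dy` for every `x`. -/
def IsJostM (s : Side) (u : ℝ → ℂ) (z : ℝ) (m : ℝ → C2) : Prop :=
  MemLp m ⊤ volume ∧
    ∀ x, m x = e1 + s.integral (fun y => WithLp.toLp 2 ((expM z (x - y) * Q1 u y) *ᵥ (m y).ofLp)) x

/-- `n ∈ L^∞(ℝ)` solves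
`n(x) = e₂ + ∫_{±∞}^x diag(e^{-2iz(x-y)}, 1) Q₂(u(y)) n(y) dy` for every `x`. -/
def IsJostN (s : Side) (u : ℝ → ℂ) (z : ℝ) (n : ℝ → C2) : Prop :=
  MemLp n ⊤ volume ∧
    ∀ x, n x = e2 + s.integral (fun y => WithLp.toLp 2 ((expN z (x - y) * Q2 u y) *ᵥ (n y).ofLp)) x

open Classical in
/-- The Jost function `m_±(x;z)`, as the bounded solution of its Volterra equation. (A value is
needed where there is none; zero is then taken.) -/
def jostM (s : Side) (u : ℝ → ℂ) (x z : ℝ) : C2 :=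
  if h : ∃ m, IsJostM s u z m then h.choose x else 0

open Classical in
/-- The Jost function `n_±(x;z)`, as the bounded solution of its Volterra equation. (A value is
needed where there is none; zero is then taken.) -/
def jostN (s : Side) (u : ℝ → ℂ) (x z : ℝ) : C2 :=
  if h : ∃ n, IsJostN s u z n then h.choose x else 0

/-- `m_±^∞(x) = exp((1/2i) ∫_{±∞}^x |u|²)`. -/
def mInf (s : Side) (u : ℝ → ℂ) (x : ℝ) : ℂ :=
  Complex.exp (1 / (2 * Complex.I) * s.integral (fun y => (‖u y‖ : ℂ) ^ 2) x)

/-- `n_±^∞(x) = exp(-(1/2i) ∫_{±∞}^x |u|²)`. -/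
def nInf (s : Side) (u : ℝ → ℂ) (x : ℝ) : ℂ :=
  Complex.exp (-(1 / (2 * Complex.I)) * s.integral (fun y => (‖u y‖ : ℂ) ^ 2) x)

/-- `q_±^{(1)}(x)`. -/
def q1 (s : Side) (u : ℝ → ℂ) (x : ℝ) : ℂ :=
  -(1 / 4) * mInf s u x *
    s.integral (fun y => u y * star (weakDeriv u y) + 1 / (2 * Complex.I) * (‖u y‖ : ℂ) ^ 4) x

/-- `q_±^{(2)}(x)`; the derivative is classical, for `u` of class `C¹`. -/
def q2 (s : Side) (u : ℝ → ℂ) (x : ℝ) : ℂ :=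
  1 / (2 * Complex.I) * deriv (fun t => star (u t) * mInf s u t) x

/-- `s_±^{(1)}(x)`; the derivative is classical, for `u` of class `C¹`. -/
def s1 (s : Side) (u : ℝ → ℂ) (x : ℝ) : ℂ :=
  -(1 / (2 * Complex.I)) * deriv (fun t => u t * nInf s u t) x

/-- `s_±^{(2)}(x)`. The sign in front is the one of the limit of `z (n_±^{(2)} - n_±^∞)`; with it
`s_±^{(2)}` is the complex conjugate of `q_±^{(1)}`. -/
def s2 (s : Side) (u : ℝ → ℂ) (x : ℝ) : ℂ :=
  -(1 / 4) * nInf s u x *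
    s.integral (fun y => star (u y) * weakDeriv u y - 1 / (2 * Complex.I) * (‖u y‖ : ℂ) ^ 4) x

/-- `z ↦ m_±(x;z) - m_±^∞(x) e₁`. -/
def remM (s : Side) (u : ℝ → ℂ) (x z : ℝ) : C2 := jostM s u x z - mInf s u x • e1

/-- `z ↦ n_±(x;z) - n_±^∞(x) e₂`. -/
def remN (s : Side) (u : ℝ → ℂ) (x z : ℝ) : C2 := jostN s u x z - nInf s u x • e2

/-- `z [m_±(x;z) - m_±^∞(x) e₁] - (q_±^{(1)}(x) e₁ + q_±^{(2)}(x) e₂)`. -/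
def hatM (s : Side) (u : ℝ → ℂ) (x z : ℝ) : C2 :=
  (z : ℂ) • remM s u x z - (q1 s u x • e1 + q2 s u x • e2)

/-- `z [n_±(x;z) - n_±^∞(x) e₂] - (s_±^{(1)}(x) e₁ + s_±^{(2)}(x) e₂)`. -/
def hatN (s : Side) (u : ℝ → ℂ) (x z : ℝ) : C2 :=
  (z : ℂ) • remN s u x z - (s1 s u x • e1 + s2 s u x • e2)

end

end KaupNewell

open KaupNewell

/-! Only one of the four Jost systems has to be studied. Reflecting the line moves the normalization
from +∞ to -∞ (`Side.integral_eq`, `Rep.integral_jostM`), and the antilinear isometry `conjSwap`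
carries the equation for n to the one for m (`conjSwap_kernel`). What remains is a Volterra equation
m = e₁ + ∫_{-∞}^x diag(1, e^{2iz(x-y)}) P m dy, with P in weighted L² and with imaginary upper left
entry. It is solved by a contraction in a sup norm weighted by e^{c arctan x} (`exists_isSol`), and
bounded solutions are unique (`eq_zero_of_homogeneous`).

Cauchy–Schwarz against ⟨y⟩ turns the Volterra operator into an integral operator with density
1/(1+y²) acting on squared L²_z norms. Grönwall then bounds a solution in L²_z by its source
(`eLpNorm_le_of_volterra`). Subtracting μ e₁, where μ' = P₀₀ μ, leaves as source a pure oscillatory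
integral of P₁₀ μ, which Plancherel places in L²_z with decay ⟨x⟩⁻¹ for x ≤ 0 (`IsSol.rmd_eq`,
`IsSol.eLpNorm_rmd_le`).

For the z-derivative, the shift z ↦ z + k is absorbed into the potential: up to the unitary diag(1,
e^{2ikx}), the solution at z + k solves the same problem with the off-diagonal entries of P
multiplied by e^{±2iky} (`twist_vker`). The difference quotient of the potential costs one power of
⟨y⟩, which the decay of the remainder pays back (`IsSol.eLpNorm_dqR_le`). Difference quotients in z
are therefore bounded in L²_z uniformly in k, and a weak limit gives H¹.

For the second order statements, 2iz times the remainder is corrected by μ·∫P₀₁P₁₀ in the first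
component and by P₁₀ μ in the second. The first row then cancels, and an integration by parts trades
the factor z for a derivative of P₁₀, leaving an L² oscillatory source (`IsRegPot.rho_eq`,
`IsRegPot.tendsto_integral_src`). No decay in x is needed here, so every x is allowed.

All estimates are proved for differences of two solutions, with a constant times the difference of
the potentials. Membership is the special case in which the second function is zero. -/

namespace KaupNewell

section

open Filter Topology
open scoped ENNReal NNReal FourierTransform BoundedContinuousFunction

/-! ### Plancherel and oscillatory integrals -/

/-- Plancherel's theorem for the integral Fourier transform on `L¹ ∩ L²`. -/
theorem eLpNorm_fourier_eq {f : ℝ → ℂ} (h1 : Integrable f) (h2 : MemLp f 2 volume) :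
    eLpNorm (𝓕 f) 2 volume = eLpNorm f 2 volume := by
  set F : Lp ℂ 2 (volume : Measure ℝ) := 𝓕 (h2.toLp f) with hF
  have hcont : Continuous (𝓕 f) :=
    VectorFourier.fourierIntegral_continuous Real.continuous_fourierChar (by fun_prop) h1
  -- The abstract L² transform and the integral transform are compared as distributions: paired with
  -- a test function, each moves the transform onto that function.
  have key : (F : ℝ → ℂ) =ᵐ[volume] 𝓕 f := by
    refine ae_eq_of_integral_contDiff_smul_eq ?_ ?_ ?_
    · exact (Lp.memLp F).locallyIntegrable (by norm_num)
    · exact hcont.locallyIntegrable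
    · intro g hg hgc
      have hgC : HasCompactSupport (fun x => (g x : ℂ)) := hgc.comp_left Complex.ofReal_zero
      set G : SchwartzMap ℝ ℂ := hgC.toSchwartzMap (Complex.ofRealCLM.contDiff.comp hg) with hG
      have hGa : ∀ x, G x = (g x : ℂ) := fun x => rfl
      have e1 : ∫ x, g x • (F : ℝ → ℂ) x = ∫ x, G x • (F : ℝ → ℂ) x := by
        refine integral_congr_ae (Eventually.of_forall fun x => ?_)
        simp [hGa]
      have e2 : ∫ x, g x • (𝓕 f) x = ∫ x, G x • (𝓕 f) x := by
        refine integral_congr_ae (Eventually.of_forall fun x => ?_)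
        simp [hGa]
      rw [e1, e2, ← Lp.toTemperedDistribution_apply, hF,
        ← Lp.fourier_toTemperedDistribution_eq, TemperedDistribution.fourier_apply,
        Lp.toTemperedDistribution_apply]
      have e3 : ∫ x, (𝓕 G) x • ((h2.toLp f : Lp ℂ 2 volume) : ℝ → ℂ) x = ∫ x, (𝓕 G) x • f x := by
        refine integral_congr_ae ?_
        filter_upwards [h2.coeFn_toLp] with x hx
        rw [hx]
      rw [e3, SchwartzMap.fourier_coe]
      exact VectorFourier.integral_fourierIntegral_smul_eq_flip (L := innerₗ ℝ)
        Real.continuous_fourierChar (by fun_prop) G.integrable h1 |>.trans (by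
          simp only [flip_innerₗ]; rfl)
  rw [← eLpNorm_congr_ae key, ← Lp.enorm_def, ← eLpNorm_congr_ae h2.coeFn_toLp, ← Lp.enorm_def]
  simp only [← ofReal_norm]
  rw [hF, Lp.norm_fourier_eq]

theorem eLpNorm_two_comp_mul_left {E : Type*} [NormedAddCommGroup E] (F : ℝ → E) {c : ℝ}
    (hc : c ≠ 0) : eLpNorm (fun z => F (c * z)) 2 volume =
      ENNReal.ofReal |c⁻¹| ^ (1 / 2 : ℝ) * eLpNorm F 2 volume := by
  have h : eLpNorm F 2 (Measure.map (c * ·) volume) = eLpNorm (F ∘ (c * ·)) 2 volume :=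
    (Homeomorph.mulLeft₀ c hc).measurableEmbedding.eLpNorm_map_measure
  rw [Real.map_volume_mul_left hc, eLpNorm_smul_measure_of_ne_top (by simp)] at h
  simpa [Function.comp_def] using h.symm

/-- The phase `e^{2izt}`. -/
noncomputable def phase (z t : ℝ) : ℂ := Complex.exp (2 * Complex.I * z * t)

theorem norm_phase (z t : ℝ) : ‖phase z t‖ = 1 := by
  have : phase z t = Complex.exp ((2 * z * t : ℝ) * Complex.I) := by
    unfold phase; congr 1; push_cast; ring
  rw [this, Complex.norm_exp_ofReal_mul_I]

theorem continuous_phase : Continuous (fun p : ℝ × ℝ => phase p.1 p.2) := by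
  unfold phase; fun_prop

theorem phase_add (z s t : ℝ) : phase z (s + t) = phase z s * phase z t := by
  unfold phase; rw [← Complex.exp_add]; congr 1; push_cast; ring

theorem phase_add_left (z k t : ℝ) : phase (z + k) t = phase z t * phase k t := by
  unfold phase; rw [← Complex.exp_add]; congr 1; push_cast; ring

theorem phase_zero (z : ℝ) : phase z 0 = 1 := by simp [phase]

/-- Up to the unimodular factor e^{2izx} the integral is the Fourier transform of f at z/π.
Plancherel and the dilation give the constant √π, rounded up to 2. -/
theorem eLpNorm_phase_integral_le {f : ℝ → ℂ} (h1 : Integrable f) (h2 : MemLp f 2 volume)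
    (x : ℝ) : eLpNorm (fun z => ∫ y, phase z (x - y) * f y) 2 volume ≤
      2 * eLpNorm f 2 volume := by
  have e : ∀ z, ∫ y, phase z (x - y) * f y = phase z x * 𝓕 f (Real.pi⁻¹ * z) := by
    intro z
    rw [Real.fourier_eq, ← integral_const_mul]
    congr 1; ext y
    rw [sub_eq_add_neg, phase_add, mul_assoc, Circle.smul_def, smul_eq_mul, Real.fourierChar_apply]
    congr 2
    unfold phase; congr 1
    have : (Real.pi : ℂ) ≠ 0 := by exact_mod_cast Real.pi_ne_zero
    simp only [RCLike.inner_apply, conj_trivial]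
    push_cast; field_simp
  have : eLpNorm (fun z => ∫ y, phase z (x - y) * f y) 2 volume =
      eLpNorm (fun z => 𝓕 f (Real.pi⁻¹ * z)) 2 volume := by
    refine eLpNorm_congr_norm_ae (Eventually.of_forall fun z => ?_)
    rw [e, norm_mul, norm_phase, one_mul]
  rw [this, eLpNorm_two_comp_mul_left _ (inv_ne_zero Real.pi_ne_zero), eLpNorm_fourier_eq h1 h2]
  gcongr
  rw [inv_inv, abs_of_pos Real.pi_pos]
  calc ENNReal.ofReal Real.pi ^ (1 / 2 : ℝ) ≤ (4 : ℝ≥0∞) ^ (1 / 2 : ℝ) := by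
        gcongr
        exact (ENNReal.ofReal_le_ofReal Real.pi_le_four).trans (by simp)
    _ = 2 := by
        rw [show (4 : ℝ≥0∞) = 2 ^ (2 : ℝ) by norm_num, ← ENNReal.rpow_mul]; norm_num

theorem eLpNorm_phase_setIntegral_le {g : ℝ → ℂ} {s : Set ℝ} (hs : MeasurableSet s)
    (h1 : IntegrableOn g s) (h2 : MemLp g 2 (volume.restrict s)) (x : ℝ) :
    eLpNorm (fun z => ∫ y in s, phase z (x - y) * g y) 2 volume ≤
      2 * eLpNorm g 2 (volume.restrict s) := by
  have := eLpNorm_phase_integral_le ((integrable_indicator_iff hs).2 h1)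
    ((memLp_indicator_iff_restrict hs).2 h2) x
  rw [eLpNorm_indicator_eq_eLpNorm_restrict hs] at this
  have e : ∀ z, ∫ y in s, phase z (x - y) * g y = ∫ y, phase z (x - y) * s.indicator g y := by
    intro z
    rw [← integral_indicator hs]
    congr 1; ext y
    by_cases hy : y ∈ s <;> simp [hy]
  simpa only [e] using this

/-- The `L²` bound for oscillatory integrals of an `L²` density, understood as improper integrals. -/
theorem eLpNorm_le_of_tendsto_phase_integral {g S : ℝ → ℂ} {x : ℝ} {a : ℕ → ℝ}
    (hg : MemLp g 2 (volume.restrict (Iic x)))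
    (hS : ∀ z, Tendsto (fun n => ∫ y in Ioc (a n) x, phase z (x - y) * g y) atTop (𝓝 (S z))) :
    eLpNorm S 2 volume ≤ 2 * eLpNorm g 2 (volume.restrict (Iic x)) := by
  have hm : ∀ n, MemLp g 2 (volume.restrict (Ioc (a n) x)) := fun n =>
    hg.mono_measure (Measure.restrict_mono Ioc_subset_Iic_self le_rfl)
  have hi : ∀ n, IntegrableOn g (Ioc (a n) x) := fun n => (hm n).integrable (by norm_num)
  -- Fatou: g need not be integrable on the half-line, so the bound is taken on bounded intervals,
  -- where L² embeds in L¹, and passed to the pointwise limit.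
  refine (Lp.eLpNorm_lim_le_liminf_eLpNorm (f := fun n z => ∫ y in Ioc (a n) x,
    phase z (x - y) * g y) (fun n => ?_) S (Eventually.of_forall hS)).trans ?_
  · refine (AEStronglyMeasurable.integral_prod_right' (f := fun p : ℝ × ℝ =>
      phase p.1 (x - p.2) * g p.2) ?_)
    refine AEStronglyMeasurable.mul ?_ ?_
    · exact (continuous_phase.comp (by fun_prop : Continuous fun p : ℝ × ℝ =>
        (p.1, x - p.2))).aestronglyMeasurable
    · exact (hi n).1.comp_snd
  · refine liminf_le_of_le (by isBoundedDefault) fun b hb => ?_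
    obtain ⟨n, hn⟩ := hb.exists
    refine hn.trans ((eLpNorm_phase_setIntegral_le measurableSet_Ioc (hi n) (hm n) x).trans ?_)
    gcongr
    exact Ioc_subset_Iic_self

/-! ### Primitives and weak derivatives -/

theorem intervalIntegrable_of_locallyIntegrable {E : Type*} [NormedAddCommGroup E] {f : ℝ → E}
    (hf : LocallyIntegrable f) (a b : ℝ) : IntervalIntegrable f volume a b :=
  intervalIntegrable_iff.2 ((hf.integrableOn_isCompact isCompact_uIcc).mono_set uIoc_subset_uIcc)

theorem absolutelyContinuousOnInterval_primitive {f : ℝ → ℂ} (hf : LocallyIntegrable f)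
    (a b : ℝ) : AbsolutelyContinuousOnInterval (fun x => ∫ t in a..x, f t) a b := by
  have hi : ∀ a b, IntervalIntegrable f volume a b := fun a b => intervalIntegrable_of_locallyIntegrable hf a b
  have hre : ∀ a b, IntervalIntegrable (fun t => (f t).re) volume a b := fun a b =>
    ⟨(hi a b).1.re, (hi a b).2.re⟩
  have him : ∀ a b, IntervalIntegrable (fun t => (f t).im) volume a b := fun a b =>
    ⟨(hi a b).1.im, (hi a b).2.im⟩
  have hc : ∀ c : ℂ, AbsolutelyContinuousOnInterval (fun _ : ℝ => c) a b := fun c =>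
    (LipschitzWith.const c).lipschitzOnWith.absolutelyContinuousOnInterval
  have h := (((hre a b).absolutelyContinuousOnInterval_intervalIntegral left_mem_uIcc).smul
    (hc 1)).add (((him a b).absolutelyContinuousOnInterval_intervalIntegral left_mem_uIcc).smul
    (hc Complex.I))
  convert! h using 1
  funext x
  change _ = (∫ t in a..x, (f t).re) • (1 : ℂ) + (∫ t in a..x, (f t).im) • Complex.I
  rw [Complex.real_smul, Complex.real_smul, mul_one, ← intervalIntegral.integral_ofReal, ← intervalIntegral.integral_ofReal,
    ← intervalIntegral.integral_mul_const, ← intervalIntegral.integral_add]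
  · simp [Complex.re_add_im]
  · exact ⟨(hre a x).1.ofReal, (hre a x).2.ofReal⟩
  · exact IntervalIntegrable.mul_const ⟨(him a x).1.ofReal, (him a x).2.ofReal⟩ _

theorem continuous_of_primitive {E : Type*} [NormedAddCommGroup E] [NormedSpace ℝ E]
    {f F : ℝ → E} (hf : LocallyIntegrable f)
    (hF : ∀ x y, F y - F x = ∫ t in x..y, f t) : Continuous F := by
  have : F = fun y => F 0 + ∫ t in (0 : ℝ)..y, f t := by
    ext y; rw [← hF]; abel
  rw [this]
  exact continuous_const.add
    (intervalIntegral.continuous_primitive (fun a b => intervalIntegrable_of_locallyIntegrable hf a b) 0)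

/-- Integration by parts of a `C¹` function against a primitive of a locally integrable one. -/
theorem integral_mul_primitive {f F φ φ' : ℝ → ℂ} (hf : LocallyIntegrable f)
    (hF : ∀ x y, F y - F x = ∫ t in x..y, f t) (hφ : ∀ x, HasDerivAt φ (φ' x) x)
    (hφ' : Continuous φ') (a b : ℝ) :
    ∫ t in a..b, (φ' t * F t + φ t * f t) = φ b * F b - φ a * F a := by
  have hFc := continuous_of_primitive hf hF
  have hφc : Continuous φ := continuous_iff_continuousAt.2 fun x => (hφ x).continuousAt
  have hg : LocallyIntegrable (fun t => φ' t * F t + φ t * f t) := by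
    refine (hφ'.mul hFc).locallyIntegrable.add ?_
    exact (locallyIntegrable_iff).2 fun K hK =>
      ((hf.integrableOn_isCompact hK).continuousOn_mul hφc.continuousOn hK)
  have hC1 : ContDiff ℝ 1 φ := by
    rw [contDiff_one_iff_deriv]
    exact ⟨fun x => (hφ x).differentiableAt, by rwa [show deriv φ = φ' from funext fun x => (hφ x).deriv]⟩
  have hFa : F = fun y => F a + ∫ t in a..y, f t := by ext y; rw [← hF]; abel
  have hFAC : AbsolutelyContinuousOnInterval F a b := by
    rw [hFa]
    exact ((LipschitzWith.const (F a)).lipschitzOnWith.absolutelyContinuousOnInterval).add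
      (absolutelyContinuousOnInterval_primitive hf a b)
  -- The product φF minus the primitive of the claimed derivative is absolutely continuous, and by
  -- Lebesgue differentiation its derivative vanishes a.e.; hence it is constant.
  have hAC := (hC1.contDiffOn.absolutelyContinuousOnInterval (a := a) (b := b)).smul hFAC |>.sub
    (absolutelyContinuousOnInterval_primitive hg a b)
  obtain ⟨C, hC⟩ := hAC.const_of_ae_hasDerivAt_zero (by
    filter_upwards [LocallyIntegrable.ae_hasDerivAt_integral hf,
      LocallyIntegrable.ae_hasDerivAt_integral hg] with x h1 h2 _
    have h3 : HasDerivAt F (f x) x := by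
      rw [hFa]; simpa using (h1 a).const_add (F a)
    convert! ((hφ x).mul h3).sub (h2 a) using 1
    ring)
  have ha := hC a left_mem_uIcc
  have hb := hC b right_mem_uIcc
  change φ a * F a - ∫ t in a..a, (φ' t * F t + φ t * f t) = C at ha
  change φ b * F b - ∫ t in a..b, (φ' t * F t + φ t * f t) = C at hb
  rw [intervalIntegral.integral_same] at ha
  linear_combination ha - hb

section Weak

variable {E : Type*} [NormedAddCommGroup E] [NormedSpace ℝ E]

theorem HasWeakDeriv.unique [CompleteSpace E] {f g h : ℝ → E} (h1 : HasWeakDeriv f g)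
    (h2 : HasWeakDeriv f h) : g =ᵐ[volume] h := by
  refine ae_eq_of_integral_contDiff_smul_eq h1.2.1 h2.2.1 fun φ hφ hc => ?_
  have := (h1.2.2 φ hφ hc).symm.trans (h2.2.2 φ hφ hc)
  simpa using this

theorem HasWeakDeriv.weakDeriv_ae_eq [CompleteSpace E] {f g : ℝ → E} (h : HasWeakDeriv f g) :
    weakDeriv f =ᵐ[volume] g :=
  (hasWeakDeriv_weakDeriv ⟨g, h⟩).unique h

theorem HasWeakDeriv.congr {f g f' g' : ℝ → E} (h : HasWeakDeriv f g)
    (hf : f =ᵐ[volume] f') (hg : g =ᵐ[volume] g') : HasWeakDeriv f' g' := by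
  refine ⟨h.1.congr hf, h.2.1.congr hg, fun φ hφ hc => ?_⟩
  have e1 : ∫ x, deriv φ x • f x = ∫ x, deriv φ x • f' x :=
    integral_congr_ae (hf.mono fun x hx => by simp only [hx])
  have e2 : ∫ x, φ x • g x = ∫ x, φ x • g' x :=
    integral_congr_ae (hg.mono fun x hx => by simp only [hx])
  rw [← e1, h.2.2 φ hφ hc, e2]

theorem integrable_testFunction_smul {φ : ℝ → ℝ} {f : ℝ → E} (hφ : Continuous φ)
    (hc : HasCompactSupport φ) (hf : LocallyIntegrable f) : Integrable (fun x => φ x • f x) :=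
  hf.integrable_smul_left_of_hasCompactSupport hφ hc

theorem HasWeakDeriv.sub {f g f' g' : ℝ → E} (h : HasWeakDeriv f g)
    (h' : HasWeakDeriv f' g') : HasWeakDeriv (f - f') (g - g') := by
  refine ⟨h.1.sub h'.1, h.2.1.sub h'.2.1, fun φ hφ hc => ?_⟩
  have hd : Continuous (deriv φ) := hφ.continuous_deriv (by simp)
  simp only [Pi.sub_apply, smul_sub]
  rw [integral_sub (integrable_testFunction_smul hd hc.deriv h.1)
    (integrable_testFunction_smul hd hc.deriv h'.1),
    integral_sub (integrable_testFunction_smul hφ.continuous hc h.2.1)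
    (integrable_testFunction_smul hφ.continuous hc h'.2.1), h.2.2 φ hφ hc, h'.2.2 φ hφ hc]
  abel

theorem weakDeriv_sub_ae_eq [CompleteSpace E] {f g : ℝ → E} (hf : ∃ f', HasWeakDeriv f f')
    (hg : ∃ g', HasWeakDeriv g g') : weakDeriv (f - g) =ᵐ[volume] weakDeriv f - weakDeriv g :=
  ((hasWeakDeriv_weakDeriv hf).sub (hasWeakDeriv_weakDeriv hg)).weakDeriv_ae_eq

theorem exists_forall_abs_le_of_hasCompactSupport {φ : ℝ → ℝ} (hc : HasCompactSupport φ) :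
    ∃ R : ℝ, 0 < R ∧ ∀ x, R ≤ |x| → φ x = 0 := by
  obtain ⟨R, hR⟩ := hc.isCompact.isBounded.subset_ball 0
  refine ⟨max R 1, by positivity, fun x hx => ?_⟩
  by_contra h
  have := hR (subset_tsupport _ h)
  rw [mem_ball_zero_iff, Real.norm_eq_abs] at this
  exact absurd ((le_max_left _ _).trans hx) (not_le.2 this)

theorem integral_eq_intervalIntegral_of_zero {h : ℝ → E} {R : ℝ} 
    (h0 : ∀ x, R ≤ |x| → h x = 0) : ∫ x, h x = ∫ x in (-R)..R, h x := by
  refine (intervalIntegral.integral_eq_integral_of_support_subset ?_).symm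
  intro x hx
  have : |x| < R := by
    by_contra hc; exact hx (h0 x (not_lt.1 hc))
  exact ⟨(abs_lt.1 this).1, (abs_lt.1 this).2.le⟩

theorem hasWeakDeriv_of_primitive {f F : ℝ → ℂ} (hf : LocallyIntegrable f)
    (hF : ∀ x y, F y - F x = ∫ t in x..y, f t) : HasWeakDeriv F f := by
  refine ⟨(continuous_of_primitive hf hF).locallyIntegrable, hf, fun φ hφ hc => ?_⟩
  obtain ⟨R, hR, h0⟩ := exists_forall_abs_le_of_hasCompactSupport hc
  obtain ⟨R', hR', h0'⟩ := exists_forall_abs_le_of_hasCompactSupport hc.deriv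
  have hd : Continuous (deriv φ) := hφ.continuous_deriv (by simp)
  have hdiff : Differentiable ℝ φ := hφ.differentiable (by simp)
  have e := integral_mul_primitive hf hF (φ := fun x => (φ x : ℂ))
    (φ' := fun x => ((deriv φ x : ℝ) : ℂ))
    (fun x => (hdiff x).hasDerivAt.ofReal_comp) (by fun_prop) (-(max R R')) (max R R')
  have hm : 0 < max R R' := by positivity
  rw [h0 (max R R') (by rw [abs_of_pos hm]; exact le_max_left _ _),
    h0 (-(max R R')) (by rw [abs_neg, abs_of_pos hm]; exact le_max_left _ _)] at e
  have i1 : Integrable (fun x => deriv φ x • F x) :=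
    integrable_testFunction_smul hd hc.deriv (continuous_of_primitive hf hF).locallyIntegrable
  have i2 : Integrable (fun x => φ x • f x) := integrable_testFunction_smul hφ.continuous hc hf
  rw [eq_neg_iff_add_eq_zero, ← integral_add i1 i2, integral_eq_intervalIntegral_of_zero (R := max R R')]
  · simpa using e
  · intro x hx
    rw [h0 x ((le_max_left _ _).trans hx), h0' x ((le_max_right _ _).trans hx)]
    simp

/-- Du Bois-Reymond: for a fixed bump ψ₀ of mass one, φ - (∫φ) ψ₀ has integral zero and so is the
derivative of a test function. Testing against it identifies the constant as ∫ ψ₀ h. -/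
theorem ae_eq_const_of_integral_deriv_smul_eq_zero [CompleteSpace E] {h : ℝ → E} (hh : LocallyIntegrable h)
    (h0 : ∀ φ : ℝ → ℝ, ContDiff ℝ ∞ φ → HasCompactSupport φ → ∫ x, deriv φ x • h x = 0) :
    ∃ C, h =ᵐ[volume] fun _ => C := by
  let ψ : ContDiffBump (0 : ℝ) := ⟨1, 2, by norm_num, by norm_num⟩
  set ψ₀ : ℝ → ℝ := ψ.normed volume with hψ₀
  have hψs : ContDiff ℝ ∞ ψ₀ := ψ.contDiff_normed
  have hψc : HasCompactSupport ψ₀ := ψ.hasCompactSupport_normed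
  refine ⟨∫ x, ψ₀ x • h x, ae_eq_of_integral_contDiff_smul_eq hh
    (locallyIntegrable_const _) fun φ hφ hc => ?_⟩
  set η : ℝ → ℝ := fun x => φ x - (∫ y, φ y) * ψ₀ x with hη
  have hηs : ContDiff ℝ ∞ η := hφ.sub (contDiff_const.mul hψs)
  have hηc : HasCompactSupport η := hc.sub (hψc.mul_left (f := fun _ => ∫ y, φ y))
  obtain ⟨R, hR, hR0⟩ := exists_forall_abs_le_of_hasCompactSupport hηc
  set Φ : ℝ → ℝ := fun x => ∫ t in (-R)..x, η t with hΦ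
  have hd : ∀ x, HasDerivAt Φ (η x) x := fun x =>
    intervalIntegral.integral_hasDerivAt_right (hηs.continuous.intervalIntegrable _ _)
      (hηs.continuous.stronglyMeasurableAtFilter _ _) hηs.continuous.continuousAt
  have hderiv : deriv Φ = η := funext fun x => (hd x).deriv
  have hΦs : ContDiff ℝ ∞ Φ := by
    rw [contDiff_infty_iff_deriv]
    exact ⟨fun x => (hd x).differentiableAt, by rwa [hderiv]⟩
  have hint : ∫ x, η x = 0 := by
    rw [hη, integral_sub (hφ.continuous.integrable_of_hasCompactSupport hc)
      ((hψs.continuous.integrable_of_hasCompactSupport hψc).const_mul _), integral_const_mul,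
      ψ.integral_normed, mul_one, sub_self]
  have hΦc : HasCompactSupport Φ := by
    refine HasCompactSupport.of_support_subset_isCompact (isCompact_Icc (a := -R) (b := R)) ?_
    intro x hx
    by_contra hxR
    apply hx
    rw [mem_Icc, not_and_or, not_le, not_le] at hxR
    rcases hxR with hxR | hxR
    · refine intervalIntegral.integral_zero_ae (Eventually.of_forall fun t ht => hR0 t ?_)
      rw [uIoc_of_ge hxR.le] at ht
      rw [abs_of_nonpos (by linarith [ht.2])]; linarith [ht.2]
    · have e := intervalIntegral.integral_add_adjacent_intervals (μ := volume) (f := η)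
        (hηs.continuous.intervalIntegrable (-R) R) (hηs.continuous.intervalIntegrable R x)
      rw [hΦ]; simp only
      rw [← e, ← integral_eq_intervalIntegral_of_zero hR0, hint, zero_add]
      refine intervalIntegral.integral_zero_ae (Eventually.of_forall fun t ht => hR0 t ?_)
      rw [uIoc_of_le hxR.le] at ht
      rw [abs_of_nonneg (by linarith [ht.1])]; linarith [ht.1]
  have := h0 Φ hΦs hΦc
  rw [hderiv, hη] at this
  simp only [sub_smul, mul_smul] at this
  have hi2 : Integrable (fun x => (∫ y, φ y) • ψ₀ x • h x) :=
    (integrable_testFunction_smul hψs.continuous hψc hh).smul (∫ y, φ y)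
  rw [integral_sub (integrable_testFunction_smul hφ.continuous hc hh) hi2, integral_smul,
    sub_eq_zero] at this
  rw [this, integral_smul_const]

/-- The difference of f and a primitive of g has zero weak derivative, hence is a.e. constant. This
supplies the absolutely continuous representatives of u and, in the H² case, of its derivative. -/
theorem HasWeakDeriv.exists_primitive {f g : ℝ → ℂ} (h : HasWeakDeriv f g) :
    ∃ F : ℝ → ℂ, Continuous F ∧ f =ᵐ[volume] F ∧ ∀ x y, F y - F x = ∫ t in x..y, g t := by
  set G : ℝ → ℂ := fun y => ∫ t in (0 : ℝ)..y, g t with hG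
  have hi : ∀ a b, IntervalIntegrable g volume a b := fun a b => intervalIntegrable_of_locallyIntegrable h.2.1 a b
  have hGp : ∀ x y, G y - G x = ∫ t in x..y, g t := fun x y =>
    intervalIntegral.integral_interval_sub_left (hi _ _) (hi _ _)
  have hGw := h.sub (hasWeakDeriv_of_primitive h.2.1 hGp)
  obtain ⟨C, hC⟩ := ae_eq_const_of_integral_deriv_smul_eq_zero hGw.1 fun φ hφ hc => by
    rw [hGw.2.2 φ hφ hc]; simp
  have hF : ∀ x y, (C + G y) - (C + G x) = ∫ t in x..y, g t := fun x y => by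
    rw [← hGp]; ring
  refine ⟨fun x => C + G x, continuous_of_primitive h.2.1 hF, ?_, hF⟩
  filter_upwards [hC] with x hx
  simp only [Pi.sub_apply] at hx
  rw [← hx]; ring

end Weak

/-! ### Difference quotients and H¹ -/

theorem integral_C2_apply {α : Type*} [MeasurableSpace α] {μ : Measure α} {F : α → C2} (hF : Integrable F μ) (i : Fin 2) :
    (∫ x, F x ∂μ) i = ∫ x, F x i ∂μ :=
  ((EuclideanSpace.proj (𝕜 := ℂ) i).integral_comp_comm hF).symm

/-- Difference quotients converge to the derivative when tested against continuous functions. -/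
theorem tendsto_integral_diffQuotient {φ : ℝ → ℝ} (hφ : ContDiff ℝ ∞ φ) (hc : HasCompactSupport φ)
    {f : ℝ → ℂ} (hf : Continuous f) {k : ℕ → ℝ} (hk0 : ∀ n, k n ≠ 0) (hk : ∀ n, |k n| ≤ 1)
    (hk' : Tendsto k atTop (𝓝 0)) :
    Tendsto (fun n => ∫ z, (φ z : ℂ) * ((k n : ℂ)⁻¹ * (f (z + k n) - f z))) atTop
      (𝓝 (-∫ z, ((deriv φ z : ℝ) : ℂ) * f z)) := by
  have hdiff : Differentiable ℝ φ := hφ.differentiable (by simp)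
  obtain ⟨R, hR, h0⟩ := exists_forall_abs_le_of_hasCompactSupport hc
  obtain ⟨L, hL⟩ := hφ.lipschitzWith_of_hasCompactSupport hc (by simp)
  have hi1 : Integrable (fun z => (φ z : ℂ) * f z) := by
    have := integrable_testFunction_smul hφ.continuous hc hf.locallyIntegrable
    simpa using this
  have hi2 : ∀ k, Integrable (fun z => (φ z : ℂ) * f (z + k)) := fun k => by
    have := integrable_testFunction_smul hφ.continuous hc
      (hf.comp (continuous_id.add continuous_const) : Continuous fun z => f (z + k)).locallyIntegrable
    simpa using this
  -- Summation by parts: a translation moves the quotient onto φ, whose Lipschitz constant and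
  -- compact support then give a dominating function.
  have e : ∀ n, ∫ z, (φ z : ℂ) * ((k n : ℂ)⁻¹ * (f (z + k n) - f z)) =
      ∫ z, ((k n)⁻¹ * (φ (z - k n) - φ z) : ℝ) * f z := by
    intro n
    have hi3 : Integrable (fun z => (φ (z - k n) : ℂ) * f z) := by
      have := (hi2 (k n)).comp_sub_right (k n)
      simpa using this
    have e1 : ∫ z, (φ z : ℂ) * f (z + k n) = ∫ z, (φ (z - k n) : ℂ) * f z := by
      rw [← integral_sub_right_eq_self _ (k n)]
      simp
    calc _ = ∫ z, ((k n : ℂ)⁻¹ * ((φ z : ℂ) * f (z + k n) - (φ z : ℂ) * f z)) := by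
          congr 1; ext z; ring
      _ = (k n : ℂ)⁻¹ * (∫ z, ((φ (z - k n) : ℂ) * f z - (φ z : ℂ) * f z)) := by
          rw [integral_const_mul, integral_sub (hi2 _) hi1, integral_sub hi3 hi1, e1]
      _ = _ := by
          rw [← integral_const_mul]; congr 1; ext z; push_cast; ring
  simp only [e]
  rw [← integral_neg]
  refine tendsto_integral_of_dominated_convergence
    (fun z => (Icc (-(R + 1)) (R + 1)).indicator (fun z => L * ‖f z‖) z) ?_ ?_ ?_ ?_
  · intro n
    have := hφ.continuous
    exact (Continuous.mul (by fun_prop) hf).aestronglyMeasurable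
  · rw [integrable_indicator_iff measurableSet_Icc]
    exact (by fun_prop : Continuous fun z => (L : ℝ) * ‖f z‖).integrableOn_Icc
  · intro n
    refine Eventually.of_forall fun z => ?_
    by_cases hz : z ∈ Icc (-(R + 1)) (R + 1)
    · rw [indicator_of_mem hz, norm_mul]
      gcongr
      rw [Complex.norm_real, norm_mul, norm_inv, inv_mul_le_iff₀ (norm_pos_iff.2 (hk0 n))]
      have := hL.dist_le_mul (z - k n) z
      rw [dist_eq_norm, dist_eq_norm] at this
      simpa [mul_comm] using this
    · rw [indicator_of_notMem hz]
      have hz' : R + 1 < |z| := by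
        by_contra h
        exact hz (abs_le.1 (not_lt.1 h))
      have h2 : R ≤ |z - k n| := by
        have := abs_sub_abs_le_abs_sub z (k n)
        linarith [hk n]
      simp [h0 z (by linarith), h0 _ h2]
  · refine Eventually.of_forall fun z => ?_
    have h1 := (hdiff z).hasDerivAt.tendsto_slope_zero
    have h2 : Tendsto (fun n => -k n) atTop (𝓝[≠] 0) :=
      tendsto_nhdsWithin_iff.2 ⟨by simpa using hk'.neg, Eventually.of_forall fun n => by simpa using hk0 n⟩
    have h3 := (h1.comp h2).neg
    have h4 : Tendsto (fun n => ((k n)⁻¹ * (φ (z - k n) - φ z) : ℝ)) atTop (𝓝 (-deriv φ z)) := by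
      refine h3.congr fun n => ?_
      simp only [Function.comp, smul_eq_mul, inv_neg, neg_mul, neg_neg, ← sub_eq_add_neg]
    have h5 := ((Complex.continuous_ofReal.tendsto _).comp h4).mul_const (f z)
    convert! h5 using 2
    push_cast; ring

/-- A bounded sequence in a Hilbert space has a weak limit along an ultrafilter. -/
theorem exists_weak_limit {H : Type*} [NormedAddCommGroup H] [InnerProductSpace ℂ H]
    [CompleteSpace H] {h : ℕ → H} {K : ℝ} (hh : ∀ n, ‖h n‖ ≤ K) :
    ∃ g : H, ‖g‖ ≤ K ∧
      ∀ Φ, Tendsto (fun n => inner ℂ (h n) Φ) (hyperfilter ℕ) (𝓝 (inner ℂ g Φ)) := by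
  let T := InnerProductSpace.toDual ℂ H
  let y : ℕ → WeakDual ℂ H := fun n => WeakDual.toStrongDual.symm (T (h n))
  -- Banach–Alaoglu. Along an ultrafilter, compactness alone yields a limit and no subsequence has
  -- to be extracted.
  obtain ⟨ℓ, hℓ, hlim⟩ := (WeakDual.isCompact_closedBall (𝕜 := ℂ)
    (0 : StrongDual ℂ H) K).ultrafilter_le_nhds ((hyperfilter ℕ).map y) (by
      rw [le_principal_iff]
      refine Filter.mem_map.2 (Filter.Eventually.of_forall fun n => ?_)
      simp only [mem_preimage, y]
      rw [LinearEquiv.apply_symm_apply, mem_closedBall_zero_iff, LinearIsometryEquiv.norm_map]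
      exact hh n)
  refine ⟨T.symm (WeakDual.toStrongDual ℓ), ?_, fun Φ => ?_⟩
  · rw [LinearIsometryEquiv.norm_map]
    simpa [mem_closedBall_zero_iff] using hℓ
  · have h1 : Tendsto y (hyperfilter ℕ) (𝓝 ℓ) := hlim
    have h2 := ((WeakDual.eval_continuous Φ).tendsto ℓ).comp h1
    have e : inner ℂ (T.symm (WeakDual.toStrongDual ℓ)) Φ = ℓ Φ := by
      rw [← InnerProductSpace.toDual_apply_apply]
      change T (T.symm (WeakDual.toStrongDual ℓ)) Φ = _
      rw [LinearIsometryEquiv.apply_symm_apply]; rfl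
    rw [e]
    exact h2

/-- A square integrable function whose difference quotients are bounded in `L²` has a weak
derivative in `L²`. -/
theorem exists_hasWeakDeriv_of_diffQuotient {f : ℝ → C2} (hfc : Continuous f)
    {K : ℝ≥0}
    (hK : ∀ k : ℝ, k ≠ 0 → eLpNorm (fun z => f (z + k) - f z) 2 volume ≤ ENNReal.ofReal |k| * K) :
    ∃ g, HasWeakDeriv f g ∧ MemLp g 2 volume ∧ eLpNorm g 2 volume ≤ K := by
  obtain ⟨k, hk0, hk1, hkt⟩ : ∃ k : ℕ → ℝ, (∀ n, k n ≠ 0) ∧ (∀ n, |k n| ≤ 1) ∧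
      Tendsto k atTop (𝓝 0) := by
    refine ⟨fun n => 1 / ((n : ℝ) + 1), fun n => by positivity, fun n => ?_,
      tendsto_one_div_add_atTop_nhds_zero_nat⟩
    rw [abs_of_pos (by positivity)]
    exact (div_le_one (by positivity)).2 (by linarith [(Nat.cast_nonneg n : (0 : ℝ) ≤ n)])
  obtain ⟨D, hD⟩ : ∃ D : ℕ → ℝ → C2, D = fun n z => ((k n : ℂ)⁻¹) • (f (z + k n) - f z) :=
    ⟨_, rfl⟩
  have hDc : ∀ n, Continuous (D n) := fun n => by subst hD; fun_prop
  have hDn : ∀ n, eLpNorm (D n) 2 volume ≤ K := fun n => by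
    have e : eLpNorm (D n) 2 volume = ‖((k n : ℂ)⁻¹)‖ₑ *
        eLpNorm (fun z => f (z + k n) - f z) 2 volume := by
      rw [← eLpNorm_const_smul, hD]; rfl
    rw [e]
    calc _ ≤ ‖((k n : ℂ)⁻¹)‖ₑ * (ENNReal.ofReal |k n| * K) := by gcongr; exact hK _ (hk0 n)
      _ = K := by
        rw [← mul_assoc, ← ofReal_norm, ← ENNReal.ofReal_mul (norm_nonneg _), norm_inv,
          Complex.norm_real, Real.norm_eq_abs, inv_mul_cancel₀ (abs_ne_zero.2 (hk0 n))]
        simp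
  have hDm : ∀ n, MemLp (D n) 2 volume := fun n =>
    ⟨(hDc n).aestronglyMeasurable, (hDn n).trans_lt ENNReal.coe_lt_top⟩
  have hhn : ∀ n, ‖(hDm n).toLp (D n)‖ ≤ K := fun n => by
    rw [Lp.norm_toLp]
    exact ENNReal.toReal_le_of_le_ofReal K.2 (by simpa using hDn n)
  obtain ⟨g, hgn, hten⟩ := exists_weak_limit hhn
  have hgm : MemLp (g : ℝ → C2) 2 volume := Lp.memLp g
  refine ⟨g, ⟨hfc.locallyIntegrable, hgm.locallyIntegrable (by norm_num), ?_⟩, hgm, ?_⟩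
  · intro φ hφ hc
    have hd : Continuous (deriv φ) := hφ.continuous_deriv (by simp)
    have i1 : Integrable (fun x => deriv φ x • f x) :=
      integrable_testFunction_smul hd hc.deriv hfc.locallyIntegrable
    have i2 : Integrable (fun x => φ x • (g : ℝ → C2) x) :=
      integrable_testFunction_smul hφ.continuous hc (hgm.locallyIntegrable (by norm_num))
    ext i
    rw [PiLp.neg_apply, integral_C2_apply i1, integral_C2_apply i2]
    -- The inner product is conjugate linear in its first slot, so both limits are computed for the
    -- conjugated component and conjugated back at the end.
    have hfi : Continuous (fun z => starRingEnd ℂ (f z i)) := by fun_prop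
    have hΦc : Continuous (fun z => (φ z : ℂ) • EuclideanSpace.single i (1 : ℂ)) := by
      have := hφ.continuous; fun_prop
    have hΦm : MemLp (fun z => (φ z : ℂ) • (EuclideanSpace.single i (1 : ℂ) : C2)) 2 volume := by
      refine hΦc.memLp_of_hasCompactSupport ?_
      exact (hc.comp_left (g := fun r : ℝ => (r : ℂ)) Complex.ofReal_zero).smul_right
    have lim1 := hten (hΦm.toLp _)
    have lim2 := (tendsto_integral_diffQuotient hφ hc hfi hk0 hk1 hkt).mono_left
      Nat.hyperfilter_le_atTop
    have e1 : ∀ n, inner ℂ ((hDm n).toLp (D n)) (hΦm.toLp _) =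
        ∫ z, (φ z : ℂ) * ((k n : ℂ)⁻¹ * (starRingEnd ℂ (f (z + k n) i) - starRingEnd ℂ (f z i))) := by
      intro n
      rw [L2.inner_def]
      refine integral_congr_ae ?_
      filter_upwards [(hDm n).coeFn_toLp, hΦm.coeFn_toLp] with z h1 h2
      rw [h1, h2, inner_smul_right, EuclideanSpace.inner_single_right]
      simp [hD]
    have e2 : inner ℂ g (hΦm.toLp _) = ∫ z, (φ z : ℂ) * starRingEnd ℂ ((g : ℝ → C2) z i) := by
      rw [L2.inner_def]
      refine integral_congr_ae ?_
      filter_upwards [hΦm.coeFn_toLp] with z h2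
      rw [h2, inner_smul_right, EuclideanSpace.inner_single_right]
      simp
    have key := tendsto_nhds_unique (lim2.congr fun n => (e1 n).symm) lim1
    rw [e2] at key
    have c1 : ∫ z, (deriv φ z • f z) i = starRingEnd ℂ (∫ z, ((deriv φ z : ℝ) : ℂ) * starRingEnd ℂ (f z i)) := by
      rw [← integral_conj]; congr 1; ext z; simp
    have c2 : ∫ z, (φ z • (g : ℝ → C2) z) i =
        starRingEnd ℂ (∫ z, (φ z : ℂ) * starRingEnd ℂ ((g : ℝ → C2) z i)) := by
      rw [← integral_conj]; congr 1; ext z; simp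
    rw [c1, c2, ← key, map_neg, neg_neg]
  · rw [← Lp.enorm_def, ← ofReal_norm]
    exact (ENNReal.ofReal_le_ofReal hgn).trans (by simp)

theorem memH1_and_h1Norm_le_of_diffQuotient {f : ℝ → C2} (hfc : Continuous f) {K : ℝ≥0}
    (hf : eLpNorm f 2 volume ≤ K)
    (hK : ∀ k : ℝ, k ≠ 0 → eLpNorm (fun z => f (z + k) - f z) 2 volume ≤ ENNReal.ofReal |k| * K) :
    MemH1 f ∧ h1Norm f ≤ 2 * K := by
  have hm : MemLp f 2 volume := ⟨hfc.aestronglyMeasurable, hf.trans_lt ENNReal.coe_lt_top⟩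
  obtain ⟨g, hg, hgm, hgK⟩ := exists_hasWeakDeriv_of_diffQuotient hfc hK
  refine ⟨⟨hm, g, hg, hgm⟩, ?_⟩
  have h1 : l2Norm f ≤ K := ENNReal.toReal_le_of_le_ofReal K.2 (by simpa using hf)
  have h2 : l2Norm (weakDeriv f) ≤ K := by
    unfold l2Norm
    rw [eLpNorm_congr_ae hg.weakDeriv_ae_eq]
    exact ENNReal.toReal_le_of_le_ofReal K.2 (by simpa using hgK)
  have h3 : 0 ≤ l2Norm f := ENNReal.toReal_nonneg
  have h4 : 0 ≤ l2Norm (weakDeriv f) := ENNReal.toReal_nonneg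
  unfold h1Norm
  refine Real.sqrt_le_iff.2 ⟨by positivity, ?_⟩
  nlinarith [K.2]

/-! ### Grönwall's inequality with density 1/(1+y²) -/

theorem integrable_exp_arctan (c : ℝ) :
    Integrable (fun y : ℝ => Real.exp (c * Real.arctan y) * (1 + y ^ 2)⁻¹) := by
  refine integrable_inv_one_add_sq.bdd_mul (c := Real.exp (|c| * (Real.pi / 2)))
    (by fun_prop) (Eventually.of_forall fun y => ?_)
  rw [Real.norm_eq_abs, Real.abs_exp]
  refine Real.exp_le_exp.2 ?_
  calc c * Real.arctan y ≤ |c * Real.arctan y| := le_abs_self _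
    _ = |c| * |Real.arctan y| := abs_mul _ _
    _ ≤ _ := by
      gcongr
      exact abs_le.2 ⟨(Real.neg_pi_div_two_lt_arctan y).le, (Real.arctan_lt_pi_div_two y).le⟩

/-- The arctangent straightens the density 1/(1+y²), and e^{c arctan}/c is an explicit
antiderivative, positive at -∞. Integrating the exponential weight gains a factor 1/c, which is what
makes the Volterra operator small in the weighted norm. -/
theorem setIntegral_exp_arctan_le {c : ℝ} (hc : 0 < c) (x : ℝ) :
    ∫ y in Iic x, Real.exp (c * Real.arctan y) * (1 + y ^ 2)⁻¹ ≤
      Real.exp (c * Real.arctan x) / c := by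
  have hd : ∀ y, HasDerivAt (fun y => Real.exp (c * Real.arctan y) / c)
      (Real.exp (c * Real.arctan y) * (1 + y ^ 2)⁻¹) y := fun y => by
    convert! (((Real.hasDerivAt_arctan y).const_mul c).exp.div_const c) using 1
    field_simp
  have ht : Tendsto (fun y => Real.exp (c * Real.arctan y) / c) atBot
      (𝓝 (Real.exp (c * -(Real.pi / 2)) / c)) := by
    have h := Real.tendsto_arctan_atBot.mono_right nhdsWithin_le_nhds
    exact ((Real.continuous_exp.tendsto _).comp (h.const_mul c)).div_const c
  rw [integral_Iic_of_hasDerivAt_of_tendsto (hd x).continuousAt.continuousWithinAt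
    (fun y _ => hd y) (integrable_exp_arctan c).integrableOn ht]
  have : 0 < Real.exp (c * -(Real.pi / 2)) / c := by positivity
  linarith

theorem setLIntegral_exp_arctan_le {c : ℝ} (hc : 0 < c) (x : ℝ) :
    ∫⁻ y in Iic x, ENNReal.ofReal (Real.exp (c * Real.arctan y) * (1 + y ^ 2)⁻¹) ≤
      ENNReal.ofReal (Real.exp (c * Real.arctan x) / c) := by
  rw [← ofReal_integral_eq_lintegral_ofReal (integrable_exp_arctan c).integrableOn
    (Eventually.of_forall fun y => by positivity)]
  exact ENNReal.ofReal_le_ofReal (setIntegral_exp_arctan_le hc x)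

/-- Grönwall's inequality on a half-line with the density `1 / (1 + y ^ 2)`. -/
theorem gronwall_half_line {G : ℝ → ℝ≥0∞} {A M : ℝ≥0∞} {κ : ℝ≥0} {x₀ : ℝ} (hM : M ≠ ⊤)
    (hGM : ∀ x ≤ x₀, G x ≤ M)
    (hG : ∀ x ≤ x₀, G x ≤ A + κ * ∫⁻ y in Iic x, ENNReal.ofReal ((1 + y ^ 2)⁻¹) * G y) :
    G x₀ ≤ 2 * A * ENNReal.ofReal (Real.exp ((2 * κ + 1) * Real.pi)) := by
  -- With this c one has κ/c ≤ 1/2, so the integral term costs at most half of the weighted supremum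
  -- S.
  set c : ℝ := 2 * κ + 1 with hc
  have hc0 : 0 < c := by positivity
  set w : ℝ → ℝ := fun x => Real.exp (c * Real.arctan x) with hw
  have hw0 : ∀ x, 0 < w x := fun x => Real.exp_pos _
  have hwinv : ∀ x, ENNReal.ofReal (w x) * ENNReal.ofReal (w x)⁻¹ = 1 := fun x => by
    rw [← ENNReal.ofReal_mul (hw0 x).le, mul_inv_cancel₀ (hw0 x).ne', ENNReal.ofReal_one]
  have hwle : ∀ x, (w x)⁻¹ ≤ Real.exp (c * (Real.pi / 2)) := fun x => by
    rw [hw, ← Real.exp_neg]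
    gcongr
    nlinarith [Real.neg_pi_div_two_lt_arctan x]
  set E := ENNReal.ofReal (Real.exp (c * (Real.pi / 2))) with hE
  set S : ℝ≥0∞ := ⨆ x : Iic x₀, G x * ENNReal.ofReal (w x)⁻¹ with hS
  have hSM : S ≤ M * E := by
    refine iSup_le fun x => ?_
    gcongr
    · exact hGM x x.2
    · exact ENNReal.ofReal_le_ofReal (hwle x)
  have hSfin : S ≠ ⊤ := ne_top_of_le_ne_top (ENNReal.mul_ne_top hM ENNReal.ofReal_ne_top) hSM
  have hGS : ∀ x ≤ x₀, G x ≤ S * ENNReal.ofReal (w x) := fun x hx => by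
    calc G x = G x * ENNReal.ofReal (w x)⁻¹ * ENNReal.ofReal (w x) := by
          rw [mul_assoc, mul_comm (ENNReal.ofReal (w x)⁻¹), hwinv, mul_one]
      _ ≤ _ := by
          gcongr
          exact le_iSup (fun x : Iic x₀ => G x * ENNReal.ofReal (w x)⁻¹) ⟨x, hx⟩
  have hint : ∀ x ≤ x₀, ∫⁻ y in Iic x, ENNReal.ofReal ((1 + y ^ 2)⁻¹) * G y ≤
      S * ENNReal.ofReal (w x / c) := fun x hx => by
    calc _ ≤ ∫⁻ y in Iic x, S * ENNReal.ofReal (w y * (1 + y ^ 2)⁻¹) := by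
          refine setLIntegral_mono' measurableSet_Iic fun y hy => ?_
          rw [ENNReal.ofReal_mul (hw0 y).le, mul_comm, ← mul_assoc]
          gcongr
          exact hGS y (le_trans hy hx)
      _ = S * ∫⁻ y in Iic x, ENNReal.ofReal (w y * (1 + y ^ 2)⁻¹) :=
          lintegral_const_mul' _ _ hSfin
      _ ≤ _ := by gcongr; exact setLIntegral_exp_arctan_le hc0 x
  have hSle : S ≤ A * E + S / 2 := by
    refine iSup_le fun ⟨x, hx⟩ => ?_
    calc G x * ENNReal.ofReal (w x)⁻¹
        ≤ (A + κ * (S * ENNReal.ofReal (w x / c))) * ENNReal.ofReal (w x)⁻¹ := by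
          gcongr
          refine (hG x hx).trans ?_
          gcongr
          exact hint x hx
      _ = A * ENNReal.ofReal (w x)⁻¹ + S * ENNReal.ofReal (κ / c) := by
          rw [add_mul]
          congr 1
          rw [show (κ : ℝ≥0∞) = ENNReal.ofReal κ by simp, mul_assoc, mul_assoc,
            ← ENNReal.ofReal_mul (by have := hw0 x; positivity), mul_left_comm,
            ← ENNReal.ofReal_mul (by positivity)]
          congr 2
          have := (hw0 x).ne'
          field_simp
      _ ≤ _ := by
          rw [ENNReal.div_eq_inv_mul, mul_comm 2⁻¹]
          gcongr
          · exact ENNReal.ofReal_le_ofReal (hwle x)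
          · rw [show (2 : ℝ≥0∞)⁻¹ = ENNReal.ofReal (1 / 2) by
              rw [one_div, ENNReal.ofReal_inv_of_pos (by norm_num)]; simp]
            refine ENNReal.ofReal_le_ofReal ?_
            rw [div_le_div_iff₀ hc0 (by norm_num), hc]; linarith
  -- The term S/2 can be cancelled because S is finite, which comes from the a priori bound by M.
  have hS2 : S ≤ 2 * (A * E) := by
    have h2 : S / 2 + S / 2 ≤ A * E + S / 2 := by rwa [ENNReal.add_halves]
    have h3 := (ENNReal.add_le_add_iff_right (ENNReal.div_ne_top hSfin (by norm_num))).1 h2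
    calc S = 2 * (S / 2) := by rw [ENNReal.mul_div_cancel (by norm_num) (by norm_num)]
      _ ≤ _ := by gcongr
  calc G x₀ ≤ S * ENNReal.ofReal (w x₀) := hGS x₀ le_rfl
    _ ≤ 2 * (A * E) * E := by
        gcongr
        refine ENNReal.ofReal_le_ofReal (Real.exp_le_exp.2 ?_)
        gcongr
        exact (Real.arctan_lt_pi_div_two _).le
    _ = _ := by
        rw [mul_assoc, mul_assoc, hE, ← ENNReal.ofReal_mul (by positivity), ← Real.exp_add,
          mul_assoc]
        congr 4; ring

/-! ### Matrix kernels and weighted Cauchy–Schwarz -/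

theorem eLpNorm_two_sq {α E : Type*} [MeasurableSpace α] [NormedAddCommGroup E] (g : α → E)
    (ν : Measure α) : eLpNorm g 2 ν ^ 2 = ∫⁻ z, ‖g z‖ₑ ^ 2 ∂ν := by
  rw [eLpNorm_eq_lintegral_rpow_enorm_toReal (by norm_num) (by norm_num)]
  simp only [ENNReal.toReal_ofNat, ENNReal.rpow_ofNat]
  rw [← ENNReal.rpow_natCast, ← ENNReal.rpow_mul]
  norm_num

theorem le_of_sq_le_sq {a b : ℝ≥0∞} (h : a ^ 2 ≤ b ^ 2) : a ≤ b := by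
  by_contra hc
  exact absurd h (not_le.2 (ENNReal.pow_lt_pow_left (by norm_num) (not_le.1 hc)))

/-- The Cauchy–Schwarz inequality with a weight. -/
theorem sq_lintegral_mul_le {α : Type*} [MeasurableSpace α] {ν : Measure α} {q ρ s : α → ℝ≥0∞}
    (hq : AEMeasurable q ν) (hρ : AEMeasurable ρ ν) (hs : AEMeasurable s ν)
    (h0 : ∀ y, s y ≠ 0) (ht : ∀ y, s y ≠ ⊤) :
    (∫⁻ y, q y * ρ y ∂ν) ^ 2 ≤ (∫⁻ y, (s y * q y) ^ 2 ∂ν) * ∫⁻ y, ((s y)⁻¹ * ρ y) ^ 2 ∂ν := by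
  have h := ENNReal.lintegral_mul_le_Lp_mul_Lq ν Real.HolderConjugate.two_two (hs.mul hq)
    (hs.inv.mul hρ)
  have e : ∫⁻ y, q y * ρ y ∂ν =
      ∫⁻ y, ((fun y => s y * q y) * fun y => (s y)⁻¹ * ρ y) y ∂ν := by
    congr 1; ext y
    simp only [Pi.mul_apply]
    calc q y * ρ y = (s y * (s y)⁻¹) * (q y * ρ y) := by
          rw [ENNReal.mul_inv_cancel (h0 y) (ht y), one_mul]
      _ = _ := by ring
  rw [e]
  refine (pow_le_pow_left' h 2).trans (le_of_eq ?_)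
  simp only [ENNReal.rpow_ofNat, Pi.mul_apply, Pi.inv_apply]
  rw [mul_pow, ← ENNReal.rpow_natCast, ← ENNReal.rpow_natCast, ← ENNReal.rpow_mul,
    ← ENNReal.rpow_mul]
  norm_num

/-- Complex `2 × 2` matrices. -/
abbrev M2 := Matrix (Fin 2) (Fin 2) ℂ

/-- The integrand `diag(1, e^{2izt}) A v` of the Volterra operators. -/
noncomputable def vker (z t : ℝ) (A : M2) (v : C2) : C2 :=
  WithLp.toLp 2 ((expM z t * A) *ᵥ v.ofLp)

theorem vker_eq (z t : ℝ) (A : M2) (v : C2) :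
    vker z t A v = (A 0 0 * v 0 + A 0 1 * v 1) • e1 +
      (phase z t * (A 1 0 * v 0 + A 1 1 * v 1)) • e2 := by
  ext i
  fin_cases i
  · simp [vker, e1, e2, expM, phase, Matrix.vecMul, dotProduct, Fin.sum_univ_two]
  · simp [vker, e1, e2, expM, phase, Matrix.vecMul, dotProduct, Fin.sum_univ_two]; ring

theorem vker_sub_left (z t : ℝ) (A B : M2) (v : C2) :
    vker z t (A - B) v = vker z t A v - vker z t B v := by
  simp only [vker_eq, Matrix.sub_apply]; module

theorem vker_smul_left (z t : ℝ) (c : ℂ) (A : M2) (v : C2) :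
    vker z t (c • A) v = c • vker z t A v := by
  simp only [vker_eq, Matrix.smul_apply, smul_eq_mul]; module

theorem vker_add (z t : ℝ) (A : M2) (v w : C2) :
    vker z t A (v + w) = vker z t A v + vker z t A w := by
  simp only [vker_eq, PiLp.add_apply]; module

theorem vker_sub (z t : ℝ) (A : M2) (v w : C2) :
    vker z t A (v - w) = vker z t A v - vker z t A w := by
  simp only [vker_eq, PiLp.sub_apply]; module

theorem vker_smul (z t : ℝ) (A : M2) (c : ℂ) (v : C2) :
    vker z t A (c • v) = c • vker z t A v := by
  simp only [vker_eq, PiLp.smul_apply, smul_eq_mul]; module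

@[simp] theorem norm_e1 : ‖e1‖ = 1 := by simp [e1, EuclideanSpace.norm_eq, Fin.sum_univ_two]

@[simp] theorem norm_e2 : ‖e2‖ = 1 := by simp [e2, EuclideanSpace.norm_eq, Fin.sum_univ_two]

/-- The sum of the moduli of the entries. -/
noncomputable def entryNorm (A : M2) : ℝ := ‖A 0 0‖ + ‖A 0 1‖ + ‖A 1 0‖ + ‖A 1 1‖

theorem entryNorm_nonneg (A : M2) : 0 ≤ entryNorm A := by unfold entryNorm; positivity

theorem norm_apply_le_entryNorm (A : M2) (i j : Fin 2) : ‖A i j‖ ≤ entryNorm A := by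
  have h1 := norm_nonneg (A 0 0)
  have h2 := norm_nonneg (A 0 1)
  have h3 := norm_nonneg (A 1 0)
  have h4 := norm_nonneg (A 1 1)
  unfold entryNorm
  fin_cases i <;> fin_cases j <;> simp only [Fin.zero_eta, Fin.mk_one] <;> linarith

theorem norm_vker_le (z t : ℝ) (A : M2) (v : C2) : ‖vker z t A v‖ ≤ entryNorm A * ‖v‖ := by
  rw [vker_eq]
  refine (norm_add_le _ _).trans ?_
  rw [norm_smul, norm_smul, norm_e1, norm_e2, norm_mul, norm_phase, one_mul, mul_one, mul_one]
  have h0 : ‖v 0‖ ≤ ‖v‖ := PiLp.norm_apply_le v 0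
  have h1 : ‖v 1‖ ≤ ‖v‖ := PiLp.norm_apply_le v 1
  calc _ ≤ (‖A 0 0‖ * ‖v 0‖ + ‖A 0 1‖ * ‖v 1‖) + (‖A 1 0‖ * ‖v 0‖ + ‖A 1 1‖ * ‖v 1‖) := by
        gcongr <;> refine (norm_add_le _ _).trans_eq (by rw [norm_mul, norm_mul])
    _ ≤ (‖A 0 0‖ * ‖v‖ + ‖A 0 1‖ * ‖v‖) + (‖A 1 0‖ * ‖v‖ + ‖A 1 1‖ * ‖v‖) := by gcongr
    _ = _ := by unfold entryNorm; ring

/-- The weight `⟨y⟩`. -/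
noncomputable def wt (y : ℝ) : ℝ := Real.sqrt (1 + y ^ 2)

theorem wt_pos (y : ℝ) : 0 < wt y := Real.sqrt_pos.2 (by positivity)

theorem wt_sq (y : ℝ) : wt y ^ 2 = 1 + y ^ 2 := Real.sq_sqrt (by positivity)

theorem continuous_wt : Continuous wt := by unfold wt; fun_prop

theorem abs_le_wt (y : ℝ) : |y| ≤ wt y := by
  rw [← Real.sqrt_sq_eq_abs]; exact Real.sqrt_le_sqrt (by linarith)

theorem one_le_wt (y : ℝ) : 1 ≤ wt y := by
  unfold wt; rw [Real.one_le_sqrt]; nlinarith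

/-- Measurability of the entries of a matrix-valued function. -/
def MeasEntries (P : ℝ → M2) : Prop := ∀ i j, Measurable fun y => P y i j

/-- The weighted `L²` norm of a matrix-valued function. -/
noncomputable def wN (P : ℝ → M2) : ℝ≥0∞ :=
  eLpNorm (fun y => wt y * entryNorm (P y)) 2 volume

theorem MeasEntries.entryNorm {P : ℝ → M2} (hP : MeasEntries P) :
    Measurable fun y => entryNorm (P y) := by
  have h1 := hP 0 0
  have h2 := hP 0 1
  have h3 := hP 1 0
  have h4 := hP 1 1
  unfold KaupNewell.entryNorm; fun_prop

theorem MeasEntries.sub {P Q : ℝ → M2} (hP : MeasEntries P) (hQ : MeasEntries Q) :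
    MeasEntries (P - Q) := fun i j => (hP i j).sub (hQ i j)

theorem memLp_inv_wt : MemLp (fun y => (wt y)⁻¹) 2 (volume : Measure ℝ) := by
  rw [memLp_two_iff_integrable_sq (by
    exact (continuous_wt.inv₀ fun y => (wt_pos y).ne').aestronglyMeasurable)]
  simpa only [inv_pow, wt_sq] using integrable_inv_one_add_sq

/-- Cauchy–Schwarz against ⟨y⟩⁻¹, which is square integrable: one weight in L² buys integrability.
-/
theorem integrable_of_weighted {g : ℝ → ℝ} (hg : Measurable g)
    (h : eLpNorm (fun y => wt y * g y) 2 volume < ⊤) : Integrable g := by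
  have h1 : MemLp (fun y => wt y * g y) 2 volume :=
    ⟨(continuous_wt.measurable.mul hg).aestronglyMeasurable, h⟩
  refine (memLp_inv_wt.integrable_mul h1).congr (Eventually.of_forall fun y => ?_)
  simp only [Pi.mul_apply]
  rw [← mul_assoc, inv_mul_cancel₀ (wt_pos y).ne', one_mul]

theorem integrable_entryNorm {P : ℝ → M2} (hP : MeasEntries P) (hw : wN P < ⊤) :
    Integrable fun y => entryNorm (P y) := integrable_of_weighted hP.entryNorm hw

theorem aestronglyMeasurable_vker {P : ℝ → M2} (hP : MeasEntries P) {ν : Measure ℝ} {g : ℝ → C2}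
    (hg : AEStronglyMeasurable g ν) (z x : ℝ) :
    AEStronglyMeasurable (fun y => vker z (x - y) (P y) (g y)) ν := by
  have hc : ∀ i, AEStronglyMeasurable (fun y => g y i) ν := fun i =>
    (EuclideanSpace.proj (𝕜 := ℂ) i).continuous.comp_aestronglyMeasurable hg
  have hp : ∀ i j, AEStronglyMeasurable (fun y => P y i j) ν := fun i j =>
    (hP i j).aestronglyMeasurable
  have hph : AEStronglyMeasurable (fun y => phase z (x - y)) ν :=
    (by unfold phase; fun_prop : Continuous fun y => phase z (x - y)).aestronglyMeasurable
  simp only [vker_eq]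
  exact ((((hp 0 0).mul (hc 0)).add ((hp 0 1).mul (hc 1))).smul_const e1).add
    ((hph.mul (((hp 1 0).mul (hc 0)).add ((hp 1 1).mul (hc 1)))).smul_const e2)

theorem integrable_vker {P : ℝ → M2} (hP : MeasEntries P) (hw : wN P < ⊤) {s : Set ℝ} {g : ℝ → C2}
    (hg : AEStronglyMeasurable g (volume.restrict s)) {M : ℝ} (hM : ∀ᵐ y ∂volume.restrict s, ‖g y‖ ≤ M)
    (z x : ℝ) : IntegrableOn (fun y => vker z (x - y) (P y) (g y)) s := by
  refine Integrable.mono' (((integrable_entryNorm hP hw).integrableOn (s := s)).mul_const M)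
    (aestronglyMeasurable_vker hP hg z x) ?_
  filter_upwards [hM] with y hy
  refine (norm_vker_le _ _ _ _).trans ?_
  gcongr
  exact entryNorm_nonneg _

/-- The Volterra operator `f ↦ ∫_{-∞}^x diag(1, e^{2iz(x-y)}) P(y) f(y, z) dy`. -/
noncomputable def vint (P : ℝ → M2) (f : ℝ → ℝ → C2) (x z : ℝ) : C2 :=
  ∫ y in Iic x, vker z (x - y) (P y) (f y z)

theorem enorm_setIntegral_vker_le (P : ℝ → M2) (g : ℝ → C2) (x z : ℝ) :
    ‖∫ y in Iic x, vker z (x - y) (P y) (g y)‖ₑ ≤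
      ∫⁻ y in Iic x, ENNReal.ofReal (entryNorm (P y)) * ‖g y‖ₑ := by
  refine (enorm_integral_le_lintegral_enorm _).trans (lintegral_mono fun y => ?_)
  rw [← ofReal_norm, ← ofReal_norm, ← ENNReal.ofReal_mul (entryNorm_nonneg _)]
  exact ENNReal.ofReal_le_ofReal (norm_vker_le _ _ _ _)

theorem wN_sq (P : ℝ → M2) :
    wN P ^ 2 = ∫⁻ y, (ENNReal.ofReal (wt y) * ENNReal.ofReal (entryNorm (P y))) ^ 2 := by
  unfold wN
  rw [eLpNorm_two_sq]
  congr 1; ext y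
  rw [← ENNReal.ofReal_mul (wt_pos y).le, ← ofReal_norm, Real.norm_of_nonneg
    (mul_nonneg (wt_pos y).le (entryNorm_nonneg _))]

theorem ofReal_wt_inv_sq (y : ℝ) :
    (ENNReal.ofReal (wt y))⁻¹ ^ 2 = ENNReal.ofReal ((1 + y ^ 2)⁻¹) := by
  rw [← ENNReal.ofReal_inv_of_pos (wt_pos y), ← ENNReal.ofReal_pow (by have := wt_pos y; positivity), inv_pow,
    wt_sq]

theorem ofReal_wt_ne_zero (y : ℝ) : ENNReal.ofReal (wt y) ≠ 0 := by
  simpa using wt_pos y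

/-- In Cauchy–Schwarz the potential takes the weight ⟨y⟩ and the other factor is left with ⟨y⟩⁻² =
1/(1+y²), which is the density in `gronwall_half_line`. -/
theorem sq_setLIntegral_entryNorm_mul_le {P : ℝ → M2} (hP : MeasEntries P) {ρ : ℝ → ℝ≥0∞} {x : ℝ}
    (hρ : AEMeasurable ρ (volume.restrict (Iic x))) :
    (∫⁻ y in Iic x, ENNReal.ofReal (entryNorm (P y)) * ρ y) ^ 2 ≤
      wN P ^ 2 * ∫⁻ y in Iic x, ENNReal.ofReal ((1 + y ^ 2)⁻¹) * ρ y ^ 2 := by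
  refine (sq_lintegral_mul_le (s := fun y => ENNReal.ofReal (wt y))
    hP.entryNorm.ennreal_ofReal.aemeasurable hρ
    continuous_wt.measurable.ennreal_ofReal.aemeasurable ofReal_wt_ne_zero
    (fun y => ENNReal.ofReal_ne_top)).trans ?_
  rw [wN_sq]
  simp only [mul_pow, ofReal_wt_inv_sq]
  gcongr
  exact Measure.restrict_le_self

/-! ### Existence and uniqueness for the Volterra equation -/

/-- A bounded solution of the homogeneous Volterra equation vanishes. -/
theorem eq_zero_of_homogeneous {P : ℝ → M2} (hP : MeasEntries P) (hw : wN P < ⊤) {g : ℝ → C2}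
    (hg : MemLp g ⊤ volume) {z : ℝ}
    (h : ∀ x, g x = ∫ y in Iic x, vker z (x - y) (P y) (g y)) (x : ℝ) : g x = 0 := by
  set κ : ℝ≥0 := (wN P ^ 2).toNNReal with hκ
  have hκ' : (κ : ℝ≥0∞) = wN P ^ 2 := ENNReal.coe_toNNReal (ENNReal.pow_ne_top hw.ne)
  set M := eLpNorm g ⊤ volume with hM
  have hgM : ∀ᵐ y, ‖g y‖ₑ ≤ M := by
    rw [hM, eLpNorm_exponent_top]; exact enorm_ae_le_eLpNormEssSup g volume
  -- The function g is only essentially bounded; the equation itself upgrades this to a bound at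
  -- every x, which Grönwall requires.
  have hb : ∀ x, ‖g x‖ₑ ≤ (∫⁻ y, ENNReal.ofReal (entryNorm (P y))) * M := fun x => by
    rw [h x]
    refine (enorm_setIntegral_vker_le _ _ _ _).trans ?_
    rw [← lintegral_mul_const' _ _ hg.2.ne]
    refine (setLIntegral_le_lintegral _ _).trans (lintegral_mono_ae ?_)
    filter_upwards [hgM] with y hy
    gcongr
  have hfin : (∫⁻ y, ENNReal.ofReal (entryNorm (P y))) * M ≠ ⊤ := by
    refine ENNReal.mul_ne_top ?_ hg.2.ne
    have := (integrable_entryNorm hP hw).2.ne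
    refine ne_top_of_le_ne_top this (lintegral_mono fun y => ?_)
    rw [← ofReal_norm]
    exact ENNReal.ofReal_le_ofReal (le_abs_self _)
  have key := gronwall_half_line (G := fun x => ‖g x‖ₑ ^ 2) (A := 0) (κ := κ) (x₀ := x)
    (ENNReal.pow_ne_top (n := 2) hfin) (fun y _ => by gcongr; exact hb y) (fun y _ => by
      rw [zero_add, hκ']
      refine le_trans ?_ (sq_setLIntegral_entryNorm_mul_le hP hg.1.restrict.enorm)
      gcongr
      nth_rw 1 [h y]
      exact enorm_setIntegral_vker_le _ _ _ _)
  simpa using key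

theorem continuous_vint {P : ℝ → M2} (hP : MeasEntries P) (hw : wN P < ⊤) {f : ℝ → ℝ → C2}
    (hf : Continuous (Function.uncurry f)) {M : ℝ} (hM : ∀ y z, ‖f y z‖ ≤ M) :
    Continuous fun p : ℝ × ℝ => vint P f p.1 p.2 := by
  have hfz : ∀ z, Continuous fun y => f y z := fun z =>
    hf.comp (by fun_prop : Continuous fun y => (y, z))
  have e : (fun p : ℝ × ℝ => vint P f p.1 p.2) = fun p => ∫ y, (Iic p.1).indicator
      (fun y => vker p.2 (p.1 - y) (P y) (f y p.2)) y := by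
    ext1 p; rw [integral_indicator measurableSet_Iic]; rfl
  rw [e, continuous_iff_continuousAt]
  intro p₀
  refine continuousAt_of_dominated (bound := fun y => entryNorm (P y) * M) ?_ ?_ ?_ ?_
  · exact Eventually.of_forall fun p =>
      (aestronglyMeasurable_vker hP (hfz p.2).aestronglyMeasurable _ _).indicator measurableSet_Iic
  · refine Eventually.of_forall fun p => Eventually.of_forall fun y => ?_
    refine (norm_indicator_le_norm_self _ _).trans ((norm_vker_le _ _ _ _).trans ?_)
    gcongr
    · exact entryNorm_nonneg _
    · exact hM _ _
  · exact (integrable_entryNorm hP hw).mul_const M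
  · have h0 : ∀ᵐ y : ℝ, y ≠ p₀.1 := by simp [ae_iff, measure_singleton]
    filter_upwards [h0] with y hy
    rcases lt_or_gt_of_ne hy with hlt | hgt
    · have hc : ContinuousAt (fun p : ℝ × ℝ => vker p.2 (p.1 - y) (P y) (f y p.2)) p₀ := by
        have h1 : Continuous fun p : ℝ × ℝ => f y p.2 :=
          hf.comp (by fun_prop : Continuous fun p : ℝ × ℝ => (y, p.2))
        have h2 : ∀ i, Continuous fun p : ℝ × ℝ => f y p.2 i := fun i =>
          (EuclideanSpace.proj (𝕜 := ℂ) i).continuous.comp h1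
        have h3 : Continuous fun p : ℝ × ℝ => phase p.2 (p.1 - y) := by
          unfold phase; fun_prop
        have h20 := h2 0
        have h21 := h2 1
        simp only [vker_eq]
        exact Continuous.continuousAt (by fun_prop)
      refine hc.congr ?_
      filter_upwards [continuous_fst.continuousAt.eventually (lt_mem_nhds hlt)] with p hp
      rw [indicator_of_mem (mem_Iic.2 hp.le)]
    · refine (continuousAt_const (y := (0 : C2))).congr ?_
      filter_upwards [continuous_fst.continuousAt.eventually (gt_mem_nhds hgt)] with p hp
      rw [indicator_of_notMem (by simpa using hp)]

/-- The bounded continuous solutions, jointly in `x` and `z`, of the Volterra equation normalized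
by `e₁` at `-∞`. -/
structure IsSol (P : ℝ → M2) (m : ℝ → ℝ → C2) : Prop where
  cont : Continuous (Function.uncurry m)
  bdd : ∃ M, ∀ x z, ‖m x z‖ ≤ M
  eq : ∀ x z, m x z = e1 + vint P m x z

/-- This is the contraction estimate. After squaring, the weighted Cauchy–Schwarz inequality and
`setLIntegral_exp_arctan_le` at rate 2c leave the factor κ/(2c), and the choice of c makes it at
most 1/4; the square root gives the factor 1/2. -/
theorem norm_setIntegral_vker_exp_le {P : ℝ → M2} (hP : MeasEntries P) (hw : wN P < ⊤) {c : ℝ}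
    (hc : c = 2 * (wN P ^ 2).toNNReal + 1) {v : ℝ → C2} (hv : Continuous v) {D : ℝ} (hD : 0 ≤ D)
    (hvD : ∀ y, ‖v y‖ ≤ D) (x z : ℝ) :
    ‖∫ y in Iic x, vker z (x - y) (P y) (Real.exp (c * Real.arctan y) • v y)‖ ≤
      Real.exp (c * Real.arctan x) * (D / 2) := by
  set κ : ℝ≥0 := (wN P ^ 2).toNNReal with hκ
  have hκ' : (κ : ℝ≥0∞) = wN P ^ 2 := ENNReal.coe_toNNReal (ENNReal.pow_ne_top hw.ne)
  have hc0 : 0 < c := by rw [hc]; positivity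
  have hm : AEMeasurable (fun y => ‖Real.exp (c * Real.arctan y) • v y‖ₑ)
      (volume.restrict (Iic x)) :=
    (by fun_prop : Continuous fun y => Real.exp (c * Real.arctan y) • v y).measurable.enorm.aemeasurable
  have h1 : ‖∫ y in Iic x, vker z (x - y) (P y) (Real.exp (c * Real.arctan y) • v y)‖ₑ ^ 2 ≤
      ENNReal.ofReal ((Real.exp (c * Real.arctan x) * (D / 2)) ^ 2) := by
    calc _ ≤ (∫⁻ y in Iic x, ENNReal.ofReal (entryNorm (P y)) *
          ‖Real.exp (c * Real.arctan y) • v y‖ₑ) ^ 2 := by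
          gcongr; exact enorm_setIntegral_vker_le _ _ _ _
      _ ≤ _ := sq_setLIntegral_entryNorm_mul_le hP hm
      _ ≤ wN P ^ 2 * ∫⁻ y in Iic x, ENNReal.ofReal (D ^ 2) *
          ENNReal.ofReal (Real.exp ((2 * c) * Real.arctan y) * (1 + y ^ 2)⁻¹) := by
          refine mul_le_mul' le_rfl (lintegral_mono fun y => ?_)
          rw [← ofReal_norm, ← ENNReal.ofReal_pow (norm_nonneg _),
            ← ENNReal.ofReal_mul (by positivity), ← ENNReal.ofReal_mul (by positivity)]
          refine ENNReal.ofReal_le_ofReal ?_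
          rw [norm_smul, Real.norm_eq_abs, Real.abs_exp, mul_pow,
            show (2 * c) * Real.arctan y = c * Real.arctan y + c * Real.arctan y by ring,
            Real.exp_add, ← sq]
          have : ‖v y‖ ^ 2 ≤ D ^ 2 := by gcongr; exact hvD y
          calc _ = ‖v y‖ ^ 2 * ((1 + y ^ 2)⁻¹ * Real.exp (c * Real.arctan y) ^ 2) := by ring
            _ ≤ D ^ 2 * ((1 + y ^ 2)⁻¹ * Real.exp (c * Real.arctan y) ^ 2) := by gcongr
            _ = _ := by ring
      _ = ENNReal.ofReal κ * (ENNReal.ofReal (D ^ 2) * ∫⁻ y in Iic x,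
          ENNReal.ofReal (Real.exp ((2 * c) * Real.arctan y) * (1 + y ^ 2)⁻¹)) := by
          rw [lintegral_const_mul' _ _ ENNReal.ofReal_ne_top, ← hκ', ENNReal.ofReal_coe_nnreal]
      _ ≤ ENNReal.ofReal κ * (ENNReal.ofReal (D ^ 2) *
          ENNReal.ofReal (Real.exp ((2 * c) * Real.arctan x) / (2 * c))) := by
          gcongr
          exact setLIntegral_exp_arctan_le (by positivity) x
      _ ≤ _ := by
          rw [← ENNReal.ofReal_mul (by positivity), ← ENNReal.ofReal_mul (by positivity)]
          refine ENNReal.ofReal_le_ofReal ?_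
          rw [show (2 * c) * Real.arctan x = c * Real.arctan x + c * Real.arctan x by ring,
            Real.exp_add, ← sq, mul_pow]
          have : (κ : ℝ) / (2 * c) ≤ 1 / 4 := by
            rw [div_le_div_iff₀ (by positivity) (by norm_num), hc]; linarith
          calc _ = (κ / (2 * c)) * (D ^ 2 * Real.exp (c * Real.arctan x) ^ 2) := by ring
            _ ≤ (1 / 4) * (D ^ 2 * Real.exp (c * Real.arctan x) ^ 2) := by gcongr
            _ = _ := by ring
  rw [← ofReal_norm, ← ENNReal.ofReal_pow (norm_nonneg _),
    ENNReal.ofReal_le_ofReal_iff (by positivity)] at h1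
  exact (pow_le_pow_iff_left₀ (norm_nonneg _) (by positivity) two_ne_zero).1 h1

/-- Banach's fixed point theorem for g = e^{-c arctan x} m. Working in the bounded continuous
functions of the pair (x, z), rather than separately for each z, makes joint continuity part of the
result; the later measurability and Tonelli arguments rely on it. -/
theorem exists_isSol {P : ℝ → M2} (hP : MeasEntries P) (hw : wN P < ⊤) : ∃ m, IsSol P m := by
  set c : ℝ := 2 * (wN P ^ 2).toNNReal + 1 with hc
  have hc0 : 0 < c := by positivity
  set w : ℝ → ℝ := fun x => Real.exp (c * Real.arctan x) with hwdef
  set E : ℝ := Real.exp (c * (Real.pi / 2)) with hE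
  have hw0 : ∀ x, 0 < w x := fun x => Real.exp_pos _
  have hwE : ∀ x, w x ≤ E := fun x => by
    refine Real.exp_le_exp.2 ?_
    gcongr; exact (Real.arctan_lt_pi_div_two _).le
  have hwinv : ∀ x, (w x)⁻¹ ≤ E := fun x => by
    rw [hwdef, ← Real.exp_neg]
    refine Real.exp_le_exp.2 ?_
    nlinarith [Real.neg_pi_div_two_lt_arctan x]
  have hwc : Continuous w := by fun_prop
  have hcont : ∀ g : (ℝ × ℝ) →ᵇ C2, Continuous (Function.uncurry fun y z => w y • g (y, z)) :=
    fun g => by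
      have : (Function.uncurry fun y z => w y • g (y, z)) = fun p : ℝ × ℝ => w p.1 • g p := by
        ext1 p; rfl
      rw [this]; fun_prop
  have hbd : ∀ g : (ℝ × ℝ) →ᵇ C2, ∀ y z, ‖w y • g (y, z)‖ ≤ E * ‖g‖ := fun g y z => by
    rw [norm_smul, Real.norm_of_nonneg (hw0 y).le]
    gcongr
    · exact hwE y
    · exact g.norm_coe_le_norm _
  have hv : ∀ g : (ℝ × ℝ) →ᵇ C2, ∀ x z, ‖vint P (fun y z => w y • g (y, z)) x z‖ ≤
      w x * (‖g‖ / 2) := fun g x z =>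
    norm_setIntegral_vker_exp_le hP hw hc (v := fun y => g (y, z)) (by fun_prop) (norm_nonneg _)
      (fun y => g.norm_coe_le_norm _) x z
  let T : ((ℝ × ℝ) →ᵇ C2) → ((ℝ × ℝ) →ᵇ C2) := fun g =>
    BoundedContinuousFunction.ofNormedAddCommGroup
      (fun p : ℝ × ℝ => (w p.1)⁻¹ • (e1 + vint P (fun y z => w y • g (y, z)) p.1 p.2))
      (((hwc.comp continuous_fst).inv₀ fun p => (hw0 p.1).ne').smul
        (continuous_const.add (continuous_vint hP hw (hcont g) (hbd g)))) (E * (1 + E * (‖g‖ / 2)))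
      (fun p => by
        rw [norm_smul, Real.norm_of_nonneg (inv_nonneg.2 (hw0 _).le)]
        gcongr
        · exact hwinv _
        · refine (norm_add_le _ _).trans ?_
          rw [norm_e1]
          gcongr
          refine (hv g _ _).trans ?_
          gcongr
          exact hwE _)
  have hT : ContractingWith (1 / 2) T := by
    refine ⟨by norm_num, LipschitzWith.of_dist_le_mul fun g h => ?_⟩
    rw [BoundedContinuousFunction.dist_le (by positivity)]
    intro p
    have e : T g p - T h p = (w p.1)⁻¹ • vint P (fun y z => w y • (g - h) (y, z)) p.1 p.2 := by
      change (w p.1)⁻¹ • (e1 + vint P (fun y z => w y • g (y, z)) p.1 p.2) -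
        (w p.1)⁻¹ • (e1 + vint P (fun y z => w y • h (y, z)) p.1 p.2) = _
      rw [← smul_sub, add_sub_add_left_eq_sub]
      congr 1
      unfold vint
      have hi : ∀ g : (ℝ × ℝ) →ᵇ C2, IntegrableOn (fun y => vker p.2 (p.1 - y) (P y)
          (w y • g (y, p.2))) (Iic p.1) := fun g =>
        integrable_vker hP hw (by fun_prop : Continuous fun y => w y • g (y, p.2)).aestronglyMeasurable
          (Eventually.of_forall fun y => hbd g y p.2) _ _
      rw [← integral_sub (hi g) (hi h)]
      congr 1; ext1 y
      rw [← vker_sub, ← smul_sub]; rfl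
    rw [dist_eq_norm, e, dist_eq_norm, norm_smul, Real.norm_of_nonneg (inv_nonneg.2 (hw0 _).le),
      inv_mul_le_iff₀ (hw0 _)]
    refine (hv (g - h) _ _).trans (le_of_eq ?_)
    simp only [NNReal.coe_div, NNReal.coe_one, NNReal.coe_ofNat]; ring
  have hfix := hT.fixedPoint_isFixedPt
  set g := hT.fixedPoint T with hg
  refine ⟨fun y z => w y • g (y, z), hcont g, ⟨_, hbd g⟩, fun x z => ?_⟩
  have h1 : g (x, z) = (w x)⁻¹ • (e1 + vint P (fun y z => w y • g (y, z)) x z) := by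
    conv_lhs => rw [← hfix]
    rfl
  change w x • g (x, z) = _
  rw [h1, smul_inv_smul₀ (hw0 x).ne']

/-! ### Estimates in L²_z for Volterra equations -/

theorem aestronglyMeasurable_vint {P : ℝ → M2} (hP : MeasEntries P) {f : ℝ → ℝ → C2}
    (hf : Continuous (Function.uncurry f)) (x : ℝ) (ν : Measure ℝ) [SFinite ν] :
    AEStronglyMeasurable (vint P f x) ν := by
  refine AEStronglyMeasurable.integral_prod_right' (f := fun p : ℝ × ℝ =>
    vker p.1 (x - p.2) (P p.2) (f p.2 p.1)) ?_
  have hc : ∀ i, AEStronglyMeasurable (fun p : ℝ × ℝ => f p.2 p.1 i)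
      (ν.prod (volume.restrict (Iic x))) := fun i =>
    ((EuclideanSpace.proj (𝕜 := ℂ) i).continuous.comp
      (hf.comp (by fun_prop : Continuous fun p : ℝ × ℝ => (p.2, p.1)))).aestronglyMeasurable
  have hp : ∀ i j, AEStronglyMeasurable (fun p : ℝ × ℝ => P p.2 i j)
      (ν.prod (volume.restrict (Iic x))) := fun i j =>
    ((hP i j).comp measurable_snd).aestronglyMeasurable
  have hph : AEStronglyMeasurable (fun p : ℝ × ℝ => phase p.1 (x - p.2))
      (ν.prod (volume.restrict (Iic x))) :=
    (by unfold phase; fun_prop : Continuous fun p : ℝ × ℝ => phase p.1 (x - p.2)).aestronglyMeasurable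
  simp only [vker_eq]
  exact ((((hp 0 0).mul (hc 0)).add ((hp 0 1).mul (hc 1))).smul_const e1).add
    ((hph.mul (((hp 1 0).mul (hc 0)).add ((hp 1 1).mul (hc 1)))).smul_const e2)

/-- Cauchy–Schwarz in y for each z, then Tonelli. The weight s stays free: s = ⟨y⟩ gives the
Grönwall form, and s = 1 serves potentials that are only in unweighted L². -/
theorem sq_eLpNorm_vint_le {P : ℝ → M2} (hP : MeasEntries P) {f : ℝ → ℝ → C2}
    (hf : Continuous (Function.uncurry f)) (x : ℝ) (ν : Measure ℝ) [SFinite ν] {s : ℝ → ℝ≥0∞}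
    (hs : Measurable s) (h0 : ∀ y, s y ≠ 0) (ht : ∀ y, s y ≠ ⊤) :
    eLpNorm (vint P f x) 2 ν ^ 2 ≤
      (∫⁻ y in Iic x, (s y * ENNReal.ofReal (entryNorm (P y))) ^ 2) *
        ∫⁻ y in Iic x, (s y)⁻¹ ^ 2 * eLpNorm (f y) 2 ν ^ 2 := by
  have hfm : Measurable fun p : ℝ × ℝ => ‖f p.1 p.2‖ₑ :=
    (continuous_enorm.comp hf).measurable
  have hfz : ∀ z, Measurable fun y => ‖f y z‖ₑ := fun z => by
    have : Continuous fun y => f y z := hf.comp (by fun_prop : Continuous fun y => (y, z))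
    exact this.measurable.enorm
  have hm : Measurable fun p : ℝ × ℝ => ((s p.1)⁻¹ * ‖f p.1 p.2‖ₑ) ^ 2 :=
    ((hs.comp measurable_fst).inv.mul hfm).pow_const 2
  have hm' : Measurable fun p : ℝ × ℝ => ((s p.2)⁻¹ * ‖f p.2 p.1‖ₑ) ^ 2 := hm.comp measurable_swap
  have hJ : Measurable fun z => ∫⁻ y in Iic x, ((s y)⁻¹ * ‖f y z‖ₑ) ^ 2 :=
    hm'.lintegral_prod_right' (ν := volume.restrict (Iic x))
  have hswap : ∫⁻ z, (∫⁻ y in Iic x, ((s y)⁻¹ * ‖f y z‖ₑ) ^ 2) ∂ν =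
      ∫⁻ y in Iic x, (s y)⁻¹ ^ 2 * eLpNorm (f y) 2 ν ^ 2 := by
    rw [lintegral_lintegral_swap (f := fun z y => ((s y)⁻¹ * ‖f y z‖ₑ) ^ 2) hm'.aemeasurable]
    refine lintegral_congr fun y => ?_
    have h0 : Continuous fun z => f y z := hf.comp (by fun_prop : Continuous fun z => (y, z))
    have h1 : Measurable fun z => ‖f y z‖ₑ ^ 2 := h0.measurable.enorm.pow_const 2
    rw [eLpNorm_two_sq, ← lintegral_const_mul _ h1]
    simp only [mul_pow]
  have hpt : ∀ z, ‖vint P f x z‖ₑ ^ 2 ≤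
      (∫⁻ y in Iic x, (s y * ENNReal.ofReal (entryNorm (P y))) ^ 2) *
        ∫⁻ y in Iic x, ((s y)⁻¹ * ‖f y z‖ₑ) ^ 2 := fun z =>
    (pow_le_pow_left' (enorm_setIntegral_vker_le P (fun y => f y z) x z) 2).trans
      (sq_lintegral_mul_le hP.entryNorm.ennreal_ofReal.aemeasurable (hfz z).aemeasurable
        hs.aemeasurable h0 ht)
  rw [eLpNorm_two_sq, ← hswap, ← lintegral_const_mul _ hJ]
  exact lintegral_mono hpt

theorem measurable_ofReal_wt : Measurable fun y => ENNReal.ofReal (wt y) :=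
  continuous_wt.measurable.ennreal_ofReal

theorem setLIntegral_inv_one_add_sq_le (x : ℝ) :
    ∫⁻ y in Iic x, ENNReal.ofReal ((1 + y ^ 2)⁻¹) ≤ 4 := by
  refine (setLIntegral_le_lintegral _ _).trans ?_
  rw [← ofReal_integral_eq_lintegral_ofReal integrable_inv_one_add_sq
    (Eventually.of_forall fun y => by positivity), integral_univ_inv_one_add_sq]
  exact (ENNReal.ofReal_le_ofReal Real.pi_le_four).trans (by simp)

theorem sq_eLpNorm_vint_le_wN {P : ℝ → M2} (hP : MeasEntries P) {f : ℝ → ℝ → C2}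
    (hf : Continuous (Function.uncurry f)) (x : ℝ) (ν : Measure ℝ) [SFinite ν] :
    eLpNorm (vint P f x) 2 ν ^ 2 ≤
      wN P ^ 2 * ∫⁻ y in Iic x, ENNReal.ofReal ((1 + y ^ 2)⁻¹) * eLpNorm (f y) 2 ν ^ 2 := by
  refine (sq_eLpNorm_vint_le hP hf x ν measurable_ofReal_wt ofReal_wt_ne_zero
    fun y => ENNReal.ofReal_ne_top).trans ?_
  simp only [ofReal_wt_inv_sq]
  rw [wN_sq]
  gcongr
  exact Measure.restrict_le_self

theorem eLpNorm_vint_le {P : ℝ → M2} (hP : MeasEntries P) {f : ℝ → ℝ → C2}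
    (hf : Continuous (Function.uncurry f)) {x : ℝ} {K : ℝ≥0∞}
    (hK : ∀ y ≤ x, eLpNorm (f y) 2 volume ≤ K) :
    eLpNorm (vint P f x) 2 volume ≤ wN P * (2 * K) := by
  refine le_of_sq_le_sq ((sq_eLpNorm_vint_le_wN hP hf x volume).trans ?_)
  rw [mul_pow, mul_pow]
  gcongr
  calc _ ≤ ∫⁻ y in Iic x, ENNReal.ofReal ((1 + y ^ 2)⁻¹) * K ^ 2 :=
        setLIntegral_mono' measurableSet_Iic fun y hy => by gcongr; exact hK y hy
    _ = (∫⁻ y in Iic x, ENNReal.ofReal ((1 + y ^ 2)⁻¹)) * K ^ 2 :=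
        lintegral_mul_const _ (by fun_prop)
    _ ≤ 4 * K ^ 2 := by gcongr; exact setLIntegral_inv_one_add_sq_le x
    _ = _ := by norm_num

/-- If `f` decays like `⟨y⟩⁻¹` in `L²_z`, an unweighted `L²` norm of the potential suffices. -/
theorem eLpNorm_vint_le_of_decay {P : ℝ → M2} (hP : MeasEntries P) {f : ℝ → ℝ → C2}
    (hf : Continuous (Function.uncurry f)) {x : ℝ} {K : ℝ≥0∞}
    (hK : ∀ y ≤ x, eLpNorm (f y) 2 volume ≤ K * (ENNReal.ofReal (wt y))⁻¹) :
    eLpNorm (vint P f x) 2 volume ≤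
      eLpNorm (fun y => entryNorm (P y)) 2 (volume.restrict (Iic x)) * (2 * K) := by
  refine le_of_sq_le_sq ((sq_eLpNorm_vint_le hP hf x volume (s := fun _ => 1) measurable_const
    (by simp) (by simp)).trans ?_)
  rw [mul_pow, mul_pow, eLpNorm_two_sq]
  simp only [one_mul, inv_one, one_pow]
  gcongr with y
  · rw [← ofReal_norm, Real.norm_of_nonneg (entryNorm_nonneg _)]
  · calc _ ≤ ∫⁻ y in Iic x, K ^ 2 * ENNReal.ofReal ((1 + y ^ 2)⁻¹) :=
          setLIntegral_mono' measurableSet_Iic fun y hy => by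
            rw [← ofReal_wt_inv_sq, ← mul_pow]; gcongr; exact hK y hy
      _ = K ^ 2 * (∫⁻ y in Iic x, ENNReal.ofReal ((1 + y ^ 2)⁻¹)) :=
          lintegral_const_mul _ (by fun_prop)
      _ ≤ K ^ 2 * 4 := by gcongr; exact setLIntegral_inv_one_add_sq_le x
      _ = _ := by ring

/-- The weight decreases on (-∞, 0]. This converts tails over (-∞, x] into the factor ⟨x⟩⁻¹ and is
the reason for restricting the H¹ statements to a half-line. -/
theorem wt_le_wt {x y : ℝ} (hyx : y ≤ x) (hx : x ≤ 0) : wt x ≤ wt y :=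
  Real.sqrt_le_sqrt (by nlinarith)

/-- Tails of weighted `L²` functions. -/
theorem eLpNorm_restrict_Iic_le {E : Type*} [NormedAddCommGroup E] [NormedSpace ℝ E] {x : ℝ}
    (hx : x ≤ 0) (h : ℝ → E) : eLpNorm h 2 (volume.restrict (Iic x)) ≤
      eLpNorm (fun y => wt y • h y) 2 volume * (ENNReal.ofReal (wt x))⁻¹ := by
  refine le_of_sq_le_sq ?_
  rw [mul_pow, eLpNorm_two_sq, eLpNorm_two_sq, ← lintegral_mul_const' _ _ (by
    simpa using wt_pos x)]
  refine (setLIntegral_mono_ae' measurableSet_Iic (Eventually.of_forall fun y hy => ?_)).trans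
    (setLIntegral_le_lintegral _ _)
  rw [enorm_smul, mul_pow, ← ofReal_norm (wt y), Real.norm_of_nonneg (wt_pos y).le, mul_right_comm,
    ← mul_pow]
  refine le_mul_of_one_le_left' ?_
  refine one_le_pow₀ ?_
  rw [← div_eq_mul_inv, ENNReal.le_div_iff_mul_le
    (Or.inl (ofReal_wt_ne_zero x)) (Or.inl ENNReal.ofReal_ne_top), one_mul]
  exact ENNReal.ofReal_le_ofReal (wt_le_wt hy hx)

theorem ennreal_add_sq_le (a b : ℝ≥0∞) : (a + b) ^ 2 ≤ 2 * a ^ 2 + 2 * b ^ 2 := by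
  have := ENNReal.rpow_add_le_mul_rpow_add_rpow a b (p := 2) (by norm_num)
  norm_num at this
  rwa [mul_add] at this

/-- The constant of the `L²_z` a priori estimate for the Volterra equation. -/
noncomputable def volterraConst (U : ℝ≥0) : ℝ≥0 :=
  (2 * Real.exp ((4 * U ^ 2 + 1) * Real.pi)).toNNReal

/-- The a priori estimate in `L²_z` for solutions of a Volterra equation. -/
theorem eLpNorm_le_of_volterra {P : ℝ → M2} (hP : MeasEntries P) {U : ℝ≥0} (hU : wN P ≤ U)
    {f S : ℝ → ℝ → C2} (hf : Continuous (Function.uncurry f))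
    (hb : ∀ R : ℝ, ∃ M : ℝ, ∀ x z, |z| ≤ R → ‖f x z‖ ≤ M) {x₀ : ℝ}
    (h : ∀ x ≤ x₀, ∀ z, f x z = S x z + vint P f x z) {A : ℝ≥0∞}
    (hA : ∀ x ≤ x₀, eLpNorm (S x) 2 volume ≤ A) :
    eLpNorm (f x₀) 2 volume ≤ volterraConst U * A := by
  have hfx : ∀ x, Continuous (f x) := fun x =>
    hf.comp (by fun_prop : Continuous fun z => (x, z))
  -- Grönwall needs finiteness beforehand, and the L²_z norm over the whole line is not yet known to
  -- be finite. On |z| ≤ R it is, uniformly in x, and the resulting constant does not depend on R.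
  have key : ∀ R : ℝ, eLpNorm (f x₀) 2 (volume.restrict (Icc (-R) R)) ≤ volterraConst U * A := by
    intro R
    set ν := volume.restrict (Icc (-R) R) with hν
    obtain ⟨M, hM⟩ := hb R
    have hbound : ∀ x, eLpNorm (f x) 2 ν ≤ ν univ ^ (2 : ℝ≥0∞).toReal⁻¹ * ENNReal.ofReal M := fun x =>
      eLpNorm_le_of_ae_bound (by
        rw [hν, ae_restrict_iff' measurableSet_Icc]
        exact Eventually.of_forall fun z hz => hM x z (abs_le.2 hz))
    have hG : ∀ x ≤ x₀, eLpNorm (f x) 2 ν ^ 2 ≤ 2 * A ^ 2 + ((2 * U ^ 2 : ℝ≥0) : ℝ≥0∞) *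
        ∫⁻ y in Iic x, ENNReal.ofReal ((1 + y ^ 2)⁻¹) * eLpNorm (f y) 2 ν ^ 2 := fun x hx => by
      have hv := aestronglyMeasurable_vint hP hf x ν
      have hS : AEStronglyMeasurable (S x) ν := by
        refine ((hfx x).aestronglyMeasurable.sub hv).congr (Eventually.of_forall fun z => ?_)
        simp [h x hx z]
      have e : f x = S x + vint P f x := funext fun z => h x hx z
      have h1 : eLpNorm (f x) 2 ν ≤ eLpNorm (S x) 2 ν + eLpNorm (vint P f x) 2 ν := by
        conv_lhs => rw [e]
        exact eLpNorm_add_le hS hv (by norm_num)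
      refine (pow_le_pow_left' h1 2).trans ((ennreal_add_sq_le _ _).trans ?_)
      push_cast
      rw [mul_assoc]
      gcongr
      · exact (eLpNorm_mono_measure _ Measure.restrict_le_self).trans (hA x hx)
      · refine (sq_eLpNorm_vint_le_wN hP hf x ν).trans ?_
        gcongr
    have := gronwall_half_line (G := fun x => eLpNorm (f x) 2 ν ^ 2)
      (M := (ν univ ^ (2 : ℝ≥0∞).toReal⁻¹ * ENNReal.ofReal M) ^ 2)
      (ENNReal.pow_ne_top (ENNReal.mul_ne_top (by
        refine ENNReal.rpow_ne_top_of_nonneg (by norm_num) ?_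
        simp [hν]) ENNReal.ofReal_ne_top)) (fun x _ => pow_le_pow_left' (hbound x) 2) hG
    refine le_of_sq_le_sq (this.trans ?_)
    have hv : (volterraConst U : ℝ≥0∞) =
        ENNReal.ofReal (2 * Real.exp ((4 * U ^ 2 + 1) * Real.pi)) := rfl
    -- Grönwall gives 4 E A² with E = exp((4U²+1)π) ≥ 1, which is at most (2E)² A². The value κ =
    -- 2U² comes from (a + b)² ≤ 2a² + 2b².
    rw [hv, mul_pow, show ∀ E : ℝ≥0∞, 2 * (2 * A ^ 2) * E = 2 * (2 * E) * A ^ 2 by intro E; ring]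
    refine mul_le_mul' ?_ le_rfl
    rw [← ENNReal.ofReal_pow (by positivity), show (2 : ℝ≥0∞) = ENNReal.ofReal 2 by simp,
      ← ENNReal.ofReal_mul (by norm_num), ← ENNReal.ofReal_mul (by norm_num)]
    refine ENNReal.ofReal_le_ofReal ?_
    have h1 : 1 ≤ Real.exp ((4 * U ^ 2 + 1) * Real.pi) := Real.one_le_exp (by positivity)
    have h2 : (2 * ((2 * U ^ 2 : ℝ≥0) : ℝ) + 1) * Real.pi = (4 * U ^ 2 + 1) * Real.pi := by
      push_cast; ring
    rw [h2]
    nlinarith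
  refine le_of_sq_le_sq ?_
  have hlim := (aecover_Icc (μ := (volume : Measure ℝ)) (tendsto_neg_atTop_atBot (G := ℝ))
    tendsto_id).lintegral_tendsto_of_countably_generated
    (f := fun z => ‖f x₀ z‖ₑ ^ 2) ((hfx x₀).measurable.enorm.pow_const 2).aemeasurable
  rw [eLpNorm_two_sq]
  refine le_of_tendsto' hlim fun R => ?_
  rw [← eLpNorm_two_sq]
  exact pow_le_pow_left' (key R) 2

/-! ### Potentials and the first order remainder -/

/-- Potentials of the spectral problem: weighted square integrable, with a continuous and purely
imaginary upper left entry. -/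
structure IsPot (P : ℝ → M2) : Prop where
  meas : MeasEntries P
  cont : Continuous fun y => P y 0 0
  re : ∀ y, (P y 0 0).re = 0
  fin : wN P < ⊤

/-- The factor `exp ∫_{-∞}^x P₀₀`. -/
noncomputable def mu (P : ℝ → M2) (x : ℝ) : ℂ := Complex.exp (∫ y in Iic x, P y 0 0)

theorem integrable_entry {P : ℝ → M2} (hP : MeasEntries P) (hw : wN P < ⊤) (i j : Fin 2) :
    Integrable fun y => P y i j :=
  (integrable_entryNorm hP hw).mono' (hP i j).aestronglyMeasurable
    (Eventually.of_forall fun _ => norm_apply_le_entryNorm _ i j)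

theorem setLIntegral_entryNorm_le {P : ℝ → M2} (hP : MeasEntries P) (x : ℝ) :
    ∫⁻ y in Iic x, ENNReal.ofReal (entryNorm (P y)) ≤ 2 * wN P := by
  refine le_of_sq_le_sq ?_
  have h := sq_setLIntegral_entryNorm_mul_le hP (ρ := fun _ => 1) (x := x) aemeasurable_const
  simp only [mul_one, one_pow] at h
  refine h.trans ?_
  rw [mul_pow, mul_comm]
  gcongr
  exact (setLIntegral_inv_one_add_sq_le x).trans (by norm_num)

theorem integral_Iic_eq_add {E : Type*} [NormedAddCommGroup E] [NormedSpace ℝ E]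
    {f : ℝ → E} (hf : Integrable f) (x : ℝ) :
    ∫ y in Iic x, f y = (∫ y in Iic 0, f y) + ∫ y in (0 : ℝ)..x, f y := by
  rw [← intervalIntegral.integral_Iic_sub_Iic hf.integrableOn hf.integrableOn]; abel

theorem hasDerivAt_integral_Iic {f : ℝ → ℂ} (hf : Integrable f) (hc : Continuous f) (x : ℝ) :
    HasDerivAt (fun x => ∫ y in Iic x, f y) (f x) x := by
  rw [funext fun x => integral_Iic_eq_add hf x]
  exact (intervalIntegral.integral_hasDerivAt_right hf.intervalIntegrable
    (hc.stronglyMeasurableAtFilter _ _) hc.continuousAt).const_add _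

theorem tendsto_integral_Iic_atBot {E : Type*} [NormedAddCommGroup E] [NormedSpace ℝ E]
    {f : ℝ → E} (hf : Integrable f) :
    Tendsto (fun x => ∫ y in Iic x, f y) atBot (𝓝 0) := by
  have h := (intervalIntegral_tendsto_integral_Iic (0 : ℝ) hf.integrableOn tendsto_id).const_sub
    (∫ y in Iic 0, f y)
  rw [sub_self] at h
  refine h.congr fun x => ?_
  rw [integral_Iic_eq_add hf x, intervalIntegral.integral_symm]
  simp only [id]; abel

namespace IsPot

variable {P : ℝ → M2}

theorem hasDerivAt_mu (hP : IsPot P) (x : ℝ) : HasDerivAt (mu P) (P x 0 0 * mu P x) x := by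
  have := (hasDerivAt_integral_Iic (integrable_entry hP.meas hP.fin 0 0) hP.cont x).cexp
  convert! this using 1
  rw [mu]; ring

theorem continuous_mu (hP : IsPot P) : Continuous (mu P) :=
  continuous_iff_continuousAt.2 fun x => (hP.hasDerivAt_mu x).continuousAt

theorem re_integral (hP : IsPot P) (x : ℝ) : (∫ y in Iic x, P y 0 0).re = 0 := by
  have := integral_re (integrable_entry hP.meas hP.fin 0 0).integrableOn (μ := volume.restrict (Iic x))
  change ∫ y in Iic x, (P y 0 0).re = (∫ y in Iic x, P y 0 0).re at this
  rw [← this]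
  simp [hP.re]

theorem norm_mu (hP : IsPot P) (x : ℝ) : ‖mu P x‖ = 1 := by
  rw [mu, Complex.norm_exp, hP.re_integral, Real.exp_zero]

/-- The integrand is the derivative of μ, and μ tends to 1 at -∞. Thus μ solves the diagonal part of
the first row exactly, with the right normalization. -/
theorem integral_mul_mu (hP : IsPot P) (x : ℝ) : ∫ y in Iic x, P y 0 0 * mu P y = mu P x - 1 := by
  have hi := integrable_entry hP.meas hP.fin 0 0
  refine integral_Iic_of_hasDerivAt_of_tendsto hP.continuous_mu.continuousWithinAt
    (fun y _ => hP.hasDerivAt_mu y) ?_ ?_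
  · exact (hi.mul_bdd (c := 1) hP.continuous_mu.aestronglyMeasurable
      (Eventually.of_forall fun y => (hP.norm_mu y).le)).integrableOn
  · have := (Complex.continuous_exp.tendsto _).comp (tendsto_integral_Iic_atBot hi)
    rwa [Complex.exp_zero] at this

end IsPot

theorem norm_exp_sub_exp_le {a b : ℂ} (ha : a.re = 0) (hb : b.re = 0) :
    ‖Complex.exp a - Complex.exp b‖ ≤ ‖a - b‖ := by
  have e1 : a = b + Complex.I * ((a.im - b.im : ℝ) : ℂ) := by
    apply Complex.ext <;> simp [ha, hb]
  have e2 : ‖Complex.exp b‖ = 1 := by rw [Complex.norm_exp, hb, Real.exp_zero]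
  have e3 : Complex.exp a - Complex.exp b =
      Complex.exp b * (Complex.exp (Complex.I * ((a.im - b.im : ℝ) : ℂ)) - 1) := by
    conv_lhs => rw [e1, Complex.exp_add]
    ring
  rw [e3, norm_mul, e2, one_mul]
  refine (Real.norm_exp_I_mul_ofReal_sub_one_le).trans (le_of_eq ?_)
  conv_rhs => rw [e1, add_sub_cancel_left, norm_mul, Complex.norm_I, one_mul, Complex.norm_real]

/-- Both exponents are imaginary, where exp is 1-Lipschitz, and the L¹ norm of P - Q on a half-line
is at most twice its weighted L² norm. -/
theorem norm_mu_sub_mu_le {P Q : ℝ → M2} (hP : IsPot P) (hQ : IsPot Q) {Δ : ℝ≥0}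
    (hΔ : wN (P - Q) ≤ Δ) (x : ℝ) : ‖mu P x - mu Q x‖ ≤ 2 * Δ := by
  have hPi := (integrable_entry hP.meas hP.fin 0 0).integrableOn (s := Iic x)
  have hQi := (integrable_entry hQ.meas hQ.fin 0 0).integrableOn (s := Iic x)
  refine (norm_exp_sub_exp_le (hP.re_integral x) (hQ.re_integral x)).trans ?_
  rw [← integral_sub hPi hQi]
  have h : ‖∫ y in Iic x, (P y 0 0 - Q y 0 0)‖ₑ ≤ ((2 * Δ : ℝ≥0) : ℝ≥0∞) := by
    calc _ ≤ ∫⁻ y in Iic x, ‖P y 0 0 - Q y 0 0‖ₑ := enorm_integral_le_lintegral_enorm _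
      _ ≤ ∫⁻ y in Iic x, ENNReal.ofReal (entryNorm ((P - Q) y)) := by
          refine lintegral_mono fun y => ?_
          rw [← ofReal_norm]
          exact ENNReal.ofReal_le_ofReal (norm_apply_le_entryNorm ((P - Q) y) 0 0)
      _ ≤ 2 * wN (P - Q) := setLIntegral_entryNorm_le (hP.meas.sub hQ.meas) x
      _ ≤ _ := by push_cast; gcongr
  rw [enorm_eq_nnnorm, ENNReal.coe_le_coe] at h
  exact_mod_cast h

/-- Jointly continuous functions bounded in `x`, locally uniformly in `z`. -/
structure Adm (f : ℝ → ℝ → C2) : Prop where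
  cont : Continuous (Function.uncurry f)
  bdd : ∀ R : ℝ, ∃ M : ℝ, ∀ x z, |z| ≤ R → ‖f x z‖ ≤ M

theorem Adm.sub {f g : ℝ → ℝ → C2} (hf : Adm f) (hg : Adm g) : Adm (f - g) := by
  refine ⟨hf.cont.sub hg.cont, fun R => ?_⟩
  obtain ⟨M, hM⟩ := hf.bdd R
  obtain ⟨N, hN⟩ := hg.bdd R
  exact ⟨M + N, fun x z hz => (norm_sub_le _ _).trans (add_le_add (hM x z hz) (hN x z hz))⟩

theorem Adm.smul {f : ℝ → ℝ → C2} (hf : Adm f) (c : ℂ) : Adm (c • f) := by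
  refine ⟨hf.cont.const_smul c, fun R => ?_⟩
  obtain ⟨M, hM⟩ := hf.bdd R
  refine ⟨‖c‖ * M, fun x z hz => ?_⟩
  rw [Pi.smul_apply, Pi.smul_apply, norm_smul]
  gcongr
  exact hM x z hz

theorem Adm.continuous_left {f : ℝ → ℝ → C2} (hf : Adm f) (z : ℝ) : Continuous fun y => f y z :=
  hf.cont.comp (by fun_prop : Continuous fun y => (y, z))

theorem Adm.continuous_right {f : ℝ → ℝ → C2} (hf : Adm f) (x : ℝ) : Continuous (f x) :=
  hf.cont.comp (by fun_prop : Continuous fun z => (x, z))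

theorem Adm.integrableOn_vker {f : ℝ → ℝ → C2} (hf : Adm f) {P : ℝ → M2} (hP : MeasEntries P)
    (hw : wN P < ⊤) (x z : ℝ) (s : Set ℝ) :
    IntegrableOn (fun y => vker z (x - y) (P y) (f y z)) s := by
  obtain ⟨M, hM⟩ := hf.bdd |z|
  exact integrable_vker hP hw (hf.continuous_left z).aestronglyMeasurable
    (Eventually.of_forall fun y => hM y z le_rfl) z x

theorem vint_sub_left {P Q : ℝ → M2} (hP : MeasEntries P) (hPw : wN P < ⊤) (hQ : MeasEntries Q)
    (hQw : wN Q < ⊤) {f : ℝ → ℝ → C2} (hf : Adm f) : vint (P - Q) f = vint P f - vint Q f := by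
  ext1 x; ext1 z
  simp only [vint, Pi.sub_apply, vker_sub_left]
  exact integral_sub (hf.integrableOn_vker hP hPw x z _) (hf.integrableOn_vker hQ hQw x z _)

theorem vint_sub {P : ℝ → M2} (hP : MeasEntries P) (hPw : wN P < ⊤) {f g : ℝ → ℝ → C2}
    (hf : Adm f) (hg : Adm g) : vint P (f - g) = vint P f - vint P g := by
  ext1 x; ext1 z
  simp only [vint, Pi.sub_apply, vker_sub]
  exact integral_sub (hf.integrableOn_vker hP hPw x z _) (hg.integrableOn_vker hP hPw x z _)

theorem vint_smul_left (P : ℝ → M2) (c : ℂ) (f : ℝ → ℝ → C2) : vint (c • P) f = c • vint P f := by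
  ext1 x; ext1 z
  simp only [vint, Pi.smul_apply, vker_smul_left]
  exact integral_smul c _

theorem vint_smul (P : ℝ → M2) (c : ℂ) (f : ℝ → ℝ → C2) : vint P (c • f) = c • vint P f := by
  ext1 x; ext1 z
  simp only [vint, Pi.smul_apply, vker_smul]
  exact integral_smul c _

/-- The oscillatory integral `e₂ ∫_{-∞}^x e^{2iz(x-y)} g(y) dy`. -/
noncomputable def osc (g : ℝ → ℂ) (x z : ℝ) : C2 := (∫ y in Iic x, phase z (x - y) * g y) • e2

theorem integrable_phase_mul {g : ℝ → ℂ} {ν : Measure ℝ} (hg : Integrable g ν) (x z : ℝ) :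
    Integrable (fun y => phase z (x - y) * g y) ν :=
  hg.bdd_mul (c := 1)
    (by unfold phase; fun_prop : Continuous fun y => phase z (x - y)).aestronglyMeasurable
    (Eventually.of_forall fun y => (norm_phase _ _).le)

theorem osc_sub {g h : ℝ → ℂ} (hg : Integrable g) (hh : Integrable h) :
    osc (g - h) = osc g - osc h := by
  ext1 x; ext1 z
  simp only [osc, Pi.sub_apply, mul_sub]
  rw [integral_sub (integrable_phase_mul hg.integrableOn x z)
    (integrable_phase_mul hh.integrableOn x z), sub_smul]

theorem osc_smul (c : ℂ) (g : ℝ → ℂ) : osc (c • g) = c • osc g := by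
  ext1 x; ext1 z
  simp only [osc, Pi.smul_apply, smul_eq_mul, mul_left_comm _ c]
  rw [integral_const_mul, mul_smul]

theorem eLpNorm_osc_eq (g : ℝ → ℂ) (x : ℝ) (ν : Measure ℝ) : eLpNorm (osc g x) 2 ν =
    eLpNorm (fun z => ∫ y in Iic x, phase z (x - y) * g y) 2 ν :=
  eLpNorm_congr_norm_ae (Eventually.of_forall fun z => by simp [osc, norm_smul])

theorem eLpNorm_osc_le {g : ℝ → ℂ} (hg : Integrable g) (hg2 : MemLp g 2 volume) (x : ℝ) :
    eLpNorm (osc g x) 2 volume ≤ 2 * eLpNorm g 2 (volume.restrict (Iic x)) := by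
  rw [eLpNorm_osc_eq]
  exact eLpNorm_phase_setIntegral_le measurableSet_Iic hg.integrableOn (hg2.restrict _) x

theorem aestronglyMeasurable_osc {g : ℝ → ℂ} (hg : AEStronglyMeasurable g volume) (x : ℝ) :
    AEStronglyMeasurable (osc g x) volume := by
  refine AEStronglyMeasurable.smul_const ?_ e2
  refine AEStronglyMeasurable.integral_prod_right' (f := fun p : ℝ × ℝ =>
    phase p.1 (x - p.2) * g p.2) ?_
  exact (by unfold phase; fun_prop : Continuous fun p : ℝ × ℝ =>
    phase p.1 (x - p.2)).aestronglyMeasurable.mul hg.restrict.comp_snd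

/-- The remainder `m - μ e₁`. -/
noncomputable def rmd (P : ℝ → M2) (m : ℝ → ℝ → C2) (x z : ℝ) : C2 := m x z - mu P x • e1

theorem IsSol.adm_rmd {P : ℝ → M2} (hP : IsPot P) {m : ℝ → ℝ → C2} (hm : IsSol P m) :
    Adm (rmd P m) := by
  refine ⟨hm.cont.sub (((hP.continuous_mu.comp continuous_fst)).smul continuous_const), fun R => ?_⟩
  obtain ⟨M, hM⟩ := hm.bdd
  refine ⟨M + 1, fun x z _ => (norm_sub_le _ _).trans (add_le_add (hM x z) ?_)⟩
  rw [norm_smul, hP.norm_mu, norm_e1, one_mul]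

theorem IsPot.integrable_entry_mul_mu {P : ℝ → M2} (hP : IsPot P) {Q : ℝ → M2}
    (hQ : MeasEntries Q) (hQw : wN Q < ⊤) (i j : Fin 2) :
    Integrable fun y => Q y i j * mu P y :=
  (integrable_entry hQ hQw i j).mul_bdd (c := 1) hP.continuous_mu.aestronglyMeasurable
      (Eventually.of_forall fun y => (hP.norm_mu y).le)

/-- Insert m = r + μ e₁. By `IsPot.integral_mul_mu` the first row applied to μ e₁ reproduces μ - 1,
so nothing without oscillation survives in the source; only the second component, with density P₁₀
μ, is left. -/
theorem IsSol.rmd_eq {P : ℝ → M2} (hP : IsPot P) {m : ℝ → ℝ → C2} (hm : IsSol P m) :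
    rmd P m = osc (fun y => P y 1 0 * mu P y) + vint P (rmd P m) := by
  ext1 x; ext1 z
  have h1 : m x z = e1 + vint P m x z := hm.eq x z
  have h2 : ∀ y, vker z (x - y) (P y) (m y z) = vker z (x - y) (P y) (rmd P m y z) +
      ((P y 0 0 * mu P y) • e1 + (phase z (x - y) * (P y 1 0 * mu P y)) • e2) := fun y => by
    have : m y z = rmd P m y z + mu P y • e1 := by simp [rmd]
    conv_lhs => rw [this, vker_add, vker_smul]
    congr 1
    simp only [vker_eq]
    simp [e1, smul_smul]
    module
  have i0 := hP.integrable_entry_mul_mu hP.meas hP.fin 0 0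
  have i1 := hP.integrable_entry_mul_mu hP.meas hP.fin 1 0
  have i2 : Integrable (fun y => (P y 0 0 * mu P y) • e1) := i0.smul_const e1
  have i3 : Integrable (fun y => (phase z (x - y) * (P y 1 0 * mu P y)) • e2) :=
    (integrable_phase_mul i1 x z).smul_const e2
  have i4 : IntegrableOn (fun y => (P y 0 0 * mu P y) • e1 +
      (phase z (x - y) * (P y 1 0 * mu P y)) • e2) (Iic x) := i2.integrableOn.add i3.integrableOn
  have h3 : vint P m x z = vint P (rmd P m) x z + ((mu P x - 1) • e1 +
      osc (fun y => P y 1 0 * mu P y) x z) := by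
    unfold vint
    simp only [h2]
    rw [integral_add ((hm.adm_rmd hP).integrableOn_vker hP.meas hP.fin x z _)
      i4, integral_add i2.integrableOn i3.integrableOn,
      integral_smul_const, integral_smul_const, hP.integral_mul_mu]
    rfl
  rw [rmd, h1, h3, Pi.add_apply, Pi.add_apply]
  module

theorem eLpNorm_le_of_norm_le_add {E : Type*} [NormedAddCommGroup E] {ν : Measure ℝ} {h : ℝ → E} {f g : ℝ → ℝ}
    (hf : Measurable f) (hg : Measurable g) {c : ℝ≥0} (hle : ∀ y, ‖h y‖ ≤ f y + c * g y)
    {D₁ D₂ : ℝ≥0∞} (h1 : eLpNorm f 2 ν ≤ D₁) (h2 : eLpNorm g 2 ν ≤ D₂) :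
    eLpNorm h 2 ν ≤ D₁ + c * D₂ := by
  have e : eLpNorm (fun y => c * g y) 2 ν ≤ c * eLpNorm g 2 ν := by
    have := eLpNorm_le_mul_eLpNorm_of_ae_le_mul (f := fun y => c * g y) (g := g) (c := (c : ℝ))
      (μ := ν) (Eventually.of_forall fun y => by simp) 2
    rwa [ENNReal.ofReal_coe_nnreal] at this
  calc eLpNorm h 2 ν ≤ eLpNorm (f + fun y => c * g y) 2 ν := eLpNorm_mono_real fun y => hle y
    _ ≤ eLpNorm f 2 ν + eLpNorm (fun y => c * g y) 2 ν :=
        eLpNorm_add_le hf.aestronglyMeasurable (hg.const_mul _).aestronglyMeasurable (by norm_num)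
    _ ≤ _ := add_le_add h1 (e.trans (by gcongr))

/-- Lipschitz dependence of the oscillating densities on the potential. -/
theorem eLpNorm_entry_mul_sub_le {A B : ℝ → M2} (hA : MeasEntries A) (hB : MeasEntries B)
    {α β : ℝ → ℂ} {Δ : ℝ≥0} (hα : ∀ y, ‖α y‖ = 1) (hαβ : ∀ y, ‖α y - β y‖ ≤ 2 * Δ)
    {w : ℝ → ℝ} (hw : Measurable w) (hw0 : ∀ y, 0 ≤ w y) {ν : Measure ℝ} {D₁ D₂ : ℝ≥0∞}
    (h1 : eLpNorm (fun y => w y * entryNorm ((A - B) y)) 2 ν ≤ D₁)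
    (h2 : eLpNorm (fun y => w y * entryNorm (B y)) 2 ν ≤ D₂) :
    eLpNorm (fun y => w y • (A y 1 0 * α y - B y 1 0 * β y)) 2 ν ≤ D₁ + 2 * Δ * D₂ := by
  have := eLpNorm_le_of_norm_le_add (h := fun y => w y • (A y 1 0 * α y - B y 1 0 * β y))
    (hw.mul (hA.sub hB).entryNorm) (hw.mul hB.entryNorm) (c := 2 * Δ) (fun y => ?_) h1 h2
  · simpa using this
  · rw [norm_smul, Real.norm_of_nonneg (hw0 y)]
    have e : A y 1 0 * α y - B y 1 0 * β y = (A - B) y 1 0 * α y + B y 1 0 * (α y - β y) := by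
      simp only [Pi.sub_apply, Matrix.sub_apply]; ring
    have h3 := norm_apply_le_entryNorm ((A - B) y) 1 0
    have h4 := norm_apply_le_entryNorm (B y) 1 0
    calc w y * ‖A y 1 0 * α y - B y 1 0 * β y‖
        ≤ w y * (entryNorm ((A - B) y) * 1 + entryNorm (B y) * (2 * Δ)) := by
          rw [e]
          refine mul_le_mul_of_nonneg_left ((norm_add_le _ _).trans ?_) (hw0 y)
          rw [norm_mul, norm_mul, hα]
          have := hαβ y
          have := entryNorm_nonneg (B y)
          gcongr
      _ = _ := by push_cast; simp only [Pi.mul_apply]; ring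

theorem eLpNorm_entry_mul_le {A : ℝ → M2}
    {α : ℝ → ℂ} (hα : ∀ y, ‖α y‖ = 1) (i j : Fin 2)
    {w : ℝ → ℝ} (hw0 : ∀ y, 0 ≤ w y) {ν : Measure ℝ} :
    eLpNorm (fun y => w y • (A y i j * α y)) 2 ν ≤
      eLpNorm (fun y => w y * entryNorm (A y)) 2 ν := by
  refine eLpNorm_mono_real fun y => ?_
  rw [norm_smul, Real.norm_of_nonneg (hw0 y), norm_mul, hα, mul_one]
  exact mul_le_mul_of_nonneg_left (norm_apply_le_entryNorm _ _ _) (hw0 y)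

theorem memLp_of_weighted {g : ℝ → ℂ} (hg : AEStronglyMeasurable g volume)
    (h : eLpNorm (fun y => wt y • g y) 2 volume < ⊤) : MemLp g 2 volume := by
  refine ⟨hg, lt_of_le_of_lt (eLpNorm_mono fun y => ?_) h⟩
  rw [norm_smul, Real.norm_of_nonneg (wt_pos y).le]
  exact le_mul_of_one_le_left (norm_nonneg _) (one_le_wt y)

/-- Plancherel sees only the tail of the density on (-∞, x], and the weight makes that tail of size
⟨x⟩⁻¹. -/
theorem eLpNorm_osc_le_of_weighted {g : ℝ → ℂ} (hg : Integrable g) {D : ℝ≥0∞} (hDt : D < ⊤)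
    (hD : eLpNorm (fun y => wt y • g y) 2 volume ≤ D) {x : ℝ} (hx : x ≤ 0) :
    eLpNorm (osc g x) 2 volume ≤ 2 * D * (ENNReal.ofReal (wt x))⁻¹ := by
  refine (eLpNorm_osc_le hg (memLp_of_weighted hg.1 (hD.trans_lt hDt)) x).trans ?_
  rw [mul_assoc]
  gcongr
  exact (eLpNorm_restrict_Iic_le hx g).trans (by gcongr)

theorem inv_ofReal_wt_le {x y : ℝ} (hyx : y ≤ x) (hx : x ≤ 0) :
    (ENNReal.ofReal (wt y))⁻¹ ≤ (ENNReal.ofReal (wt x))⁻¹ :=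
  ENNReal.inv_le_inv.2 (ENNReal.ofReal_le_ofReal (wt_le_wt hyx hx))

/-- Decay constant of the remainder. -/
noncomputable def decayConst (U : ℝ≥0) : ℝ≥0 := volterraConst U * (2 * U)

/-- The a priori estimate uses only the supremum of the source over y ≤ x, and ⟨y⟩⁻¹ ≤ ⟨x⟩⁻¹ there,
so the solution inherits the decay of the source. This decay later compensates the weight lost by
difference quotients. -/
theorem IsSol.eLpNorm_rmd_le {P : ℝ → M2} (hP : IsPot P) {m : ℝ → ℝ → C2} (hm : IsSol P m)
    {U : ℝ≥0} (hU : wN P ≤ U) {x : ℝ} (hx : x ≤ 0) :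
    eLpNorm (rmd P m x) 2 volume ≤ decayConst U * (ENNReal.ofReal (wt x))⁻¹ := by
  have hr := hm.adm_rmd hP
  have h := eLpNorm_le_of_volterra hP.meas hU hr.cont hr.bdd (x₀ := x)
    (S := osc (fun y => P y 1 0 * mu P y)) (fun y _ z => congrFun (congrFun (hm.rmd_eq hP) y) z)
    (A := 2 * U * (ENNReal.ofReal (wt x))⁻¹) fun y hy => by
      refine (eLpNorm_osc_le_of_weighted (hP.integrable_entry_mul_mu hP.meas hP.fin 1 0)
        (D := U) ENNReal.coe_lt_top ((eLpNorm_entry_mul_le hP.norm_mu 1 0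
          fun y => (wt_pos y).le).trans hU) (hy.trans hx)).trans ?_
      exact mul_le_mul' le_rfl (inv_ofReal_wt_le hy hx)
  refine h.trans (le_of_eq ?_)
  rw [decayConst]; push_cast; ring

/-- The equation satisfied by the difference of solutions of two Volterra equations. -/
theorem sub_eq_of_volterra {P Q : ℝ → M2} (hP : MeasEntries P) (hPw : wN P < ⊤)
    (hQ : MeasEntries Q) (hQw : wN Q < ⊤) {f g S T : ℝ → ℝ → C2} (hf : Adm f) (hg : Adm g)
    (hfS : f = S + vint P f) (hgT : g = T + vint Q g) :
    f - g = (S - T + vint (P - Q) g) + vint P (f - g) := by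
  rw [vint_sub_left hP hPw hQ hQw hg, vint_sub hP hPw hf hg]
  nth_rw 1 [hfS, hgT]
  abel

theorem eLpNorm_entryNorm_restrict_le {P : ℝ → M2} {x : ℝ} (hx : x ≤ 0) :
    eLpNorm (fun y => entryNorm (P y)) 2 (volume.restrict (Iic x)) ≤
      wN P * (ENNReal.ofReal (wt x))⁻¹ :=
  eLpNorm_restrict_Iic_le hx fun y => entryNorm (P y)

theorem wN_sub_lt_top {P Q : ℝ → M2} (hP : IsPot P) (hQ : IsPot Q) : wN (P - Q) < ⊤ := by
  have h := eLpNorm_le_of_norm_le_add (h := fun y => wt y * entryNorm ((P - Q) y)) (c := 1)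
    (continuous_wt.measurable.mul hP.meas.entryNorm)
    (continuous_wt.measurable.mul hQ.meas.entryNorm) (fun y => ?_) (ν := volume) le_rfl le_rfl
  · exact h.trans_lt (ENNReal.add_lt_top.2 ⟨hP.fin, by rw [ENNReal.coe_one, one_mul]; exact hQ.fin⟩)
  · simp only [Pi.mul_apply, NNReal.coe_one, one_mul]
    rw [Real.norm_of_nonneg (mul_nonneg (wt_pos y).le (entryNorm_nonneg _)), ← mul_add]
    refine mul_le_mul_of_nonneg_left ?_ (wt_pos y).le
    have h1 := norm_sub_le (P y 0 0) (Q y 0 0)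
    have h2 := norm_sub_le (P y 0 1) (Q y 0 1)
    have h3 := norm_sub_le (P y 1 0) (Q y 1 0)
    have h4 := norm_sub_le (P y 1 1) (Q y 1 1)
    simp only [entryNorm, Pi.sub_apply, Matrix.sub_apply]
    linarith

/-- Lipschitz constant of the decaying `L²_z` norm of the remainder. -/
noncomputable def decayLipConst (U : ℝ≥0) : ℝ≥0 :=
  volterraConst U * (2 * (1 + 2 * U) + 2 * decayConst U)

/-- The difference solves the equation of P with source the oscillatory integral of the difference
of densities, plus P - Q acting on the remainder of Q. Both decay: in the second, the decay of the
remainder makes the y-integral converge, and the tail of P - Q supplies the factor ⟨x⟩⁻¹. -/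
theorem IsSol.eLpNorm_rmd_sub_le {P Q : ℝ → M2} (hP : IsPot P) (hQ : IsPot Q) {m n : ℝ → ℝ → C2}
    (hm : IsSol P m) (hn : IsSol Q n) {U Δ : ℝ≥0} (hPU : wN P ≤ U) (hQU : wN Q ≤ U)
    (hΔ : wN (P - Q) ≤ Δ) {x : ℝ} (hx : x ≤ 0) :
    eLpNorm ((rmd P m - rmd Q n) x) 2 volume ≤
      (decayLipConst U * Δ : ℝ≥0) * (ENNReal.ofReal (wt x))⁻¹ := by
  have hr := hm.adm_rmd hP
  have hs := hn.adm_rmd hQ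
  have hi := hP.integrable_entry_mul_mu hP.meas hP.fin 1 0
  have hj := hQ.integrable_entry_mul_mu hQ.meas hQ.fin 1 0
  have heq := sub_eq_of_volterra hP.meas hP.fin hQ.meas hQ.fin hr hs (hm.rmd_eq hP) (hn.rmd_eq hQ)
  rw [← osc_sub hi hj] at heq
  have h := eLpNorm_le_of_volterra hP.meas hPU (hr.sub hs).cont (hr.sub hs).bdd (x₀ := x)
    (fun y _ z => congrFun (congrFun heq y) z)
    (A := (2 * (Δ + 2 * Δ * U) + Δ * (2 * decayConst U)) * (ENNReal.ofReal (wt x))⁻¹) fun y hy => by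
      refine (eLpNorm_add_le (aestronglyMeasurable_osc (hi.sub hj).1 y)
        (aestronglyMeasurable_vint (hP.meas.sub hQ.meas) hs.cont y volume) (by norm_num)).trans ?_
      rw [add_mul]
      gcongr ?_ + ?_
      · refine (eLpNorm_osc_le_of_weighted (D := Δ + 2 * Δ * U) (hi.sub hj)
          (by norm_cast; exact ENNReal.coe_lt_top) ?_ (hy.trans hx)).trans ?_
        · exact eLpNorm_entry_mul_sub_le hP.meas hQ.meas hP.norm_mu (norm_mu_sub_mu_le hP hQ hΔ)
            continuous_wt.measurable (fun y => (wt_pos y).le) hΔ hQU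
        · exact mul_le_mul' le_rfl (inv_ofReal_wt_le hy hx)
      · refine (eLpNorm_vint_le_of_decay (hP.meas.sub hQ.meas) hs.cont (K := decayConst U)
          fun t ht => hn.eLpNorm_rmd_le hQ hQU (ht.trans (hy.trans hx))).trans ?_
        rw [mul_right_comm]
        refine mul_le_mul' ((eLpNorm_entryNorm_restrict_le (hy.trans hx)).trans ?_) le_rfl
        exact mul_le_mul' hΔ (inv_ofReal_wt_le hy hx)
  refine h.trans (le_of_eq ?_)
  rw [decayLipConst]; push_cast; ring

/-! ### Shifts of the spectral parameter and difference quotients -/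

/-- The diagonal unitary `diag(1, e^{2ikx})`. -/
noncomputable def twist (k x : ℝ) : C2 →L[ℂ] C2 :=
  (EuclideanSpace.proj (𝕜 := ℂ) (0 : Fin 2)).smulRight e1 +
    (phase k x • EuclideanSpace.proj (𝕜 := ℂ) (1 : Fin 2)).smulRight e2

theorem twist_apply (k x : ℝ) (v : C2) : twist k x v = v 0 • e1 + (phase k x * v 1) • e2 := rfl

@[simp] theorem twist_apply_zero (k x : ℝ) (v : C2) : twist k x v 0 = v 0 := by
  simp [twist_apply, e1, e2]

@[simp] theorem twist_apply_one (k x : ℝ) (v : C2) : twist k x v 1 = phase k x * v 1 := by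
  simp [twist_apply, e1, e2]

theorem twist_e1 (k x : ℝ) : twist k x e1 = e1 := by
  ext i; fin_cases i <;> simp [twist_apply, e1, e2]

theorem norm_twist (k x : ℝ) (v : C2) : ‖twist k x v‖ = ‖v‖ := by
  simp [EuclideanSpace.norm_eq, Fin.sum_univ_two, norm_phase]

theorem phase_mul_phase_neg (k x : ℝ) : phase k x * phase k (-x) = 1 := by
  rw [← phase_add, add_neg_cancel, phase_zero]

theorem twist_twist_neg (k x : ℝ) (v : C2) : twist k x (twist k (-x) v) = v := by
  ext i; fin_cases i
  · simp
  · simp [← mul_assoc, phase_mul_phase_neg]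

theorem norm_phase_sub_one_le (k y : ℝ) : ‖phase k y - 1‖ ≤ 2 * |k| * |y| := by
  have : phase k y = Complex.exp (Complex.I * ((2 * k * y : ℝ) : ℂ)) := by
    unfold phase; congr 1; push_cast; ring
  rw [this]
  refine Real.norm_exp_I_mul_ofReal_sub_one_le.trans (le_of_eq ?_)
  rw [Real.norm_eq_abs, abs_mul, abs_mul, abs_two]

theorem norm_twist_sub_le (k x : ℝ) (v : C2) : ‖twist k x v - v‖ ≤ 2 * |k| * |x| * ‖v‖ := by
  have e : twist k x v - v = ((phase k x - 1) * v 1) • e2 := by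
    ext i; fin_cases i
    · simp [e2]
    · simp [e2]; ring
  rw [e, norm_smul, norm_mul, norm_e2, mul_one]
  gcongr
  · exact norm_phase_sub_one_le k x
  · exact PiLp.norm_apply_le v 1

/-- The potential whose spectral problem at `z` is that of `P` at `z + k`, up to a twist. -/
noncomputable def shiftP (k : ℝ) (P : ℝ → M2) (y : ℝ) : M2 :=
  !![P y 0 0, P y 0 1 * phase k y; P y 1 0 * phase k (-y), P y 1 1]

theorem continuous_phase_right (k : ℝ) : Continuous (phase k) := by unfold phase; fun_prop

theorem measEntries_shiftP (k : ℝ) {P : ℝ → M2} (hP : MeasEntries P) : MeasEntries (shiftP k P) := by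
  intro i j
  have h1 := (continuous_phase_right k).measurable
  have h2 := ((continuous_phase_right k).comp continuous_neg).measurable
  fin_cases i <;> fin_cases j
  · exact hP 0 0
  · exact (hP 0 1).mul h1
  · exact (hP 1 0).mul h2
  · exact hP 1 1

theorem entryNorm_shiftP (k : ℝ) (P : ℝ → M2) (y : ℝ) :
    entryNorm (shiftP k P y) = entryNorm (P y) := by
  simp [entryNorm, shiftP, norm_phase]

theorem shiftP_sub (k : ℝ) (P Q : ℝ → M2) : shiftP k (P - Q) = shiftP k P - shiftP k Q := by
  ext y i j
  fin_cases i <;> fin_cases j <;> simp [shiftP, sub_mul]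

theorem wN_shiftP (k : ℝ) (P : ℝ → M2) : wN (shiftP k P) = wN P := by
  simp only [wN, entryNorm_shiftP]

theorem IsPot.shift {P : ℝ → M2} (hP : IsPot P) (k : ℝ) : IsPot (shiftP k P) where
  meas := measEntries_shiftP k hP.meas
  cont := hP.cont
  re := hP.re
  fin := by rw [wN_shiftP]; exact hP.fin

theorem mu_shiftP (k : ℝ) (P : ℝ → M2) : mu (shiftP k P) = mu P := rfl

/-- The solution for the shifted potential. -/
noncomputable def shiftSol (k : ℝ) (m : ℝ → ℝ → C2) (x z : ℝ) : C2 := twist k (-x) (m x (z + k))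

/-- The shift by k multiplies the phase by e^{2ikx} e^{-2iky}. The twist on the left removes the
first factor, and the second is absorbed by the potential and by the twist of the unknown.
Differentiating in z thus becomes perturbing the potential, to which the Lipschitz theory applies.
-/
theorem twist_vker (k z x y : ℝ) (P : ℝ → M2) (v : C2) :
    twist k (-x) (vker (z + k) (x - y) (P y) v) =
      vker z (x - y) (shiftP k P y) (twist k (-y) v) := by
  have h1 : phase k (-x) * phase k (x - y) = phase k (-y) := by
    rw [← phase_add]; congr 1; ring
  have h2 := phase_mul_phase_neg k y
  rw [vker_eq, vker_eq, phase_add_left]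
  ext i; fin_cases i
  · simp only [twist_apply, shiftP, e1, e2]
    simp only [Fin.zero_eta, PiLp.add_apply, PiLp.smul_apply, smul_eq_mul]
    simp
    linear_combination (-(P y 0 1 * v 1)) * h2
  · simp only [twist_apply, shiftP, e1, e2]
    simp only [Fin.mk_one, PiLp.add_apply, PiLp.smul_apply, smul_eq_mul]
    simp
    linear_combination (phase z (x - y) * (P y 1 0 * v 0 + P y 1 1 * v 1)) * h1

theorem continuous_twist_neg {f : ℝ × ℝ → C2} (hf : Continuous f) (k : ℝ) :
    Continuous fun p : ℝ × ℝ => twist k (-p.1) (f p) := by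
  have h1 : Continuous fun p : ℝ × ℝ => phase k (-p.1) :=
    (continuous_phase_right k).comp continuous_fst.neg
  simp only [twist_apply]
  fun_prop

theorem IsSol.shift {P : ℝ → M2} {m : ℝ → ℝ → C2} (hP : IsPot P) (hm : IsSol P m) (k : ℝ) :
    IsSol (shiftP k P) (shiftSol k m) := by
  obtain ⟨M, hM⟩ := hm.bdd
  refine ⟨?_, ⟨M, fun x z => ?_⟩, fun x z => ?_⟩
  · exact continuous_twist_neg (f := fun p => m p.1 (p.2 + k))
      (hm.cont.comp (by fun_prop : Continuous fun p : ℝ × ℝ => (p.1, p.2 + k))) k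
  · rw [shiftSol, norm_twist]; exact hM _ _
  · have hadm : Adm m := ⟨hm.cont, fun _ => ⟨M, fun x z _ => hM x z⟩⟩
    rw [shiftSol, hm.eq, map_add, twist_e1, vint, ← ContinuousLinearMap.integral_comp_comm _
      (hadm.integrableOn_vker hP.meas hP.fin x (z + k) _)]
    simp only [twist_vker]
    rfl

theorem rmd_shift (k : ℝ) (P : ℝ → M2) (m : ℝ → ℝ → C2) (x z : ℝ) :
    rmd (shiftP k P) (shiftSol k m) x z = twist k (-x) (rmd P m x (z + k)) := by
  rw [rmd, rmd, map_sub, map_smul, twist_e1, mu_shiftP, shiftSol]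

/-- The difference quotient of the potential under the shift. -/
noncomputable def dqP (k : ℝ) (P : ℝ → M2) : ℝ → M2 := (k : ℂ)⁻¹ • (shiftP k P - P)

theorem dqP_sub (k : ℝ) (P Q : ℝ → M2) : dqP k P - dqP k Q = dqP k (P - Q) := by
  rw [dqP, dqP, dqP, shiftP_sub, ← smul_sub]; congr 1; abel

theorem measEntries_dqP (k : ℝ) {P : ℝ → M2} (hP : MeasEntries P) : MeasEntries (dqP k P) :=
  fun i j => (((measEntries_shiftP k hP).sub hP) i j).const_mul _

theorem entryNorm_smul (c : ℂ) (A : M2) : entryNorm (c • A) = ‖c‖ * entryNorm A := by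
  simp only [entryNorm, Matrix.smul_apply, norm_smul]; ring

/-- Only finiteness for fixed k is meant: the bound used here has a factor 1/|k|. Estimates uniform
in k hold in unweighted L² only. -/
theorem wN_dqP_lt_top (k : ℝ) {P : ℝ → M2} (hP : IsPot P) : wN (dqP k P) < ⊤ := by
  have e : wN (dqP k P) ≤ ENNReal.ofReal ‖(k : ℂ)⁻¹‖ * wN (shiftP k P - P) := by
    refine eLpNorm_le_mul_eLpNorm_of_ae_le_mul (Eventually.of_forall fun y => le_of_eq ?_) 2
    rw [dqP, Pi.smul_apply, entryNorm_smul, mul_left_comm, norm_mul, norm_norm]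
  exact e.trans_lt (ENNReal.mul_lt_top ENNReal.ofReal_lt_top (wN_sub_lt_top (hP.shift k) hP))

/-- Since |e^{2iky} - 1| ≤ 2|k||y|, dividing by k costs one power of ⟨y⟩, which is the whole weight
available on P. -/
theorem entryNorm_dqP_le {k : ℝ} (hk : k ≠ 0) (P : ℝ → M2) (y : ℝ) :
    entryNorm (dqP k P y) ≤ 2 * (wt y * entryNorm (P y)) := by
  have hk' : 0 < |k| := abs_pos.2 hk
  have h1 : ‖phase k y - 1‖ ≤ |k| * (2 * wt y) := by
    refine (norm_phase_sub_one_le k y).trans ?_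
    calc 2 * |k| * |y| = |k| * (2 * |y|) := by ring
      _ ≤ _ := by gcongr; exact abs_le_wt y
  have h2 : ‖phase k (-y) - 1‖ ≤ |k| * (2 * wt y) := by
    refine (norm_phase_sub_one_le k (-y)).trans ?_
    rw [abs_neg]
    calc 2 * |k| * |y| = |k| * (2 * |y|) := by ring
      _ ≤ _ := by gcongr; exact abs_le_wt y
  rw [dqP, Pi.smul_apply, entryNorm_smul, norm_inv, Complex.norm_real, Real.norm_eq_abs,
    inv_mul_le_iff₀ hk']
  have e1 : P y 0 1 * phase k y - P y 0 1 = P y 0 1 * (phase k y - 1) := by ring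
  have e2 : P y 1 0 * phase k (-y) - P y 1 0 = P y 1 0 * (phase k (-y) - 1) := by ring
  have e : entryNorm ((shiftP k P - P) y) = ‖P y 0 1‖ * ‖phase k y - 1‖ +
      ‖P y 1 0‖ * ‖phase k (-y) - 1‖ := by
    rw [← norm_mul, ← norm_mul, ← e1, ← e2]
    simp [entryNorm, shiftP]
  rw [e]
  calc _ ≤ ‖P y 0 1‖ * (|k| * (2 * wt y)) + ‖P y 1 0‖ * (|k| * (2 * wt y)) := by gcongr
    _ = (|k| * (2 * wt y)) * (‖P y 0 1‖ + ‖P y 1 0‖) := by ring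
    _ ≤ (|k| * (2 * wt y)) * entryNorm (P y) := by
        have := wt_pos y
        gcongr
        have h0 := norm_nonneg (P y 0 0)
        have h3 := norm_nonneg (P y 1 1)
        unfold entryNorm; linarith
    _ = _ := by ring

theorem eLpNorm_entryNorm_dqP_le {k : ℝ} (hk : k ≠ 0) (P : ℝ → M2) (ν : Measure ℝ) :
    eLpNorm (fun y => entryNorm (dqP k P y)) 2 ν ≤
      2 * eLpNorm (fun y => wt y * entryNorm (P y)) 2 ν := by
  have := eLpNorm_le_mul_eLpNorm_of_ae_le_mul (f := fun y => entryNorm (dqP k P y))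
    (g := fun y => wt y * entryNorm (P y)) (c := 2) (μ := ν) (Eventually.of_forall fun y => by
      rw [Real.norm_of_nonneg (entryNorm_nonneg _),
        Real.norm_of_nonneg (mul_nonneg (wt_pos y).le (entryNorm_nonneg _))]
      exact entryNorm_dqP_le hk P y) 2
  simpa using this

theorem eLpNorm_entryNorm_dqP_le_wN {k : ℝ} (hk : k ≠ 0) (P : ℝ → M2) (x : ℝ) :
    eLpNorm (fun y => entryNorm (dqP k P y)) 2 (volume.restrict (Iic x)) ≤ 2 * wN P :=
  (eLpNorm_entryNorm_dqP_le hk P _).trans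
    (mul_le_mul' le_rfl (eLpNorm_mono_measure _ Measure.restrict_le_self))

/-- The difference quotient in `z`, after the twist, of the remainder. -/
noncomputable def dqR (k : ℝ) (P : ℝ → M2) (m : ℝ → ℝ → C2) : ℝ → ℝ → C2 :=
  (k : ℂ)⁻¹ • (rmd (shiftP k P) (shiftSol k m) - rmd P m)

theorem IsSol.adm_dqR {P : ℝ → M2} (hP : IsPot P) {m : ℝ → ℝ → C2} (hm : IsSol P m) (k : ℝ) :
    Adm (dqR k P m) :=
  (((hm.shift hP k).adm_rmd (hP.shift k)).sub (hm.adm_rmd hP)).smul _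

/-- The discrete Leibniz rule: the quotient falls either on the potential, next to the shifted
remainder, or on the remainder. The oscillatory source is differenced only through P₁₀, because the
shift does not change μ. -/
theorem IsSol.dqR_eq {P : ℝ → M2} (hP : IsPot P) {m : ℝ → ℝ → C2} (hm : IsSol P m) (k : ℝ) :
    dqR k P m = (osc (fun y => dqP k P y 1 0 * mu P y) +
      vint (dqP k P) (rmd (shiftP k P) (shiftSol k m))) + vint P (dqR k P m) := by
  have hP' := hP.shift k
  have hm' := hm.shift hP k
  have hi := hP.integrable_entry_mul_mu hP'.meas hP'.fin 1 0
  have hj := hP.integrable_entry_mul_mu hP.meas hP.fin 1 0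
  have hR := hm'.adm_rmd hP'
  have hr := hm.adm_rmd hP
  have e1 : (fun y => dqP k P y 1 0 * mu P y) = (k : ℂ)⁻¹ •
      ((fun y => shiftP k P y 1 0 * mu P y) - fun y => P y 1 0 * mu P y) := by
    ext y
    simp only [dqP, Pi.smul_apply, Pi.sub_apply, Matrix.smul_apply, Matrix.sub_apply, smul_eq_mul]
    ring
  rw [e1, osc_smul, osc_sub hi hj, dqP, vint_smul_left, vint_sub_left hP'.meas hP'.fin hP.meas
    hP.fin hR, dqR, vint_smul, vint_sub hP.meas hP.fin hR hr, ← smul_add, ← smul_add]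
  congr 1
  have h1 := hm'.rmd_eq hP'
  have h2 := hm.rmd_eq hP
  rw [mu_shiftP] at h1
  nth_rw 1 [h1, h2]
  abel

theorem memLp_dqP_mul_mu {P : ℝ → M2} (hP : IsPot P) (k : ℝ) :
    MemLp (fun y => dqP k P y 1 0 * mu P y) 2 volume := by
  refine memLp_of_weighted (hP.integrable_entry_mul_mu (measEntries_dqP k hP.meas)
    (wN_dqP_lt_top k hP) 1 0).1 ?_
  exact (eLpNorm_entry_mul_le hP.norm_mu 1 0 fun y => (wt_pos y).le).trans_lt (wN_dqP_lt_top k hP)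

/-- Bound for the difference quotients. -/
noncomputable def dqConst (U : ℝ≥0) : ℝ≥0 :=
  volterraConst U * (2 * (2 * U) + (2 * U) * (2 * decayConst U))

/-- The quotient of the potential has lost its weight, but it acts on the shifted remainder, which
decays like ⟨y⟩⁻¹; `eLpNorm_vint_le_of_decay` combines the two, uniformly in k. -/
theorem IsSol.eLpNorm_dqR_le {P : ℝ → M2} (hP : IsPot P) {m : ℝ → ℝ → C2} (hm : IsSol P m)
    {U : ℝ≥0} (hU : wN P ≤ U) {k : ℝ} (hk : k ≠ 0) {x : ℝ} (hx : x ≤ 0) :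
    eLpNorm (dqR k P m x) 2 volume ≤ dqConst U := by
  have hP' := hP.shift k
  have hm' := hm.shift hP k
  have hR := hm'.adm_rmd hP'
  have hB := measEntries_dqP k hP.meas
  have hd := hm.adm_dqR hP k
  have hi := hP.integrable_entry_mul_mu hB (wN_dqP_lt_top k hP) 1 0
  have h := eLpNorm_le_of_volterra hP.meas hU hd.cont hd.bdd (x₀ := x)
    (fun y _ z => congrFun (congrFun (hm.dqR_eq hP k) y) z)
    (A := 2 * (2 * U) + (2 * U) * (2 * decayConst U)) fun y hy => by
      refine (eLpNorm_add_le (aestronglyMeasurable_osc hi.1 y)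
        (aestronglyMeasurable_vint hB hR.cont y volume) (by norm_num)).trans ?_
      have hBn := (eLpNorm_entryNorm_dqP_le_wN hk P y).trans (mul_le_mul' le_rfl hU)
      refine add_le_add ?_ ?_
      · refine (eLpNorm_osc_le hi (memLp_dqP_mul_mu hP k) y).trans (mul_le_mul' le_rfl ?_)
        refine le_trans ?_ hBn
        simpa using eLpNorm_entry_mul_le (A := dqP k P) hP.norm_mu 1 0 (w := fun _ => 1) (by simp)
      · refine (eLpNorm_vint_le_of_decay hB hR.cont (K := decayConst U)
          fun t ht => hm'.eLpNorm_rmd_le hP' (by rwa [wN_shiftP]) (ht.trans (hy.trans hx))).trans ?_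
        exact mul_le_mul' hBn le_rfl
  refine h.trans (le_of_eq ?_)
  rw [dqConst]; push_cast; ring

/-- Lipschitz constant of the difference quotients. -/
noncomputable def dqLipConst (U : ℝ≥0) : ℝ≥0 :=
  volterraConst U * (2 * (2 + 4 * U) + 2 * (2 * decayConst U) +
    (2 * U) * (2 * decayLipConst U) + 2 * dqConst U)

theorem IsSol.eLpNorm_dqR_sub_le {P Q : ℝ → M2} (hP : IsPot P) (hQ : IsPot Q) {m n : ℝ → ℝ → C2}
    (hm : IsSol P m) (hn : IsSol Q n) {U Δ : ℝ≥0} (hPU : wN P ≤ U) (hQU : wN Q ≤ U)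
    (hΔ : wN (P - Q) ≤ Δ) {k : ℝ} (hk : k ≠ 0) {x : ℝ} (hx : x ≤ 0) :
    eLpNorm ((dqR k P m - dqR k Q n) x) 2 volume ≤ (dqLipConst U * Δ : ℝ≥0) := by
  have hP' := hP.shift k
  have hm' := hm.shift hP k
  have hR := hm'.adm_rmd hP'
  have hQ' := hQ.shift k
  have hn' := hn.shift hQ k
  have hS := hn'.adm_rmd hQ'
  have hPU' : wN (shiftP k P) ≤ U := by rwa [wN_shiftP]
  have hQU' : wN (shiftP k Q) ≤ U := by rwa [wN_shiftP]
  have hΔ' : wN (shiftP k P - shiftP k Q) ≤ Δ := by rwa [← shiftP_sub, wN_shiftP]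
  have hB := measEntries_dqP k hP.meas
  have hC := measEntries_dqP k hQ.meas
  have hBw := wN_dqP_lt_top k hP
  have hCw := wN_dqP_lt_top k hQ
  have hd := hm.adm_dqR hP k
  have hd' := hn.adm_dqR hQ k
  have hi := hP.integrable_entry_mul_mu hB hBw 1 0
  have hj := hQ.integrable_entry_mul_mu hC hCw 1 0
  have heq := sub_eq_of_volterra hP.meas hP.fin hQ.meas hQ.fin hd hd' (hm.dqR_eq hP k)
    (hn.dqR_eq hQ k)
  -- Bilinear splitting in which each term has a quotient potential, unweighted, acting on a
  -- decaying remainder or on a decaying difference of remainders.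
  have e1 : vint (dqP k P) (rmd (shiftP k P) (shiftSol k m)) -
      vint (dqP k Q) (rmd (shiftP k Q) (shiftSol k n)) =
      vint (dqP k P - dqP k Q) (rmd (shiftP k P) (shiftSol k m)) +
      vint (dqP k Q) (rmd (shiftP k P) (shiftSol k m) - rmd (shiftP k Q) (shiftSol k n)) := by
    rw [vint_sub_left hB hBw hC hCw hR, vint_sub hC hCw hR hS]; abel
  rw [add_sub_add_comm, e1, ← osc_sub hi hj] at heq
  have h := eLpNorm_le_of_volterra hP.meas hPU (hd.sub hd').cont (hd.sub hd').bdd (x₀ := x)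
    (fun y _ z => congrFun (congrFun heq y) z)
    (A := (2 * (2 * Δ + 2 * Δ * (2 * U)) + ((2 * Δ) * (2 * decayConst U) +
      (2 * U) * (2 * (decayLipConst U * Δ)))) + Δ * (2 * dqConst U)) fun y hy => by
      have hBC : ∀ y, eLpNorm (fun y => entryNorm ((dqP k P - dqP k Q) y)) 2
          (volume.restrict (Iic y)) ≤ 2 * Δ := fun y => by
        rw [dqP_sub]
        exact (eLpNorm_entryNorm_dqP_le_wN hk _ y).trans (mul_le_mul' le_rfl hΔ)
      have hCn : ∀ y, eLpNorm (fun y => entryNorm (dqP k Q y)) 2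
          (volume.restrict (Iic y)) ≤ 2 * U := fun y =>
        (eLpNorm_entryNorm_dqP_le_wN hk _ y).trans (mul_le_mul' le_rfl hQU)
      have m1 := aestronglyMeasurable_osc (hi.sub hj).1 y
      have m2 := aestronglyMeasurable_vint (hB.sub hC) hR.cont y volume
      have m3 := aestronglyMeasurable_vint hC (hR.sub hS).cont y volume
      have m4 := aestronglyMeasurable_vint (hP.meas.sub hQ.meas) hd'.cont y volume
      refine (eLpNorm_add_le (m1.add (m2.add m3)) m4 (by norm_num)).trans (add_le_add
        ((eLpNorm_add_le m1 (m2.add m3) (by norm_num)).trans (add_le_add ?_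
        ((eLpNorm_add_le m2 m3 (by norm_num)).trans (add_le_add ?_ ?_)))) ?_)
      · refine (eLpNorm_osc_le (hi.sub hj) ((memLp_dqP_mul_mu hP k).sub (memLp_dqP_mul_mu hQ k))
          y).trans (mul_le_mul' le_rfl ?_)
        have := eLpNorm_entry_mul_sub_le hB hC hP.norm_mu (norm_mu_sub_mu_le hP hQ hΔ)
          (w := fun _ => 1) measurable_const (by simp) (D₁ := 2 * Δ) (D₂ := 2 * U)
          (ν := volume.restrict (Iic y)) (by simpa using hBC y) (by simpa using hCn y)
        simp only [one_smul] at this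
        exact this
      · refine (eLpNorm_vint_le_of_decay (hB.sub hC) hR.cont (K := decayConst U)
          fun t ht => hm'.eLpNorm_rmd_le hP' hPU' (ht.trans (hy.trans hx))).trans ?_
        exact mul_le_mul' (hBC y) le_rfl
      · refine (eLpNorm_vint_le_of_decay hC (hR.sub hS).cont
          (K := (decayLipConst U * Δ : ℝ≥0))
          fun t ht => hm'.eLpNorm_rmd_sub_le hP' hQ' hn' hPU' hQU' hΔ'
            (ht.trans (hy.trans hx))).trans ?_
        rw [ENNReal.coe_mul]
        exact mul_le_mul' (hCn y) le_rfl
      -- The quotient of the remainder is known to be bounded but not to decay, so here the full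
      -- weight of P - Q is spent.
      · refine (eLpNorm_vint_le (hP.meas.sub hQ.meas) hd'.cont (K := dqConst U)
          fun t ht => hn.eLpNorm_dqR_le hQ hQU hk (ht.trans (hy.trans hx))).trans ?_
        exact mul_le_mul' hΔ le_rfl
  refine h.trans (le_of_eq ?_)
  rw [dqLipConst]; push_cast; ring

/-- Lipschitz constant for the `H¹_z` norm of the remainder. -/
noncomputable def h1LipConst (U : ℝ≥0) : ℝ≥0 := 2 * decayLipConst U + dqLipConst U

theorem IsSol.eLpNorm_rmd_sub_le' {P Q : ℝ → M2} (hP : IsPot P) (hQ : IsPot Q) {m n : ℝ → ℝ → C2}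
    (hm : IsSol P m) (hn : IsSol Q n) {U Δ : ℝ≥0} (hPU : wN P ≤ U) (hQU : wN Q ≤ U)
    (hΔ : wN (P - Q) ≤ Δ) {x : ℝ} (hx : x ≤ 0) :
    eLpNorm ((rmd P m - rmd Q n) x) 2 volume ≤ (h1LipConst U * Δ : ℝ≥0) := by
  refine (hm.eLpNorm_rmd_sub_le hP hQ hn hPU hQU hΔ hx).trans ?_
  calc _ ≤ ((decayLipConst U * Δ : ℝ≥0) : ℝ≥0∞) * 1 := by
        gcongr
        rw [ENNReal.inv_le_one, ENNReal.one_le_ofReal]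
        exact one_le_wt x
    _ ≤ _ := by
        rw [mul_one, ENNReal.coe_le_coe]
        gcongr
        unfold h1LipConst
        exact le_add_right (le_mul_of_one_le_left' (by norm_num))

/-- Undoing the twist writes the increment as (diag(1, e^{2ikx}) - 1) R + k v, where R is the
difference of shifted remainders and v that of the quotients. The first term grows like |k||x|, and
the decay ⟨x⟩⁻¹ of R absorbs |x|. -/
theorem IsSol.eLpNorm_diff_rmd_sub_le {P Q : ℝ → M2} (hP : IsPot P) (hQ : IsPot Q)
    {m n : ℝ → ℝ → C2} (hm : IsSol P m) (hn : IsSol Q n) {U Δ : ℝ≥0} (hPU : wN P ≤ U)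
    (hQU : wN Q ≤ U) (hΔ : wN (P - Q) ≤ Δ) {k : ℝ} (hk : k ≠ 0) {x : ℝ} (hx : x ≤ 0) :
    eLpNorm (fun z => (rmd P m - rmd Q n) x (z + k) - (rmd P m - rmd Q n) x z) 2 volume ≤
      ENNReal.ofReal |k| * (h1LipConst U * Δ : ℝ≥0) := by
  have hP' := hP.shift k
  have hm' := hm.shift hP k
  have hQ' := hQ.shift k
  have hn' := hn.shift hQ k
  have hR := (hm'.adm_rmd hP').sub (hn'.adm_rmd hQ')
  have hv := (hm.adm_dqR hP k).sub (hn.adm_dqR hQ k)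
  have hPU' : wN (shiftP k P) ≤ U := by rwa [wN_shiftP]
  have hQU' : wN (shiftP k Q) ≤ U := by rwa [wN_shiftP]
  have hΔ' : wN (shiftP k P - shiftP k Q) ≤ Δ := by rwa [← shiftP_sub, wN_shiftP]
  set R : ℝ → ℝ → C2 := rmd (shiftP k P) (shiftSol k m) - rmd (shiftP k Q) (shiftSol k n) with hRd
  set v : ℝ → ℝ → C2 := dqR k P m - dqR k Q n with hvd
  have e : (fun z => (rmd P m - rmd Q n) x (z + k) - (rmd P m - rmd Q n) x z) =
      (fun z => twist k x (R x z) - R x z) + fun z => (k : ℂ) • v x z := by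
    ext1 z
    have hk' : (k : ℂ) ≠ 0 := by exact_mod_cast hk
    simp only [hRd, hvd, dqR, Pi.add_apply, Pi.sub_apply, Pi.smul_apply, map_sub, rmd_shift,
      twist_twist_neg, ← smul_sub, smul_inv_smul₀ hk']
    abel
  rw [e]
  have hc1 : Continuous fun z => twist k x (R x z) - R x z :=
    ((twist k x).continuous.comp (hR.continuous_right x)).sub (hR.continuous_right x)
  have hc2 : Continuous fun z => (k : ℂ) • v x z := (hv.continuous_right x).const_smul (k : ℂ)
  refine (eLpNorm_add_le hc1.aestronglyMeasurable hc2.aestronglyMeasurable (by norm_num)).trans ?_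
  have b1 : eLpNorm (fun z => twist k x (R x z) - R x z) 2 volume ≤
      ENNReal.ofReal (2 * |k| * |x|) * eLpNorm (R x) 2 volume :=
    eLpNorm_le_mul_eLpNorm_of_ae_le_mul (Eventually.of_forall fun z => norm_twist_sub_le _ _ _) 2
  have b2 : eLpNorm (fun z => (k : ℂ) • v x z) 2 volume ≤
      ENNReal.ofReal |k| * eLpNorm (v x) 2 volume :=
    eLpNorm_le_mul_eLpNorm_of_ae_le_mul (Eventually.of_forall fun z => by
      rw [norm_smul, Complex.norm_real, Real.norm_eq_abs]) 2
  have b3 := hm'.eLpNorm_rmd_sub_le hP' hQ' hn' hPU' hQU' hΔ' hx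
  have b4 := hm.eLpNorm_dqR_sub_le hP hQ hn hPU hQU hΔ hk hx
  have b5 : ENNReal.ofReal (2 * |k| * |x|) * (ENNReal.ofReal (wt x))⁻¹ ≤
      ENNReal.ofReal |k| * 2 := by
    rw [← ENNReal.ofReal_inv_of_pos (wt_pos x), ← ENNReal.ofReal_mul (by positivity),
      show (2 : ℝ≥0∞) = ENNReal.ofReal 2 by simp, ← ENNReal.ofReal_mul (by positivity)]
    refine ENNReal.ofReal_le_ofReal ?_
    rw [← div_eq_mul_inv, div_le_iff₀ (wt_pos x)]
    nlinarith [abs_le_wt x, abs_nonneg k]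
  calc _ ≤ ENNReal.ofReal (2 * |k| * |x|) * ((decayLipConst U * Δ : ℝ≥0) *
        (ENNReal.ofReal (wt x))⁻¹) + ENNReal.ofReal |k| * (dqLipConst U * Δ : ℝ≥0) :=
        add_le_add (b1.trans (by gcongr)) (b2.trans (by gcongr))
    _ = (ENNReal.ofReal (2 * |k| * |x|) * (ENNReal.ofReal (wt x))⁻¹) *
        (decayLipConst U * Δ : ℝ≥0) + ENNReal.ofReal |k| * (dqLipConst U * Δ : ℝ≥0) := by ring
    _ ≤ (ENNReal.ofReal |k| * 2) * (decayLipConst U * Δ : ℝ≥0) +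
        ENNReal.ofReal |k| * (dqLipConst U * Δ : ℝ≥0) := by gcongr
    _ = _ := by rw [h1LipConst]; push_cast; ring

/-! ### Regular potentials and the second order remainder -/

/-- Potentials whose lower left entry is absolutely continuous, with square integrable
derivative `p`. -/
structure IsRegPot (P : ℝ → M2) (p : ℝ → ℂ) : Prop extends IsPot P where
  trace : ∀ y, P y 1 1 = -P y 0 0
  cont_upper : Continuous fun y => P y 0 1
  bdd_lower : ∃ M, ∀ y, ‖P y 1 0‖ ≤ M
  meas_deriv : Measurable p
  memLp_deriv : MemLp p 2 volume
  prim : ∀ x y, P y 1 0 - P x 1 0 = ∫ t in x..y, p t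

/-- The integral of the product of the off-diagonal entries. -/
noncomputable def corr (P : ℝ → M2) (x : ℝ) : ℂ := ∫ y in Iic x, P y 0 1 * P y 1 0

/-- The source of the equation satisfied by the second order remainder. -/
noncomputable def src (P : ℝ → M2) (p : ℝ → ℂ) (y : ℝ) : ℂ :=
  mu P y * (p y + 2 * P y 0 0 * P y 1 0 - P y 1 0 * corr P y)

/-- The second order remainder. -/
noncomputable def rho (P : ℝ → M2) (m : ℝ → ℝ → C2) (x z : ℝ) : C2 :=
  (2 * Complex.I * z) • rmd P m x z + ((mu P x * corr P x) • e1 + (P x 1 0 * mu P x) • e2)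

/-- The second component of the inhomogeneity in the equation for the second order remainder. -/
noncomputable def bdry (P : ℝ → M2) (x z : ℝ) : ℂ :=
  P x 1 0 * mu P x + 2 * Complex.I * z * (∫ y in Iic x, phase z (x - y) * (P y 1 0 * mu P y)) -
    ∫ y in Iic x, phase z (x - y) * (P y 1 0 * (mu P y * corr P y) - P y 0 0 * (P y 1 0 * mu P y))

namespace IsRegPot

variable {P : ℝ → M2} {p : ℝ → ℂ}

theorem locallyIntegrable_deriv (hP : IsRegPot P p) : LocallyIntegrable p :=
  hP.memLp_deriv.locallyIntegrable (by norm_num)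

theorem cont_lower (hP : IsRegPot P p) : Continuous fun y => P y 1 0 :=
  continuous_of_primitive hP.locallyIntegrable_deriv hP.prim

theorem integrable_mul (hP : IsRegPot P p) : Integrable fun y => P y 0 1 * P y 1 0 := by
  obtain ⟨M, hM⟩ := hP.bdd_lower
  exact (integrable_entry hP.meas hP.fin 0 1).mul_bdd hP.cont_lower.aestronglyMeasurable
    (Eventually.of_forall hM)

theorem hasDerivAt_corr (hP : IsRegPot P p) (x : ℝ) :
    HasDerivAt (corr P) (P x 0 1 * P x 1 0) x :=
  hasDerivAt_integral_Iic hP.integrable_mul (hP.cont_upper.mul hP.cont_lower) x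

theorem continuous_corr (hP : IsRegPot P p) : Continuous (corr P) :=
  continuous_iff_continuousAt.2 fun x => (hP.hasDerivAt_corr x).continuousAt

theorem exists_norm_corr_le (hP : IsRegPot P p) : ∃ M, ∀ x, ‖corr P x‖ ≤ M :=
  ⟨∫ y, ‖P y 0 1 * P y 1 0‖, fun _ => (norm_integral_le_integral_norm _).trans
    (setIntegral_le_integral hP.integrable_mul.norm (Eventually.of_forall fun _ => norm_nonneg _))⟩

theorem integrable_first (hP : IsRegPot P p) : Integrable fun y =>
    P y 0 0 * (mu P y * corr P y) + P y 0 1 * (P y 1 0 * mu P y) := by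
  obtain ⟨M, hM⟩ := hP.exists_norm_corr_le
  refine Integrable.add ?_ ?_
  · refine (integrable_entry hP.meas hP.fin 0 0).mul_bdd (c := M)
      (hP.continuous_mu.mul hP.continuous_corr).aestronglyMeasurable
      (Eventually.of_forall fun y => ?_)
    rw [norm_mul, hP.norm_mu, one_mul]; exact hM y
  · simp only [← mul_assoc]
    exact hP.integrable_mul.mul_bdd (c := 1) hP.continuous_mu.aestronglyMeasurable
      (Eventually.of_forall fun y => (hP.norm_mu y).le)

/-- The integrand is (μ · corr)', with limit 0 at -∞. The first components of the correction in
`rho` therefore balance exactly and leave no source in the first row. -/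
theorem integral_first (hP : IsRegPot P p) (x : ℝ) :
    ∫ y in Iic x, (P y 0 0 * (mu P y * corr P y) + P y 0 1 * (P y 1 0 * mu P y)) =
      mu P x * corr P x := by
  have h := integral_Iic_of_hasDerivAt_of_tendsto (a := x) (m := 0)
    (f := fun y => mu P y * corr P y)
    (hP.continuous_mu.mul hP.continuous_corr).continuousWithinAt
    (fun y _ => (hP.hasDerivAt_mu y).mul (hP.hasDerivAt_corr y)) ?_ ?_
  · rw [sub_zero] at h
    rw [← h]
    congr 1; ext y; ring
  · exact (hP.integrable_first.congr (Eventually.of_forall fun y => by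
      ring)).integrableOn
  · refine squeeze_zero_norm (a := fun x => ‖corr P x‖) (fun y => ?_) ?_
    · rw [norm_mul, hP.norm_mu, one_mul]
    · simpa [corr] using (tendsto_integral_Iic_atBot hP.integrable_mul).norm

theorem integrable_second (hP : IsRegPot P p) : Integrable fun y =>
    P y 1 0 * (mu P y * corr P y) - P y 0 0 * (P y 1 0 * mu P y) := by
  obtain ⟨M, hM⟩ := hP.exists_norm_corr_le
  obtain ⟨N, hN⟩ := hP.bdd_lower
  refine Integrable.sub ?_ ?_
  · refine (integrable_entry hP.meas hP.fin 1 0).mul_bdd (c := M)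
      (hP.continuous_mu.mul hP.continuous_corr).aestronglyMeasurable
      (Eventually.of_forall fun y => ?_)
    rw [norm_mul, hP.norm_mu, one_mul]; exact hM y
  · refine (integrable_entry hP.meas hP.fin 0 0).mul_bdd (c := N)
      (hP.cont_lower.mul hP.continuous_mu).aestronglyMeasurable
      (Eventually.of_forall fun y => ?_)
    rw [norm_mul, hP.norm_mu, mul_one]; exact hN y

/-- The factor z in `rho` prevents a bound uniform in z; this is why `Adm` asks only for local
uniformity in z. -/
theorem adm_rho (hP : IsRegPot P p) {m : ℝ → ℝ → C2} (hm : IsSol P m) : Adm (rho P m) := by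
  have hr := hm.adm_rmd hP.toIsPot
  have hc := hP.cont_lower
  have hμ := hP.continuous_mu
  have hB := hP.continuous_corr
  obtain ⟨M, hM⟩ := hP.exists_norm_corr_le
  obtain ⟨N, hN⟩ := hP.bdd_lower
  refine ⟨?_, fun R => ?_⟩
  · refine Continuous.add (Continuous.smul
      (by fun_prop : Continuous fun q : ℝ × ℝ => 2 * Complex.I * (q.2 : ℂ)) hr.cont) (Continuous.add ?_ ?_)
    · exact Continuous.smul (f := fun q : ℝ × ℝ => mu P q.1 * corr P q.1) (by fun_prop)
        continuous_const
    · exact Continuous.smul (f := fun q : ℝ × ℝ => P q.1 1 0 * mu P q.1)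
        ((hc.comp continuous_fst).mul (hμ.comp continuous_fst)) continuous_const
  · obtain ⟨K, hK⟩ := hr.bdd R
    refine ⟨2 * R * K + (M + N), fun x z hz => (norm_add_le _ _).trans (add_le_add ?_
      ((norm_add_le _ _).trans (add_le_add ?_ ?_)))⟩
    · rw [norm_smul]
      refine mul_le_mul ?_ (hK x z hz) (norm_nonneg _) (by linarith [abs_nonneg z])
      simpa using hz
    · rw [norm_smul, norm_mul, hP.norm_mu, norm_e1, one_mul, mul_one]; exact hM x
    · rw [norm_smul, norm_mul, hP.norm_mu, norm_e2, mul_one, mul_one]; exact hN x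

/-- Multiply the equation of the remainder by 2iz and insert the corrections. The first row cancels
by `integral_first`. In the second, trace zero replaces P₁₁ by -P₀₀, and what is left is `bdry`. -/
theorem rho_eq (hP : IsRegPot P p) {m : ℝ → ℝ → C2} (hm : IsSol P m) :
    rho P m = (fun x z => bdry P x z • e2) + vint P (rho P m) := by
  ext1 x; ext1 z
  have hr := hm.adm_rmd hP.toIsPot
  have h1 := congrFun (congrFun (hm.rmd_eq hP.toIsPot) x) z
  have h2 : ∀ y, vker z (x - y) (P y) (rho P m y z) =
      (2 * Complex.I * z) • vker z (x - y) (P y) (rmd P m y z) +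
      ((P y 0 0 * (mu P y * corr P y) + P y 0 1 * (P y 1 0 * mu P y)) • e1 +
        (phase z (x - y) * (P y 1 0 * (mu P y * corr P y) - P y 0 0 * (P y 1 0 * mu P y))) • e2) :=
      fun y => by
    rw [rho, vker_add, vker_smul]
    congr 1
    simp only [vker_eq, hP.trace]
    simp [e1, e2, sub_eq_add_neg]
  have i2 : Integrable fun y =>
      (P y 0 0 * (mu P y * corr P y) + P y 0 1 * (P y 1 0 * mu P y)) • e1 :=
    hP.integrable_first.smul_const e1
  have i3 : Integrable fun y => (phase z (x - y) *
      (P y 1 0 * (mu P y * corr P y) - P y 0 0 * (P y 1 0 * mu P y))) • e2 :=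
    (integrable_phase_mul hP.integrable_second x z).smul_const e2
  have i1 : IntegrableOn (fun y => (2 * Complex.I * z) • vker z (x - y) (P y) (rmd P m y z))
      (Iic x) := (hr.integrableOn_vker hP.meas hP.fin x z (Iic x)).smul (2 * Complex.I * (z : ℂ))
  have i4 : IntegrableOn (fun y =>
      (P y 0 0 * (mu P y * corr P y) + P y 0 1 * (P y 1 0 * mu P y)) • e1 +
        (phase z (x - y) * (P y 1 0 * (mu P y * corr P y) - P y 0 0 * (P y 1 0 * mu P y))) • e2)
      (Iic x) := i2.integrableOn.add i3.integrableOn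
  have h3 : vint P (rho P m) x z = (2 * Complex.I * z) • vint P (rmd P m) x z +
      ((mu P x * corr P x) • e1 + (∫ y in Iic x, phase z (x - y) *
        (P y 1 0 * (mu P y * corr P y) - P y 0 0 * (P y 1 0 * mu P y))) • e2) := by
    unfold vint
    simp only [h2]
    rw [integral_add i1 i4, integral_add i2.integrableOn i3.integrableOn,
      integral_smul_const, integral_smul_const, hP.integral_first, integral_smul]
  rw [Pi.add_apply, Pi.add_apply, h3, rho]
  rw [Pi.add_apply, Pi.add_apply] at h1
  conv_lhs => rw [h1]
  simp only [osc, bdry]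
  module

/-- Integrating 2iz ∫ e^{2iz(x-y)} P₁₀ μ by parts produces -P₁₀ μ at x, which cancels the boundary
value in `bdry`, and the derivative (P₁₀ μ)'. Together with the remaining integral the density is
`src`. It is only known to be in L², so its integral is improper, taken along a sequence on which
P₁₀ vanishes in the limit. -/
theorem tendsto_integral_src (hP : IsRegPot P p) {a : ℕ → ℝ} (ha : Tendsto a atTop atBot)
    (hca : Tendsto (fun n => P (a n) 1 0) atTop (𝓝 0)) (x z : ℝ) :
    Tendsto (fun n => ∫ y in Ioc (a n) x, phase z (x - y) * src P p y) atTop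
      (𝓝 (bdry P x z)) := by
  have iW : Integrable fun y => P y 1 0 * mu P y :=
    hP.integrable_entry_mul_mu hP.meas hP.fin 1 0
  have i1 := (integrable_phase_mul iW x z)
  have i2 := (integrable_phase_mul hP.integrable_second x z)
  have t1 := intervalIntegral_tendsto_integral_Iic x i1.integrableOn ha
  have t2 := intervalIntegral_tendsto_integral_Iic x i2.integrableOn ha
  have t3 : Tendsto (fun n => phase z (x - a n) * mu P (a n) * P (a n) 1 0) atTop (𝓝 0) := by
    refine squeeze_zero_norm (fun n => ?_) (by simpa using hca.norm)
    rw [norm_mul, norm_mul, norm_phase, hP.norm_mu, one_mul, one_mul]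
  have t4 := ((t3.const_sub (P x 1 0 * mu P x)).add (t1.const_mul (2 * Complex.I * z))).sub t2
  rw [sub_zero] at t4
  refine t4.congr' ?_
  filter_upwards [ha.eventually_le_atBot x] with n hn
  rw [← intervalIntegral.integral_of_le hn]
  have hphd : ∀ y, HasDerivAt (fun y => phase z (x - y))
      (-(2 * Complex.I * z) * phase z (x - y)) y := fun y => by
    have := ((((hasDerivAt_id y).const_sub x).ofReal_comp).const_mul (2 * Complex.I * z)).cexp
    convert! this using 1
    simp [phase]; ring
  have hcph : Continuous fun y => phase z (x - y) := by unfold phase; fun_prop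
  have hμ := hP.continuous_mu
  -- The C¹ factor is e^{2iz(x-t)} μ(t) and the absolutely continuous one is P₁₀; p enters only as a
  -- locally integrable derivative.
  have hk : ∫ t in a n..x, ((-(2 * Complex.I * z) * phase z (x - t) * mu P t +
      phase z (x - t) * (P t 0 0 * mu P t)) * P t 1 0 + phase z (x - t) * mu P t * p t) =
      phase z (x - x) * mu P x * P x 1 0 - phase z (x - a n) * mu P (a n) * P (a n) 1 0 :=
    integral_mul_primitive hP.locallyIntegrable_deriv hP.prim
    (fun y => (hphd y).mul (hP.hasDerivAt_mu y))
    (((continuous_const.mul hcph).mul hμ).add (hcph.mul (hP.cont.mul hμ))) (a n) x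
  rw [sub_self, phase_zero, one_mul] at hk
  have j1 := i1.intervalIntegrable (a := a n) (b := x)
  have j2 := i2.intervalIntegrable (a := a n) (b := x)
  have j3 : IntervalIntegrable (fun t => (-(2 * Complex.I * z) * phase z (x - t) * mu P t +
      phase z (x - t) * (P t 0 0 * mu P t)) * P t 1 0 + phase z (x - t) * mu P t * p t)
      volume (a n) x := by
    refine IntervalIntegrable.add (Continuous.intervalIntegrable ?_ _ _)
      (IntervalIntegrable.continuousOn_mul ?_ (hcph.mul hμ).continuousOn)
    · exact (((continuous_const.mul hcph).mul hμ).add (hcph.mul (hP.cont.mul hμ))).mul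
        hP.cont_lower
    · exact intervalIntegrable_of_locallyIntegrable hP.locallyIntegrable_deriv _ _
  rw [mul_comm (P x 1 0), ← hk, ← intervalIntegral.integral_const_mul,
    ← intervalIntegral.integral_add j3 (j1.const_mul _),
    ← intervalIntegral.integral_sub (j3.add (j1.const_mul _)) j2]
  congr 1; ext y
  simp only [src]
  ring

end IsRegPot

/-- A nonnegative integrable function is small along a sequence tending to `-∞`. -/
theorem exists_seq_tendsto_zero {h : ℝ → ℝ} (hh : Integrable h) (h0 : ∀ y, 0 ≤ h y) :
    ∃ a : ℕ → ℝ, Tendsto a atTop atBot ∧ Tendsto (fun n => h (a n)) atTop (𝓝 0) := by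
  have key : ∀ n : ℕ, ∃ y ≤ -(n : ℝ), h y ≤ 1 / ((n : ℝ) + 1) := fun n => by
    by_contra! hc
    have : IntegrableOn (fun _ => 1 / ((n : ℝ) + 1)) (Iic (-(n : ℝ))) := by
      refine Integrable.mono' (hh.integrableOn (s := Iic (-(n : ℝ)))) (by fun_prop) ?_
      filter_upwards [ae_restrict_mem measurableSet_Iic] with y hy
      rw [Real.norm_of_nonneg (by positivity)]
      exact (hc y hy).le
    rw [integrableOn_const_iff] at this
    have h1 : (n : ℝ) + 1 ≠ 0 := by positivity
    simp [h1] at this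
  choose a ha ha' using key
  exact ⟨a, tendsto_atBot_mono ha (tendsto_neg_atTop_atBot.comp tendsto_natCast_atTop_atTop),
    squeeze_zero (fun n => h0 _) ha' tendsto_one_div_add_atTop_nhds_zero_nat⟩

/-! ### Bounds for the second order remainder -/

/-- The bounds on a regular potential that control its second order remainder. -/
structure RegBound (P : ℝ → M2) (p : ℝ → ℂ) (U : ℝ≥0) : Prop where
  weighted : wN P ≤ U
  diag : ∀ y, ‖P y 0 0‖ ≤ U
  upper : ∀ y, ‖P y 0 1‖ ≤ U
  deriv : eLpNorm p 2 volume ≤ U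

theorem eLpNorm_entryNorm_le (P : ℝ → M2) : eLpNorm (fun y => entryNorm (P y)) 2 volume ≤ wN P := by
  refine eLpNorm_mono_real fun y => ?_
  rw [Real.norm_of_nonneg (entryNorm_nonneg _)]
  exact le_mul_of_one_le_left (entryNorm_nonneg _) (one_le_wt y)

theorem setIntegral_entryNorm_le {P : ℝ → M2} (hP : MeasEntries P) {U : ℝ≥0} (hU : wN P ≤ U)
    (x : ℝ) : ∫ y in Iic x, entryNorm (P y) ≤ 2 * U := by
  rw [integral_eq_lintegral_of_nonneg_ae (Eventually.of_forall fun y => entryNorm_nonneg _)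
    hP.entryNorm.aestronglyMeasurable]
  refine ENNReal.toReal_le_of_le_ofReal (by positivity)
    ((setLIntegral_entryNorm_le hP x).trans ?_)
  rw [ENNReal.ofReal_mul (by norm_num), ENNReal.ofReal_coe_nnreal, ENNReal.ofReal_ofNat]
  gcongr

theorem norm_setIntegral_le {P Q : ℝ → M2} (hP : MeasEntries P) (hQ : MeasEntries Q)
    {U V k l : ℝ≥0} (hU : wN P ≤ U) (hV : wN Q ≤ V) {f : ℝ → ℂ}
    (hf : ∀ y, ‖f y‖ ≤ k * entryNorm (P y) + l * entryNorm (Q y)) (x : ℝ) :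
    ‖∫ y in Iic x, f y‖ ≤ k * (2 * U) + l * (2 * V) := by
  have i1 := ((integrable_entryNorm hP (hU.trans_lt ENNReal.coe_lt_top)).const_mul
    (k : ℝ)).integrableOn (s := Iic x)
  have i2 := ((integrable_entryNorm hQ (hV.trans_lt ENNReal.coe_lt_top)).const_mul
    (l : ℝ)).integrableOn (s := Iic x)
  refine (norm_integral_le_of_norm_le (i1.add i2) (Eventually.of_forall hf)).trans ?_
  rw [integral_add' i1 i2, integral_const_mul, integral_const_mul]
  have h1 := setIntegral_entryNorm_le hP hU x
  have h2 := setIntegral_entryNorm_le hQ hV x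
  gcongr

namespace RegBound

variable {P Q : ℝ → M2} {p q : ℝ → ℂ} {U Δ : ℝ≥0}

theorem norm_corr_le (hP : IsRegPot P p) (h : RegBound P p U) (x : ℝ) :
    ‖corr P x‖ ≤ 2 * U ^ 2 := by
  refine (norm_setIntegral_le (k := U) (l := 0) hP.meas hP.meas h.weighted h.weighted
    (fun y => ?_) x).trans (le_of_eq ?_)
  · rw [norm_mul]
    have h1 := h.upper y
    have h2 := norm_apply_le_entryNorm (P y) 1 0
    simp only [NNReal.coe_zero, zero_mul, add_zero]
    gcongr
  · push_cast; ring

theorem norm_corr_sub_le (hP : IsRegPot P p) (hQ : IsRegPot Q q) (h : RegBound P p U)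
    (h' : RegBound Q q U) (hd : RegBound (P - Q) (p - q) Δ) (x : ℝ) :
    ‖corr P x - corr Q x‖ ≤ 4 * U * Δ := by
  rw [corr, corr, ← integral_sub hP.integrable_mul.integrableOn hQ.integrable_mul.integrableOn]
  refine (norm_setIntegral_le (k := Δ) (l := U) hP.meas (hP.meas.sub hQ.meas) h.weighted
    hd.weighted (fun y => ?_) x).trans (le_of_eq ?_)
  · have e : P y 0 1 * P y 1 0 - Q y 0 1 * Q y 1 0 =
        (P - Q) y 0 1 * P y 1 0 + Q y 0 1 * (P - Q) y 1 0 := by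
      simp only [Pi.sub_apply, Matrix.sub_apply]; ring
    rw [e]
    refine (norm_add_le _ _).trans ?_
    rw [norm_mul, norm_mul]
    have h1 := hd.upper y
    have h2 := norm_apply_le_entryNorm (P y) 1 0
    have h3 := h'.upper y
    have h4 := norm_apply_le_entryNorm ((P - Q) y) 1 0
    gcongr
  · ring

theorem norm_core_le (hP : IsRegPot P p) (h : RegBound P p U) (y : ℝ) :
    ‖p y + 2 * P y 0 0 * P y 1 0 - P y 1 0 * corr P y‖ ≤
      ‖p y‖ + (2 * U + 2 * U ^ 2 : ℝ≥0) * entryNorm (P y) := by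
  have h1 := h.diag y
  have h2 := norm_apply_le_entryNorm (P y) 1 0
  have h3 := h.norm_corr_le hP y
  have h4 := entryNorm_nonneg (P y)
  calc _ ≤ ‖p y‖ + 2 * ‖P y 0 0‖ * ‖P y 1 0‖ + ‖P y 1 0‖ * ‖corr P y‖ := by
        refine (norm_sub_le _ _).trans (add_le_add ((norm_add_le _ _).trans ?_) ?_) <;>
        simp
    _ ≤ ‖p y‖ + 2 * U * entryNorm (P y) + entryNorm (P y) * (2 * U ^ 2) := by gcongr
    _ = _ := by push_cast; ring

theorem norm_core_sub_le (hP : IsRegPot P p) (hQ : IsRegPot Q q) (h : RegBound P p U)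
    (h' : RegBound Q q U) (hd : RegBound (P - Q) (p - q) Δ) (y : ℝ) :
    ‖(p y + 2 * P y 0 0 * P y 1 0 - P y 1 0 * corr P y) -
      (q y + 2 * Q y 0 0 * Q y 1 0 - Q y 1 0 * corr Q y)‖ ≤
      ‖(p - q) y‖ + (2 * U + 2 * U ^ 2 : ℝ≥0) * entryNorm ((P - Q) y) +
        (2 * Δ + 4 * U * Δ : ℝ≥0) * entryNorm (Q y) := by
  have h1 := h.diag y
  have h2 := norm_apply_le_entryNorm ((P - Q) y) 1 0
  have h3 := h.norm_corr_le hP y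
  have h4 := entryNorm_nonneg ((P - Q) y)
  have h5 := hd.diag y
  have h6 := norm_apply_le_entryNorm (Q y) 1 0
  have h7 := norm_corr_sub_le hP hQ h h' hd y
  have h8 := entryNorm_nonneg (Q y)
  have e : (p y + 2 * P y 0 0 * P y 1 0 - P y 1 0 * corr P y) -
      (q y + 2 * Q y 0 0 * Q y 1 0 - Q y 1 0 * corr Q y) =
      (p - q) y + 2 * P y 0 0 * (P - Q) y 1 0 + 2 * (P - Q) y 0 0 * Q y 1 0 -
        (P - Q) y 1 0 * corr P y - Q y 1 0 * (corr P y - corr Q y) := by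
    simp only [Pi.sub_apply, Matrix.sub_apply]; ring
  rw [e]
  calc _ ≤ ‖(p - q) y‖ + 2 * ‖P y 0 0‖ * ‖(P - Q) y 1 0‖ + 2 * ‖(P - Q) y 0 0‖ * ‖Q y 1 0‖ +
        ‖(P - Q) y 1 0‖ * ‖corr P y‖ + ‖Q y 1 0‖ * ‖corr P y - corr Q y‖ := by
        refine (norm_sub_le _ _).trans (add_le_add ((norm_sub_le _ _).trans
          (add_le_add ((norm_add_le _ _).trans (add_le_add ((norm_add_le _ _).trans ?_) ?_)) ?_))
          ?_) <;> simp
    _ ≤ ‖(p - q) y‖ + 2 * U * entryNorm ((P - Q) y) + 2 * Δ * entryNorm (Q y) +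
        entryNorm ((P - Q) y) * (2 * U ^ 2) + entryNorm (Q y) * (4 * U * Δ) := by gcongr
    _ = _ := by push_cast; ring

end RegBound

/-- Bound for the source. -/
noncomputable def srcConst (U : ℝ≥0) : ℝ≥0 := U + (2 * U + 2 * U ^ 2) * U

/-- Lipschitz constant of the source. -/
noncomputable def srcLipConst (U : ℝ≥0) : ℝ≥0 :=
  1 + (2 * U + 2 * U ^ 2) + (2 + 4 * U) * U + 2 * srcConst U

namespace RegBound

variable {P Q : ℝ → M2} {p q : ℝ → ℂ} {U Δ : ℝ≥0}

theorem eLpNorm_core_le (hP : IsRegPot P p) (h : RegBound P p U) :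
    eLpNorm (fun y => p y + 2 * P y 0 0 * P y 1 0 - P y 1 0 * corr P y) 2 volume ≤ srcConst U := by
  refine (eLpNorm_le_of_norm_le_add hP.meas_deriv.norm hP.meas.entryNorm (h.norm_core_le hP)
    ((eLpNorm_norm p).le.trans h.deriv) ((eLpNorm_entryNorm_le P).trans h.weighted)).trans ?_
  rw [srcConst]; push_cast; rfl

theorem measurable_core (hP : IsRegPot P p) :
    Measurable fun y => p y + 2 * P y 0 0 * P y 1 0 - P y 1 0 * corr P y :=
  (hP.meas_deriv.add (((hP.meas 0 0).const_mul 2).mul (hP.meas 1 0))).sub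
    ((hP.meas 1 0).mul hP.continuous_corr.measurable)

theorem memLp_src (hP : IsRegPot P p) (h : RegBound P p U) : MemLp (src P p) 2 volume := by
  refine ⟨(hP.continuous_mu.measurable.mul (measurable_core hP)).aestronglyMeasurable, ?_⟩
  refine lt_of_le_of_lt ?_ ((h.eLpNorm_core_le hP).trans_lt ENNReal.coe_lt_top)
  refine eLpNorm_mono fun y => ?_
  rw [src, norm_mul, hP.norm_mu, one_mul]

theorem eLpNorm_src_le (hP : IsRegPot P p) (h : RegBound P p U) :
    eLpNorm (src P p) 2 volume ≤ srcConst U := by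
  refine (eLpNorm_mono fun y => ?_).trans (h.eLpNorm_core_le hP)
  rw [src, norm_mul, hP.norm_mu, one_mul]

theorem eLpNorm_src_sub_le (hP : IsRegPot P p) (hQ : IsRegPot Q q) (h : RegBound P p U)
    (h' : RegBound Q q U) (hd : RegBound (P - Q) (p - q) Δ) :
    eLpNorm (src P p - src Q q) 2 volume ≤ (srcLipConst U * Δ : ℝ≥0) := by
  have hPQ := hP.meas.sub hQ.meas
  have hcore := (measurable_core hP).sub (measurable_core hQ)
  -- First the difference of the sources stripped of the factor μ; the variation of μ, at most 2Δ,
  -- is added afterwards.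
  have k1 := eLpNorm_le_of_norm_le_add (c := 1)
    (((hP.meas_deriv.sub hQ.meas_deriv).norm).add (hPQ.entryNorm.const_mul
      ((2 * U + 2 * U ^ 2 : ℝ≥0) : ℝ))) (hQ.meas.entryNorm.const_mul
      ((2 * Δ + 4 * U * Δ : ℝ≥0) : ℝ)) (ν := volume)
    (fun y => (norm_core_sub_le hP hQ h h' hd y).trans_eq (by
      simp only [Pi.add_apply, Pi.sub_apply, NNReal.coe_one, one_mul]))
    (D₁ := Δ + (2 * U + 2 * U ^ 2 : ℝ≥0) * Δ) (D₂ := 0 + (2 * Δ + 4 * U * Δ : ℝ≥0) * U)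
    (eLpNorm_le_of_norm_le_add (hP.meas_deriv.sub hQ.meas_deriv).norm hPQ.entryNorm
      (fun y => by
        rw [Real.norm_of_nonneg]
        · rfl
        · have := entryNorm_nonneg ((P - Q) y)
          exact add_nonneg (norm_nonneg _) (by positivity))
      ((eLpNorm_norm (p - q)).le.trans hd.deriv) ((eLpNorm_entryNorm_le _).trans hd.weighted))
    (eLpNorm_le_of_norm_le_add (measurable_const (a := (0 : ℝ))) hQ.meas.entryNorm (fun y => by
        have := entryNorm_nonneg (Q y)
        rw [Real.norm_of_nonneg (by positivity), zero_add])
      (by simp) ((eLpNorm_entryNorm_le _).trans h'.weighted))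
  have k2 := eLpNorm_le_of_norm_le_add (h := src P p - src Q q) (c := 2 * Δ) hcore.norm
    (measurable_core hQ).norm (ν := volume) (fun y => by
      have e : (src P p - src Q q) y = mu P y *
          ((p y + 2 * P y 0 0 * P y 1 0 - P y 1 0 * corr P y) -
            (q y + 2 * Q y 0 0 * Q y 1 0 - Q y 1 0 * corr Q y)) + (mu P y - mu Q y) *
            (q y + 2 * Q y 0 0 * Q y 1 0 - Q y 1 0 * corr Q y) := by
        simp only [Pi.sub_apply, src]; ring
      rw [e]
      refine (norm_add_le _ _).trans ?_
      rw [norm_mul, norm_mul, hP.norm_mu, one_mul]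
      have := norm_mu_sub_mu_le hP.toIsPot hQ.toIsPot hd.weighted y
      push_cast
      exact add_le_add le_rfl (mul_le_mul_of_nonneg_right this (norm_nonneg _)))
    ((eLpNorm_norm _).le.trans k1) ((eLpNorm_norm _).le.trans (h'.eLpNorm_core_le hQ))
  refine k2.trans (le_of_eq ?_)
  rw [srcLipConst]; push_cast; ring

end RegBound

/-- Bound for the second order remainder. -/
noncomputable def rhoConst (U : ℝ≥0) : ℝ≥0 := volterraConst U * (2 * srcConst U)

/-- Lipschitz constant of the second order remainder. -/
noncomputable def rhoLipConst (U : ℝ≥0) : ℝ≥0 :=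
  volterraConst U * (2 * srcLipConst U + 2 * rhoConst U)

theorem eLpNorm_smul_e2 {f : ℝ → ℂ} {ν : Measure ℝ} :
    eLpNorm (fun z => f z • e2) 2 ν = eLpNorm f 2 ν :=
  eLpNorm_congr_norm_ae (Eventually.of_forall fun z => by simp [norm_smul])

namespace IsRegPot

variable {P Q : ℝ → M2} {p q : ℝ → ℂ} {U Δ : ℝ≥0} {m n : ℝ → ℝ → C2}

theorem integrable_norm_lower (hP : IsRegPot P p) : Integrable fun y => ‖P y 1 0‖ :=
  (integrable_entry hP.meas hP.fin 1 0).norm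

theorem eLpNorm_bdry_le (hP : IsRegPot P p) (h : RegBound P p U) (x : ℝ) :
    eLpNorm (fun z => bdry P x z • e2) 2 volume ≤ 2 * srcConst U := by
  obtain ⟨a, ha, ha'⟩ := exists_seq_tendsto_zero hP.integrable_norm_lower fun _ => norm_nonneg _
  rw [eLpNorm_smul_e2]
  refine (eLpNorm_le_of_tendsto_phase_integral ((h.memLp_src hP).restrict _)
    (hP.tendsto_integral_src ha (tendsto_zero_iff_norm_tendsto_zero.2 ha') x)).trans ?_
  gcongr
  exact (eLpNorm_mono_measure _ Measure.restrict_le_self).trans (h.eLpNorm_src_le hP)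

theorem eLpNorm_bdry_sub_le (hP : IsRegPot P p) (hQ : IsRegPot Q q) (h : RegBound P p U)
    (h' : RegBound Q q U) (hd : RegBound (P - Q) (p - q) Δ) (x : ℝ) :
    eLpNorm (fun z => bdry P x z • e2 - bdry Q x z • e2) 2 volume ≤
      2 * (srcLipConst U * Δ : ℝ≥0) := by
  -- A single sequence has to serve both potentials, so it is extracted from the sum of the moduli
  -- of the two lower left entries.
  obtain ⟨a, ha, ha'⟩ := exists_seq_tendsto_zero
    (hP.integrable_norm_lower.add hQ.integrable_norm_lower)
    fun _ => add_nonneg (norm_nonneg _) (norm_nonneg _)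
  have t1 := hP.tendsto_integral_src ha (squeeze_zero_norm
    (fun n => le_add_of_nonneg_right (norm_nonneg _)) ha') x
  have t2 := hQ.tendsto_integral_src ha (squeeze_zero_norm
    (fun n => le_add_of_nonneg_left (norm_nonneg _)) ha') x
  simp only [← sub_smul]
  rw [eLpNorm_smul_e2 (f := fun z => bdry P x z - bdry Q x z)]
  have hs := (h.memLp_src hP).sub (h'.memLp_src hQ)
  have hint : ∀ {g : ℝ → ℂ}, MemLp g 2 volume → ∀ n z,
      IntegrableOn (fun y => phase z (x - y) * g y) (Ioc (a n) x) := fun hg n z =>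
    integrable_phase_mul ((hg.restrict (Ioc (a n) x)).integrable (by norm_num)) x z
  refine (eLpNorm_le_of_tendsto_phase_integral (a := a) (x := x) (hs.restrict _) fun z => ?_).trans
    (mul_le_mul' le_rfl ((eLpNorm_mono_measure _ Measure.restrict_le_self).trans
      (RegBound.eLpNorm_src_sub_le hP hQ h h' hd)))
  refine ((t1 z).sub (t2 z)).congr fun n => ?_
  rw [← integral_sub (hint (h.memLp_src hP) n z) (hint (h'.memLp_src hQ) n z)]
  simp only [Pi.sub_apply, mul_sub]

/-- The source is bounded in L²_z uniformly in x and no decay is asked of it, so the estimate holds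
on the whole line. -/
theorem eLpNorm_rho_le (hP : IsRegPot P p) (hm : IsSol P m) (h : RegBound P p U) (x : ℝ) :
    eLpNorm (rho P m x) 2 volume ≤ rhoConst U := by
  have ha := hP.adm_rho hm
  refine (eLpNorm_le_of_volterra hP.meas h.weighted ha.cont ha.bdd
    (fun y _ z => congrFun (congrFun (hP.rho_eq hm) y) z)
    fun y _ => hP.eLpNorm_bdry_le h y).trans (le_of_eq ?_)
  rw [rhoConst]; push_cast; rfl

theorem eLpNorm_rho_sub_le (hP : IsRegPot P p) (hQ : IsRegPot Q q) (hm : IsSol P m)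
    (hn : IsSol Q n) (h : RegBound P p U) (h' : RegBound Q q U)
    (hd : RegBound (P - Q) (p - q) Δ) (x : ℝ) :
    eLpNorm ((rho P m - rho Q n) x) 2 volume ≤ (rhoLipConst U * Δ : ℝ≥0) := by
  have ha := hP.adm_rho hm
  have hb := hQ.adm_rho hn
  have heq := sub_eq_of_volterra hP.meas hP.fin hQ.meas hQ.fin ha hb (hP.rho_eq hm) (hQ.rho_eq hn)
  have hmv : ∀ y, AEStronglyMeasurable (vint (P - Q) (rho Q n) y) volume := fun y =>
    aestronglyMeasurable_vint (hP.meas.sub hQ.meas) hb.cont y volume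
  -- Measurability of this source is read off the equation: it equals a continuous function minus
  -- Volterra integrals already known to be measurable.
  have hms : ∀ y, AEStronglyMeasurable (fun z => bdry P y z • e2 - bdry Q y z • e2) volume :=
    fun y => by
      have e : (fun z => bdry P y z • e2 - bdry Q y z • e2) =
          (rho P m - rho Q n) y - vint P (rho P m - rho Q n) y - vint (P - Q) (rho Q n) y := by
        ext1 z
        have := congrFun (congrFun heq y) z
        simp only [Pi.add_apply, Pi.sub_apply] at this ⊢
        rw [this]; abel
      rw [e]
      exact (((ha.sub hb).continuous_right y).aestronglyMeasurable.sub
        (aestronglyMeasurable_vint hP.meas (ha.sub hb).cont y volume)).sub (hmv y)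
  refine (eLpNorm_le_of_volterra hP.meas h.weighted (ha.sub hb).cont (ha.sub hb).bdd
    (fun y _ z => congrFun (congrFun heq y) z)
    (A := 2 * (srcLipConst U * Δ : ℝ≥0) + Δ * (2 * rhoConst U))
    fun y _ => (eLpNorm_add_le (hms y) (hmv y) (by norm_num)).trans
      (add_le_add (eLpNorm_bdry_sub_le hP hQ h h' hd y) ?_)).trans (le_of_eq ?_)
  · exact (eLpNorm_vint_le (hP.meas.sub hQ.meas) hb.cont
      (fun t _ => hQ.eLpNorm_rho_le hn h' t)).trans (mul_le_mul' hd.weighted le_rfl)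
  · rw [rhoLipConst]; push_cast; ring

end IsRegPot

/-! ### Reduction of both ends to -∞ -/

/-- The sign that reflects the line so that the normalization is at `-∞`. -/
def Side.sgn : Side → ℝ
  | .minus => 1
  | .plus => -1

@[simp] theorem Side.sgn_mul_sgn (s : Side) : s.sgn * s.sgn = 1 := by cases s <;> simp [Side.sgn]

@[simp] theorem Side.sgn_mul_cancel (s : Side) (x : ℝ) : s.sgn * (s.sgn * x) = x := by
  rw [← mul_assoc, s.sgn_mul_sgn, one_mul]

@[simp] theorem Side.ofReal_sgn_mul_sgn (s : Side) : (s.sgn : ℂ) * s.sgn = 1 := by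
  rw [← Complex.ofReal_mul, s.sgn_mul_sgn, Complex.ofReal_one]

@[simp] theorem Side.abs_sgn (s : Side) : |s.sgn| = 1 := by cases s <;> simp [Side.sgn]

@[simp] theorem Side.norm_sgn (s : Side) : ‖(s.sgn : ℂ)‖ = 1 := by
  rw [Complex.norm_real, Real.norm_eq_abs, s.abs_sgn]

theorem Side.sgn_mul_nonpos (s : Side) {x : ℝ} (hx : x ∈ s.halfLine) : s.sgn * x ≤ 0 := by
  cases s <;> simpa [Side.sgn, Side.halfLine] using hx

theorem Side.measurePreserving (s : Side) :
    MeasurePreserving (fun y => s.sgn * y) volume volume := by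
  cases s
  · simp only [Side.sgn, one_mul]
    exact MeasurePreserving.id volume
  · simpa [Side.sgn] using Measure.measurePreserving_neg (volume : Measure ℝ)

theorem Side.integral_eq {E : Type*} [NormedAddCommGroup E] [NormedSpace ℝ E] (s : Side)
    (f : ℝ → E) (x : ℝ) :
    s.integral f x = s.sgn • ∫ t in Iic (s.sgn * x), f (s.sgn * t) := by
  cases s
  · simp [Side.sgn, Side.integral]
  · simp [Side.sgn, Side.integral, integral_comp_neg_Iic]

/-- The potential `Q₁` built from a function and its derivative. -/
noncomputable def pot (w g : ℝ → ℂ) (y : ℝ) : M2 :=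
  (1 / (2 * Complex.I)) •
    !![(‖w y‖ : ℂ) ^ 2, w y;
      -2 * Complex.I * star (g y) - star (w y) * (‖w y‖ : ℂ) ^ 2, -(‖w y‖ : ℂ) ^ 2]

/-- The potential, reflected so that the normalization is at `-∞`. -/
noncomputable def sidePot (s : Side) (w g : ℝ → ℂ) (y : ℝ) : M2 := (s.sgn : ℂ) • pot w g (s.sgn * y)

/-- Representatives of a function and of its weak derivative. -/
structure Rep (u w g : ℝ → ℂ) : Prop where
  ae_eq : u =ᵐ[volume] w
  deriv_ae_eq : weakDeriv u =ᵐ[volume] g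

namespace Rep

variable {u w g : ℝ → ℂ}

theorem ae_sgn (h : Rep u w g) (s : Side) :
    ∀ᵐ t, u (s.sgn * t) = w (s.sgn * t) ∧ weakDeriv u (s.sgn * t) = g (s.sgn * t) :=
  s.measurePreserving.quasiMeasurePreserving.ae (h.ae_eq.and h.deriv_ae_eq)

/-- After y = σt the phase keeps its form with (x, z) replaced by (σx, σz), because σ² = 1. The sign
σ of the integral goes into `sidePot`, so the theory at -∞ covers both ends. -/
theorem integral_jostM (h : Rep u w g) (s : Side) (m : ℝ → C2) (x z : ℝ) :
    s.integral (fun y => WithLp.toLp 2 ((expM z (x - y) * Q1 u y) *ᵥ (m y).ofLp)) x =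
      ∫ t in Iic (s.sgn * x),
        vker (s.sgn * z) (s.sgn * x - t) (sidePot s w g t) (m (s.sgn * t)) := by
  rw [s.integral_eq, ← integral_smul]
  refine setIntegral_congr_ae measurableSet_Iic ?_
  filter_upwards [h.ae_sgn s] with t ht _
  have e1 : Q1 u (s.sgn * t) = pot w g (s.sgn * t) := by rw [Q1, pot, ht.1, ht.2]
  have e2 : expM z (x - s.sgn * t) = expM (s.sgn * z) (s.sgn * x - t) := by
    unfold expM
    congr 6
    push_cast
    linear_combination (-(2 * Complex.I * z * x)) * s.ofReal_sgn_mul_sgn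
  rw [e1, e2, sidePot, vker_smul_left, Complex.coe_smul]
  rfl

theorem isJostM (h : Rep u w g) {s : Side} {m : ℝ → ℝ → C2} (hm : IsSol (sidePot s w g) m)
    (z : ℝ) : IsJostM s u z fun x => m (s.sgn * x) (s.sgn * z) := by
  obtain ⟨M, hM⟩ := hm.bdd
  refine ⟨memLp_top_of_bound ?_ M (Eventually.of_forall fun x => hM _ _), fun x => ?_⟩
  · exact (hm.cont.comp (by fun_prop : Continuous fun x : ℝ =>
      (s.sgn * x, s.sgn * z))).aestronglyMeasurable
  · rw [h.integral_jostM]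
    simp only [Side.sgn_mul_cancel]
    exact hm.eq _ _

/-- The difference from the constructed solution is a bounded solution of the homogeneous equation.
Since `jostM` is defined by a choice, this identification is what gives access to it. -/
theorem eq_of_isJostM (h : Rep u w g) {s : Side} (hP : IsPot (sidePot s w g))
    {m : ℝ → ℝ → C2} (hm : IsSol (sidePot s w g) m) {z : ℝ} {f : ℝ → C2} (hf : IsJostM s u z f)
    (x : ℝ) : f x = m (s.sgn * x) (s.sgn * z) := by
  obtain ⟨M, hM⟩ := hm.bdd
  have hmc : Continuous fun x => m x (s.sgn * z) :=
    hm.cont.comp (by fun_prop : Continuous fun x : ℝ => (x, s.sgn * z))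
  have h1 : MemLp (fun x => f (s.sgn * x)) ⊤ volume :=
    hf.1.comp_measurePreserving s.measurePreserving
  have h2 : MemLp (fun x => m x (s.sgn * z)) ⊤ volume :=
    memLp_top_of_bound hmc.aestronglyMeasurable M (Eventually.of_forall fun x => hM _ _)
  have hfb : ∀ᵐ y, ‖f (s.sgn * y)‖ ≤ (eLpNorm (fun x => f (s.sgn * x)) ⊤ volume).toReal := by
    have := ae_le_eLpNormEssSup (f := fun x => f (s.sgn * x)) (μ := volume)
    filter_upwards [this] with y hy
    rw [eLpNorm_exponent_top, ← toReal_enorm]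
    refine ENNReal.toReal_mono ?_ hy
    rw [← eLpNorm_exponent_top]; exact h1.2.ne
  have key := eq_zero_of_homogeneous (z := s.sgn * z) hP.meas hP.fin (h1.sub h2) (fun x => by
    have e1 := hf.2 (s.sgn * x)
    rw [h.integral_jostM] at e1
    simp only [Side.sgn_mul_cancel] at e1
    simp only [Pi.sub_apply, vker_sub]
    rw [integral_sub (integrable_vker hP.meas hP.fin h1.1.restrict (ae_restrict_of_ae hfb) _ _)
      (integrable_vker hP.meas hP.fin h2.1.restrict (Eventually.of_forall fun y => hM y _) _ _),
      e1, hm.eq, vint]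
    abel) (s.sgn * x)
  simpa [sub_eq_zero] using key

theorem jostM_eq (h : Rep u w g) {s : Side} (hP : IsPot (sidePot s w g))
    {m : ℝ → ℝ → C2} (hm : IsSol (sidePot s w g) m) (x z : ℝ) :
    jostM s u x z = m (s.sgn * x) (s.sgn * z) := by
  have hex : ∃ f, IsJostM s u z f := ⟨_, h.isJostM hm z⟩
  rw [jostM, dif_pos hex]
  exact h.eq_of_isJostM hP hm hex.choose_spec x

theorem mInf_eq (h : Rep u w g) (s : Side) (x : ℝ) :
    mInf s u x = mu (sidePot s w g) (s.sgn * x) := by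
  rw [mInf, mu, s.integral_eq, Complex.real_smul, ← integral_const_mul, ← integral_const_mul]
  congr 1
  refine setIntegral_congr_ae measurableSet_Iic ?_
  filter_upwards [h.ae_sgn s] with t ht _
  rw [ht.1]
  simp [sidePot, pot]
  ring

theorem remM_eq (h : Rep u w g) {s : Side} (hP : IsPot (sidePot s w g))
    {m : ℝ → ℝ → C2} (hm : IsSol (sidePot s w g) m) (x z : ℝ) :
    remM s u x z = rmd (sidePot s w g) m (s.sgn * x) (s.sgn * z) := by
  rw [remM, rmd, h.jostM_eq hP hm, h.mInf_eq]

/-- The product of the off-diagonal entries is (i/2)(u ū_x + |u|⁴/(2i)), the sign disappearing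
because σ² = 1. This matches the first correction in `rho` with the one in `hatM`. -/
theorem q1_eq (h : Rep u w g) (s : Side) (x : ℝ) :
    q1 s u x = -(s.sgn / (2 * Complex.I)) *
      (mu (sidePot s w g) (s.sgn * x) * corr (sidePot s w g) (s.sgn * x)) := by
  have e : corr (sidePot s w g) (s.sgn * x) = Complex.I / 2 * ∫ t in Iic (s.sgn * x),
      (u (s.sgn * t) * star (weakDeriv u (s.sgn * t)) +
        1 / (2 * Complex.I) * (‖u (s.sgn * t)‖ : ℂ) ^ 4) := by
    rw [corr, ← integral_const_mul]
    refine setIntegral_congr_ae measurableSet_Iic ?_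
    filter_upwards [h.ae_sgn s] with t ht _
    rw [ht.1, ht.2]
    have e1 : star (w (s.sgn * t)) * w (s.sgn * t) = (‖w (s.sgn * t)‖ : ℂ) ^ 2 :=
      Complex.conj_mul' _
    have hI := Complex.I_sq
    have e2 : ((‖w (s.sgn * t)‖ : ℂ)) ^ 4 = w (s.sgn * t) * star (w (s.sgn * t)) *
        (‖w (s.sgn * t)‖ : ℂ) ^ 2 := by rw [mul_comm (w _), e1]; ring
    rw [e2]
    simp [sidePot, pot]
    have := s.ofReal_sgn_mul_sgn
    generalize (s.sgn : ℂ) = σ at this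
    linear_combination (norm := skip) (-(w (s.sgn * t) * ((-(2 * Complex.I * (starRingEnd ℂ) (g (s.sgn * t))) - (starRingEnd ℂ) (w (s.sgn * t)) * (‖w (s.sgn * t)‖ : ℂ) ^ 2))) / 4) * this
    ring_nf
    simp only [Complex.I_sq, Complex.I_pow_three]
    ring
  rw [q1, h.mInf_eq, s.integral_eq, e, Complex.real_smul]
  generalize (∫ t in Iic (s.sgn * x), (u (s.sgn * t) * star (weakDeriv u (s.sgn * t)) +
    1 / (2 * Complex.I) * (‖u (s.sgn * t)‖ : ℂ) ^ 4)) = K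
  have hI := Complex.I_ne_zero
  field_simp
  ring

end Rep

/-! ### Conjugation symmetry between m and n -/

/-- The symmetry `v ↦ (v̄₂, v̄₁)` of `ℂ²`, which exchanges the two systems of Jost functions. -/
noncomputable def conjSwap : C2 ≃ₗᵢ[ℝ] C2 where
  toFun v := !₂[star (v 1), star (v 0)]
  invFun v := !₂[star (v 1), star (v 0)]
  map_add' v w := by ext i; fin_cases i <;> simp
  map_smul' c v := by ext i; fin_cases i <;> simp
  left_inv v := by ext i; fin_cases i <;> simp
  right_inv v := by ext i; fin_cases i <;> simp
  norm_map' v := by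
    simp [EuclideanSpace.norm_eq, Fin.sum_univ_two, add_comm]

theorem conjSwap_apply (v : C2) : conjSwap v = !₂[star (v 1), star (v 0)] := rfl

@[simp] theorem conjSwap_conjSwap (v : C2) : conjSwap (conjSwap v) = v := conjSwap.left_inv v

@[simp] theorem conjSwap_e1 : conjSwap e1 = e2 := by
  ext i; fin_cases i <;> simp [conjSwap_apply, e1, e2]

@[simp] theorem conjSwap_e2 : conjSwap e2 = e1 := by
  ext i; fin_cases i <;> simp [conjSwap_apply, e1, e2]

theorem conjSwap_smul (c : ℂ) (v : C2) : conjSwap (c • v) = star c • conjSwap v := by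
  ext i; fin_cases i <;> simp [conjSwap_apply]

/-- Conjugating the entries and exchanging the two indices takes Q₂ to Q₁ and diag(e^{-2izt}, 1) to
diag(1, e^{2izt}) for real z. Everything about n is thus the isometric image of a statement about m.
-/
theorem conjSwap_kernel (u : ℝ → ℂ) (z t y : ℝ) (v : C2) :
    conjSwap (WithLp.toLp 2 ((expN z t * Q2 u y) *ᵥ v.ofLp)) =
      WithLp.toLp 2 ((expM z t * Q1 u y) *ᵥ (conjSwap v).ofLp) := by
  have e : star (Complex.exp (-2 * Complex.I * z * t)) = Complex.exp (2 * Complex.I * z * t) := by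
    rw [Complex.star_def, ← Complex.exp_conj]
    have h2 : (starRingEnd ℂ) 2 = 2 := Complex.conj_ofNat 2
    simp [h2]
  ext i
  fin_cases i
  · simp [conjSwap_apply, expN, expM, Q1, Q2, dotProduct, Fin.sum_univ_two]
    ring
  · simp only [Complex.star_def] at e
    simp [conjSwap_apply, expN, expM, Q1, Q2, dotProduct, Fin.sum_univ_two] at e ⊢
    rw [e]
    ring

theorem Side.integral_conjSwap (s : Side) (f : ℝ → C2) (x : ℝ) :
    s.integral (fun y => conjSwap (f y)) x = conjSwap (s.integral f x) := by
  cases s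
  · exact conjSwap.toContinuousLinearEquiv.integral_comp_comm f
  · simp only [Side.integral, map_neg]
    rw [neg_inj]
    exact conjSwap.toContinuousLinearEquiv.integral_comp_comm f

theorem Side.integral_star (s : Side) (f : ℝ → ℂ) (x : ℝ) :
    s.integral (fun y => star (f y)) x = star (s.integral f x) := by
  cases s
  · exact integral_conj
  · simp only [Side.integral, star_neg]
    rw [neg_inj]
    exact integral_conj

theorem isJostN_iff (s : Side) (u : ℝ → ℂ) (z : ℝ) (n : ℝ → C2) :
    IsJostN s u z n ↔ IsJostM s u z fun x => conjSwap (n x) := by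
  refine and_congr ⟨fun h => ?_, fun h => ?_⟩ (forall_congr' fun x => ?_)
  · exact h.congr_norm (conjSwap.continuous.comp_aestronglyMeasurable h.1)
      (Eventually.of_forall fun x => (conjSwap.norm_map _).symm)
  · have h1 := conjSwap.continuous.comp_aestronglyMeasurable h.1
    simp only [conjSwap_conjSwap] at h1
    exact h.congr_norm h1 (Eventually.of_forall fun x => conjSwap.norm_map _)
  · simp only [← conjSwap_kernel]
    rw [s.integral_conjSwap, ← conjSwap_e2, ← map_add, conjSwap.injective.eq_iff]

theorem nInf_eq (s : Side) (u : ℝ → ℂ) (x : ℝ) : nInf s u x = star (mInf s u x) := by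
  rw [nInf, mInf, Complex.star_def, ← Complex.exp_conj, map_mul, ← Complex.star_def,
    ← s.integral_star]
  congr 2
  · simp
  · simp

theorem s1_eq (s : Side) (u : ℝ → ℂ) (x : ℝ) : s1 s u x = star (q2 s u x) := by
  rw [s1, q2, star_mul', ← deriv.star]
  simp [nInf_eq]

theorem s2_eq (s : Side) (u : ℝ → ℂ) (x : ℝ) : s2 s u x = star (q1 s u x) := by
  rw [s2, q1, star_mul', star_mul', ← s.integral_star, nInf_eq]
  congr 2
  · simp
  · ext y
    simp

namespace Rep

variable {u w g : ℝ → ℂ}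

theorem jostN_eq (h : Rep u w g) {s : Side} (hP : IsPot (sidePot s w g))
    {m : ℝ → ℝ → C2} (hm : IsSol (sidePot s w g) m) (x z : ℝ) :
    jostN s u x z = conjSwap (jostM s u x z) := by
  have hex : ∃ f, IsJostN s u z f := ⟨fun x => conjSwap (m (s.sgn * x) (s.sgn * z)), by
    rw [isJostN_iff]
    simpa only [conjSwap_conjSwap] using h.isJostM hm z⟩
  rw [jostN, dif_pos hex, h.jostM_eq hP hm,
    ← h.eq_of_isJostM hP hm ((isJostN_iff _ _ _ _).1 hex.choose_spec) x, conjSwap_conjSwap]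

theorem remN_eq (h : Rep u w g) {s : Side} (hP : IsPot (sidePot s w g))
    {m : ℝ → ℝ → C2} (hm : IsSol (sidePot s w g) m) (x z : ℝ) :
    remN s u x z = conjSwap (remM s u x z) := by
  rw [remN, remM, map_sub, conjSwap_smul, conjSwap_e1, h.jostN_eq hP hm, nInf_eq]

theorem hatN_eq (h : Rep u w g) {s : Side} (hP : IsPot (sidePot s w g))
    {m : ℝ → ℝ → C2} (hm : IsSol (sidePot s w g) m) (x z : ℝ) :
    hatN s u x z = conjSwap (hatM s u x z) := by
  rw [hatN, hatM, map_sub, map_add, conjSwap_smul, conjSwap_smul, conjSwap_smul, conjSwap_e1,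
    conjSwap_e2, h.remN_eq hP hm, s1_eq, s2_eq, Complex.star_def, Complex.conj_ofReal, add_comm
      (_ • e1)]

/-- The product rule for ū μ reproduces the lower left entry of the potential: its cubic term is
what differentiating μ contributes. Here u must be classically differentiable, since `q2` uses
`deriv`. -/
theorem q2_eq (h : Rep u u g) (hu : ∀ x, HasDerivAt u (g x) x) (s : Side)
    (hP : IsPot (sidePot s u g)) (x : ℝ) :
    q2 s u x = -(s.sgn / (2 * Complex.I)) *
      (sidePot s u g (s.sgn * x) 1 0 * mu (sidePot s u g) (s.sgn * x)) := by
  have hd := (hu x).star.mul (((hP.hasDerivAt_mu (s.sgn * x)).scomp x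
    ((hasDerivAt_id x).const_mul s.sgn)))
  have hf : (fun t => star (u t) * mInf s u t) =
      (fun t => star (u t)) * (mu (sidePot s u g) ∘ (s.sgn * ·)) := by
    ext t; simp [h.mInf_eq s t]
  rw [q2, hf, hd.deriv]
  simp [sidePot, pot]
  have := s.ofReal_sgn_mul_sgn
  generalize (s.sgn : ℂ) = σ at this
  generalize mu (sidePot s u g) (s.sgn * x) = M
  generalize (‖u x‖ : ℂ) = N
  have hI := Complex.I_ne_zero
  have hI2 := Complex.I_sq
  generalize Complex.I = i at *
  generalize (starRingEnd ℂ) (g x) = G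
  generalize (starRingEnd ℂ) (u x) = V
  have hσ : σ ^ 2 = 1 := by rw [sq, this]
  field_simp
  rw [hσ]
  linear_combination (M * V * N ^ 2) * hI2

theorem hatM_eq (h : Rep u u g) (hu : ∀ x, HasDerivAt u (g x) x) {s : Side}
    (hP : IsPot (sidePot s u g)) {m : ℝ → ℝ → C2} (hm : IsSol (sidePot s u g) m) (x z : ℝ) :
    hatM s u x z =
      ((s.sgn : ℂ) / (2 * Complex.I)) • rho (sidePot s u g) m (s.sgn * x) (s.sgn * z) := by
  have e : ((s.sgn : ℂ) / (2 * Complex.I)) * (2 * Complex.I * ((s.sgn * z : ℝ) : ℂ)) = z := by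
    have := s.ofReal_sgn_mul_sgn
    have hI := Complex.I_ne_zero
    push_cast
    field_simp
    linear_combination (z : ℂ) * this
  rw [hatM, h.q1_eq, h.q2_eq hu s hP, h.remM_eq hP hm, rho, smul_add, smul_smul, e]
  module

end Rep

/-! ### Lipschitz dependence of the potential on u -/

@[simp] theorem sidePot_zero (s : Side) : sidePot s 0 0 = 0 := by
  ext y i j
  fin_cases i <;> fin_cases j <;> simp [sidePot, pot]

theorem wt_sgn_mul (s : Side) (y : ℝ) : wt (s.sgn * y) = wt y := by
  unfold wt
  rw [mul_pow, sq s.sgn, s.sgn_mul_sgn, one_mul]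

theorem entryNorm_sgn_smul (s : Side) (A : M2) : entryNorm ((s.sgn : ℂ) • A) = entryNorm A := by
  simp only [entryNorm, Matrix.smul_apply, norm_smul, s.norm_sgn, one_mul]

theorem sidePot_sub_apply (s : Side) (w v g k : ℝ → ℂ) (y : ℝ) :
    (sidePot s w g - sidePot s v k) y =
      (s.sgn : ℂ) • (pot w g (s.sgn * y) - pot v k (s.sgn * y)) := by
  rw [Pi.sub_apply, sidePot, sidePot, smul_sub]

theorem norm_sq_sub_sq_le {S : ℝ} {a b : ℂ} (ha : ‖a‖ ≤ S) (hb : ‖b‖ ≤ S) :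
    ‖(‖a‖ : ℂ) ^ 2 - (‖b‖ : ℂ) ^ 2‖ ≤ 2 * S * ‖a - b‖ := by
  have e : (‖a‖ : ℂ) ^ 2 - (‖b‖ : ℂ) ^ 2 = (((‖a‖ + ‖b‖) * (‖a‖ - ‖b‖) : ℝ) : ℂ) := by
    push_cast; ring
  rw [e, Complex.norm_real, norm_mul, Real.norm_of_nonneg (by positivity)]
  have := abs_norm_sub_norm_le a b
  have h0 := norm_nonneg a
  have h1 := norm_nonneg b
  rw [← Real.norm_eq_abs] at this
  exact mul_le_mul (by linarith) this (norm_nonneg _) (by linarith)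

theorem norm_cubic_sub_le {S : ℝ} {a b : ℂ} (ha : ‖a‖ ≤ S) (hb : ‖b‖ ≤ S) :
    ‖star a * (‖a‖ : ℂ) ^ 2 - star b * (‖b‖ : ℂ) ^ 2‖ ≤ 3 * S ^ 2 * ‖a - b‖ := by
  have e : star a * (‖a‖ : ℂ) ^ 2 - star b * (‖b‖ : ℂ) ^ 2 =
      star (a - b) * (‖a‖ : ℂ) ^ 2 + star b * ((‖a‖ : ℂ) ^ 2 - (‖b‖ : ℂ) ^ 2) := by
    rw [star_sub]; ring
  have h := norm_sq_sub_sq_le ha hb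
  have hS : 0 ≤ S := (norm_nonneg a).trans ha
  calc _ ≤ ‖a - b‖ * ‖a‖ ^ 2 + ‖b‖ * ‖(‖a‖ : ℂ) ^ 2 - (‖b‖ : ℂ) ^ 2‖ := by
        rw [e]
        refine (norm_add_le _ _).trans_eq ?_
        rw [norm_mul, norm_mul, norm_star, norm_star]
        simp
    _ ≤ ‖a - b‖ * S ^ 2 + S * (2 * S * ‖a - b‖) := by gcongr
    _ = _ := by ring

theorem norm_half_I : ‖1 / (2 * Complex.I)‖ = 1 / 2 := by simp

/-- Lipschitz constant of the map from functions to potentials. -/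
noncomputable def potConst (S : ℝ≥0) : ℝ≥0 := 1 + (1 / 2 + 2 * S + 3 / 2 * S ^ 2)

/-- The prefactor has modulus 1/2. The two diagonal entries contribute 2S together, the upper right
entry 1/2, and the lower left entry ‖g - k‖ plus (3/2)S² from the cubic term. -/
theorem entryNorm_pot_sub_le {S : ℝ≥0} {w v g k : ℝ → ℂ} {y : ℝ} (hw : ‖w y‖ ≤ S)
    (hv : ‖v y‖ ≤ S) : entryNorm (pot w g y - pot v k y) ≤
      ‖(g - k) y‖ + (1 / 2 + 2 * S + 3 / 2 * S ^ 2 : ℝ≥0) * ‖(w - v) y‖ := by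
  have h1 := norm_sq_sub_sq_le hw hv
  have h2 := norm_cubic_sub_le hw hv
  have e10 : ‖-2 * Complex.I * star (g y) - star (w y) * (‖w y‖ : ℂ) ^ 2 -
      (-2 * Complex.I * star (k y) - star (v y) * (‖v y‖ : ℂ) ^ 2)‖ ≤
      2 * ‖g y - k y‖ + 3 * S ^ 2 * ‖w y - v y‖ := by
    have e : -2 * Complex.I * star (g y) - star (w y) * (‖w y‖ : ℂ) ^ 2 -
        (-2 * Complex.I * star (k y) - star (v y) * (‖v y‖ : ℂ) ^ 2) =
        -2 * Complex.I * star (g y - k y) -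
          (star (w y) * (‖w y‖ : ℂ) ^ 2 - star (v y) * (‖v y‖ : ℂ) ^ 2) := by
      rw [star_sub]; ring
    rw [e]
    refine (norm_sub_le _ _).trans (add_le_add (le_of_eq ?_) h2)
    rw [norm_mul, norm_star]; simp
  have e00 : ‖-(‖w y‖ : ℂ) ^ 2 - -(‖v y‖ : ℂ) ^ 2‖ = ‖(‖w y‖ : ℂ) ^ 2 - (‖v y‖ : ℂ) ^ 2‖ := by
    rw [← norm_neg]; congr 1; ring
  rw [pot, pot, ← smul_sub]
  simp only [entryNorm, Matrix.smul_apply, Matrix.sub_apply, norm_smul, norm_half_I,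
    Matrix.of_apply, Matrix.cons_val', Matrix.cons_val_zero, Matrix.cons_val_one,
    Matrix.cons_val_fin_one, Pi.sub_apply, e00]
  push_cast
  nlinarith [norm_nonneg (w y - v y)]

theorem measurable_pot {w g : ℝ → ℂ} (hw : Measurable w) (hg : Measurable g) :
    MeasEntries (pot w g) := by
  intro i j
  have hn : Measurable fun y => (‖w y‖ : ℂ) ^ 2 :=
    (Complex.measurable_ofReal.comp hw.norm).pow_const 2
  have hsg : Measurable fun y => star (g y) := continuous_star.measurable.comp hg
  have hsw : Measurable fun y => star (w y) := continuous_star.measurable.comp hw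
  fin_cases i <;> fin_cases j
  · exact hn.const_mul _
  · exact hw.const_mul _
  · exact ((hsg.const_mul _).sub (hsw.mul hn)).const_mul _
  · exact hn.neg.const_mul _

theorem measurable_sidePot (s : Side) {w g : ℝ → ℂ} (hw : Measurable w) (hg : Measurable g) :
    MeasEntries (sidePot s w g) := fun i j =>
  ((measurable_pot hw hg i j).comp (measurable_const_mul s.sgn)).const_mul _

theorem wN_sidePot_sub_le (s : Side) {S D : ℝ≥0} {w v g k : ℝ → ℂ} (hwm : Measurable w)
    (hvm : Measurable v) (hgm : Measurable g) (hkm : Measurable k)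
    (hw : ∀ y, ‖w y‖ ≤ S) (hv : ∀ y, ‖v y‖ ≤ S) (hwv : eLpNorm (weighted (w - v)) 2 volume ≤ D)
    (hgk : eLpNorm (weighted (g - k)) 2 volume ≤ D) :
    wN (sidePot s w g - sidePot s v k) ≤ (potConst S * D : ℝ≥0) := by
  have e : (fun y => wt y * entryNorm ((sidePot s w g - sidePot s v k) y)) =
      (fun y => wt y * entryNorm (pot w g y - pot v k y)) ∘ fun y => s.sgn * y := by
    ext y
    simp only [Function.comp_apply, sidePot_sub_apply, entryNorm_sgn_smul, wt_sgn_mul]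
  have hm := (measurable_pot hwm hgm).sub (measurable_pot hvm hkm)
  have hm' : Measurable fun y => wt y * entryNorm (pot w g y - pot v k y) :=
    continuous_wt.measurable.mul hm.entryNorm
  rw [wN, e, eLpNorm_comp_measurePreserving
    hm'.aestronglyMeasurable s.measurePreserving]
  refine (eLpNorm_le_of_norm_le_add (f := fun y => wt y * ‖(g - k) y‖)
    (g := fun y => wt y * ‖(w - v) y‖) (c := 1 / 2 + 2 * S + 3 / 2 * S ^ 2)
    (continuous_wt.measurable.mul (hgm.sub hkm).norm)
    (continuous_wt.measurable.mul (hwm.sub hvm).norm) (fun y => ?_) (D₁ := D) (D₂ := D)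
    (le_trans (eLpNorm_mono fun y => ?_) hgk) (le_trans (eLpNorm_mono fun y => ?_) hwv)).trans
    (le_of_eq ?_)
  · have h := entryNorm_pot_sub_le (g := g) (k := k) (hw y) (hv y)
    have hwt := (wt_pos y).le
    rw [Real.norm_of_nonneg (mul_nonneg hwt (entryNorm_nonneg _))]
    calc _ ≤ wt y * (‖(g - k) y‖ + (1 / 2 + 2 * S + 3 / 2 * S ^ 2 : ℝ≥0) * ‖(w - v) y‖) := by
          gcongr
      _ = _ := by ring
  · simp only [weighted, norm_smul, norm_mul, norm_norm]; rfl
  · simp only [weighted, norm_smul, norm_mul, norm_norm]; rfl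
  · rw [potConst]; push_cast; ring

theorem wN_sidePot_le (s : Side) {S D : ℝ≥0} {w g : ℝ → ℂ} (hwm : Measurable w)
    (hgm : Measurable g) (hw : ∀ y, ‖w y‖ ≤ S) (hwD : eLpNorm (weighted w) 2 volume ≤ D)
    (hgD : eLpNorm (weighted g) 2 volume ≤ D) :
    wN (sidePot s w g) ≤ (potConst S * D : ℝ≥0) := by
  have := wN_sidePot_sub_le s (v := 0) (k := 0) hwm measurable_zero hgm measurable_zero hw
    (fun y => by simp) (by simpa using hwD) (by simpa using hgD)
  simpa using this

theorem continuous_pot_diag {w : ℝ → ℂ} (g : ℝ → ℂ) (hw : Continuous w) :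
    Continuous fun y => pot w g y 0 0 := by
  have : Continuous fun y => (1 / (2 * Complex.I)) * (‖w y‖ : ℂ) ^ 2 := by fun_prop
  exact this

theorem isPot_sidePot (s : Side) {w g : ℝ → ℂ} (hw : Continuous w) (hg : Measurable g)
    (hfin : wN (sidePot s w g) < ⊤) : IsPot (sidePot s w g) where
  meas := measurable_sidePot s hw.measurable hg
  cont := ((continuous_pot_diag g hw).comp (continuous_const_mul s.sgn)).const_smul (s.sgn : ℂ)
  re y := by
    have : sidePot s w g y 0 0 = Complex.I *
        ((-(s.sgn * ‖w (s.sgn * y)‖ ^ 2 / 2) : ℝ) : ℂ) := by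
      simp [sidePot, pot]
      ring
    rw [this, Complex.re_mul_ofReal, Complex.I_re, zero_mul]
  fin := hfin

/-- The derivative of the lower left entry of the potential. -/
noncomputable def lowDeriv (w g g' : ℝ → ℂ) (y : ℝ) : ℂ :=
  1 / (2 * Complex.I) * (-2 * Complex.I * star (g' y) -
    (2 * (star (w y) * w y * star (g y)) + star (w y) * star (w y) * g y))

theorem norm_mul_mul_sub_le {S : ℝ} {a b c a' b' c' : ℂ} {d q : ℝ} (ha : ‖a‖ ≤ S) (hb : ‖b‖ ≤ S)
    (hb' : ‖b'‖ ≤ S) (hc' : ‖c'‖ ≤ S) (h1 : ‖a - a'‖ ≤ d)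
    (h2 : ‖b - b'‖ ≤ d) (h3 : ‖c - c'‖ ≤ q) :
    ‖a * b * c - a' * b' * c'‖ ≤ S ^ 2 * q + 2 * S ^ 2 * d := by
  have hS : 0 ≤ S := (norm_nonneg a).trans ha
  have hd : 0 ≤ d := (norm_nonneg _).trans h1
  have he : 0 ≤ q := (norm_nonneg _).trans h3
  have e : a * b * c - a' * b' * c' =
      a * b * (c - c') + a * (b - b') * c' + (a - a') * b' * c' := by ring
  rw [e]
  refine (norm_add_le _ _).trans ((add_le_add (norm_add_le _ _) le_rfl).trans ?_)
  simp only [norm_mul]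
  calc _ ≤ S * S * q + S * d * S + d * S * S := by gcongr
    _ = _ := by ring

theorem norm_lowDeriv_sub_le {S : ℝ≥0} {w v g k g' k' : ℝ → ℂ} {y : ℝ} (hw : ‖w y‖ ≤ S)
    (hv : ‖v y‖ ≤ S) (hk : ‖k y‖ ≤ S) :
    ‖lowDeriv w g g' y - lowDeriv v k k' y‖ ≤
      ‖(g' - k') y‖ + (3 * S ^ 2 : ℝ≥0) * (‖(g - k) y‖ + 2 * ‖(w - v) y‖) := by
  have hs : ∀ a b : ℂ, ‖star a - star b‖ = ‖a - b‖ := fun a b => by rw [← star_sub, norm_star]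
  have h1 := norm_mul_mul_sub_le (a := star (w y)) (a' := star (v y)) (b := w y) (b' := v y)
    (c := star (g y)) (c' := star (k y)) ((norm_star _).trans_le hw) hw hv
    ((norm_star _).trans_le hk) (hs _ _).le le_rfl (hs _ _).le
  have h2 := norm_mul_mul_sub_le (a := star (w y)) (a' := star (v y)) (b := star (w y))
    (b' := star (v y)) (c := g y) (c' := k y) ((norm_star _).trans_le hw)
    ((norm_star _).trans_le hw) ((norm_star _).trans_le hv) hk (hs _ _).le (hs _ _).le le_rfl
  have e : lowDeriv w g g' y - lowDeriv v k k' y = 1 / (2 * Complex.I) *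
      (-2 * Complex.I * (star (g' y) - star (k' y)) -
        (2 * (star (w y) * w y * star (g y) - star (v y) * v y * star (k y)) +
          (star (w y) * star (w y) * g y - star (v y) * star (v y) * k y))) := by
    simp only [lowDeriv]; ring
  rw [e, norm_mul, norm_half_I]
  have h3 : ‖-2 * Complex.I * (star (g' y) - star (k' y))‖ = 2 * ‖g' y - k' y‖ := by
    rw [norm_mul, hs]; simp
  have h4 : ‖2 * (star (w y) * w y * star (g y) - star (v y) * v y * star (k y))‖ =
      2 * ‖star (w y) * w y * star (g y) - star (v y) * v y * star (k y)‖ := by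
    rw [norm_mul]; simp
  have h5 := (norm_sub_le (-2 * Complex.I * (star (g' y) - star (k' y)))
        (2 * (star (w y) * w y * star (g y) - star (v y) * v y * star (k y)) +
          (star (w y) * star (w y) * g y - star (v y) * star (v y) * k y))).trans
      (add_le_add h3.le ((norm_add_le _ _).trans (add_le_add h4.le le_rfl)))
  simp only [Pi.sub_apply]
  push_cast
  have h6 : 0 ≤ (S : ℝ) ^ 2 * ‖g y - k y‖ := by positivity
  have h7 : 0 ≤ (S : ℝ) ^ 2 * ‖w y - v y‖ := by positivity
  nlinarith

theorem measurable_lowDeriv {w g g' : ℝ → ℂ} (hw : Measurable w) (hg : Measurable g)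
    (hg' : Measurable g') : Measurable (lowDeriv w g g') := by
  have hs : ∀ {f : ℝ → ℂ}, Measurable f → Measurable fun y => star (f y) := fun hf =>
    continuous_star.measurable.comp hf
  exact (((hs hg').const_mul _).sub (((((hs hw).mul hw).mul (hs hg)).const_mul _).add
    (((hs hw).mul (hs hw)).mul hg))).const_mul _

/-- Constant in the bounds for regular potentials. -/
noncomputable def regConst (S : ℝ≥0) : ℝ≥0 :=
  potConst S + 2 * S + 1 + 1 + 3 * S ^ 2 * 3

/-- The quantities entering the bounds for the regular potentials. -/
structure Close (w v g k g' k' : ℝ → ℂ) (D : ℝ≥0) : Prop where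
  wt_fun : eLpNorm (weighted (w - v)) 2 volume ≤ D
  wt_deriv : eLpNorm (weighted (g - k)) 2 volume ≤ D
  deriv2 : eLpNorm (g' - k') 2 volume ≤ D
  sup : ∀ y, ‖w y - v y‖ ≤ 2 * D

theorem eLpNorm_le_weighted (f : ℝ → ℂ) : eLpNorm f 2 volume ≤ eLpNorm (weighted f) 2 volume := by
  refine eLpNorm_mono fun y => ?_
  rw [weighted, norm_smul, Real.norm_of_nonneg (Real.sqrt_nonneg _)]
  exact le_mul_of_one_le_left (norm_nonneg _) (one_le_wt y)

theorem regBound_sidePot_sub (s : Side) {S D : ℝ≥0} {w v g k g' k' : ℝ → ℂ} (hwm : Measurable w)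
    (hvm : Measurable v) (hgm : Measurable g) (hkm : Measurable k) (hgm' : Measurable g')
    (hkm' : Measurable k') (hw : ∀ y, ‖w y‖ ≤ S) (hv : ∀ y, ‖v y‖ ≤ S) (hk : ∀ y, ‖k y‖ ≤ S)
    (h : Close w v g k g' k' D) :
    RegBound (sidePot s w g - sidePot s v k)
      ((fun y => lowDeriv w g g' (s.sgn * y)) - fun y => lowDeriv v k k' (s.sgn * y))
      (regConst S * D) where
  weighted := by
    refine (wN_sidePot_sub_le s hwm hvm hgm hkm hw hv h.wt_fun h.wt_deriv).trans ?_
    rw [ENNReal.coe_le_coe]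
    gcongr
    simp only [regConst, add_assoc]
    exact le_self_add
  diag y := by
    rw [sidePot_sub_apply, Matrix.smul_apply, norm_smul, s.norm_sgn, one_mul, pot, pot, ← smul_sub,
      Matrix.smul_apply, norm_smul, norm_half_I]
    have h1 := norm_sq_sub_sq_le (hw (s.sgn * y)) (hv (s.sgn * y))
    have h2 : 2 * (S : ℝ) * ‖w (s.sgn * y) - v (s.sgn * y)‖ ≤ 2 * S * (2 * D) := by
      gcongr; exact h.sup _
    have h3 : 0 ≤ ((potConst S + 1 + 1 + 3 * S ^ 2 * 3 : ℝ≥0) : ℝ) * D := by positivity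
    simp only [Matrix.sub_apply, Matrix.of_apply, Matrix.cons_val', Matrix.cons_val_zero,
      Matrix.cons_val_fin_one]
    rw [regConst]
    push_cast at h3 ⊢
    linarith
  upper y := by
    rw [sidePot_sub_apply, Matrix.smul_apply, norm_smul, s.norm_sgn, one_mul, pot, pot, ← smul_sub,
      Matrix.smul_apply, norm_smul, norm_half_I]
    have h2 := h.sup (s.sgn * y)
    have h3 : 0 ≤ ((potConst S + 2 * S + 1 + 3 * S ^ 2 * 3 : ℝ≥0) : ℝ) * D := by positivity
    simp only [Matrix.sub_apply, Matrix.of_apply, Matrix.cons_val', Matrix.cons_val_zero,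
      Matrix.cons_val_fin_one, Matrix.cons_val_one]
    rw [regConst]
    push_cast at h3 ⊢
    linarith
  deriv := by
    have e : ((fun y => lowDeriv w g g' (s.sgn * y)) - fun y => lowDeriv v k k' (s.sgn * y)) =
        (lowDeriv w g g' - lowDeriv v k k') ∘ fun y => s.sgn * y := rfl
    rw [e, eLpNorm_comp_measurePreserving ((measurable_lowDeriv hwm hgm hgm').sub
      (measurable_lowDeriv hvm hkm hkm')).aestronglyMeasurable s.measurePreserving]
    refine (eLpNorm_le_of_norm_le_add (c := 3 * S ^ 2) (hgm'.sub hkm').norm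
      ((hgm.sub hkm).norm.add ((hwm.sub hvm).norm.const_mul 2))
      (fun y => norm_lowDeriv_sub_le (hw y) (hv y) (hk y)) (D₁ := D) (D₂ := D + (2 : ℝ≥0) * D)
      ((eLpNorm_norm (g' - k')).le.trans h.deriv2)
      (eLpNorm_le_of_norm_le_add (c := 2) (hgm.sub hkm).norm (hwm.sub hvm).norm (fun y => ?_)
        ((eLpNorm_norm (g - k)).le.trans ((eLpNorm_le_weighted _).trans h.wt_deriv))
        ((eLpNorm_norm (w - v)).le.trans ((eLpNorm_le_weighted _).trans h.wt_fun)))).trans ?_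
    · refine (Real.norm_of_nonneg (add_nonneg (norm_nonneg _) ?_)).le
      exact mul_nonneg zero_le_two (norm_nonneg _)
    · norm_cast
      rw [regConst]
      calc D + 3 * S ^ 2 * (D + 2 * D) = (1 + 3 * S ^ 2 * 3) * D := by ring
        _ ≤ ((potConst S + 2 * S + 1) + (1 + 3 * S ^ 2 * 3)) * D := by
          exact mul_le_mul' le_add_self le_rfl
        _ = _ := by ring

@[simp] theorem lowDeriv_zero (y : ℝ) : lowDeriv 0 0 0 y = 0 := by simp [lowDeriv]

theorem regBound_sidePot (s : Side) {S D : ℝ≥0} {w g g' : ℝ → ℂ} (hwm : Measurable w)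
    (hgm : Measurable g) (hgm' : Measurable g') (hw : ∀ y, ‖w y‖ ≤ S)
    (h : Close w 0 g 0 g' 0 D) :
    RegBound (sidePot s w g) (fun y => lowDeriv w g g' (s.sgn * y)) (regConst S * D) := by
  have := regBound_sidePot_sub s hwm measurable_zero hgm measurable_zero hgm' measurable_zero hw
    (by simp) (by simp) h
  have e : (fun y => lowDeriv 0 0 0 (s.sgn * y)) = (0 : ℝ → ℂ) := by ext y; simp
  rwa [e, sidePot_zero, sub_zero, sub_zero] at this

/-- Writing ū|u|² as ū u ū, the cubic part is C¹ and is integrated classically; only ū_x is treated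
as a primitive of an L² function. -/
theorem lowDeriv_prim {w g g' : ℝ → ℂ} (hw : ∀ x, HasDerivAt w (g x) x) (hg : Continuous g)
    (hg' : LocallyIntegrable g') (hp : ∀ x y, g y - g x = ∫ t in x..y, g' t) (x y : ℝ) :
    pot w g y 1 0 - pot w g x 1 0 = ∫ t in x..y, lowDeriv w g g' t := by
  have hwc : Continuous w := continuous_iff_continuousAt.2 fun x => (hw x).continuousAt
  have hs : ∀ {f : ℝ → ℂ}, Continuous f → Continuous fun y => star (f y) := fun hf =>
    continuous_star.comp hf
  have hd : ∀ t, HasDerivAt (fun t => star (w t) * w t * star (w t))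
      (2 * (star (w t) * w t * star (g t)) + star (w t) * star (w t) * g t) t := fun t => by
    convert! ((hw t).star.mul (hw t)).mul (hw t).star using 1
    simp only [Pi.mul_apply]; ring
  have hc : Continuous fun t => 2 * (star (w t) * w t * star (g t)) + star (w t) * star (w t) * g t :=
    (continuous_const.mul (((hs hwc).mul hwc).mul (hs hg))).add
      (((hs hwc).mul (hs hwc)).mul hg)
  have h1 := intervalIntegral.integral_eq_sub_of_hasDerivAt (fun t _ => hd t)
    (hc.intervalIntegrable x y)
  have h2 : ∫ t in x..y, star (g' t) = star (g y) - star (g x) := by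
    rw [← star_sub, hp x y]
    simp only [intervalIntegral, star_sub]
    exact congrArg₂ _ integral_conj integral_conj
  have i1 : IntervalIntegrable (fun t => star (g' t)) volume x y := by
    have := intervalIntegrable_of_locallyIntegrable hg' x y
    rw [intervalIntegrable_iff] at this ⊢
    exact (Complex.conjCLE : ℂ →L[ℝ] ℂ).integrable_comp this
  unfold lowDeriv
  rw [intervalIntegral.integral_const_mul, intervalIntegral.integral_sub (i1.const_mul _)
    (hc.intervalIntegrable x y), intervalIntegral.integral_const_mul, h1, h2]
  have e : ∀ t, (‖w t‖ : ℂ) ^ 2 = star (w t) * w t := fun t => (Complex.conj_mul' _).symm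
  simp only [pot, Matrix.smul_apply, Matrix.of_apply, Matrix.cons_val', Matrix.cons_val_zero,
    Matrix.cons_val_fin_one, Matrix.cons_val_one, e, smul_eq_mul]
  ring

theorem isRegPot_sidePot (s : Side) {S : ℝ≥0} {w g g' : ℝ → ℂ} (hw : ∀ x, HasDerivAt w (g x) x)
    (hg : Continuous g) (hgm' : Measurable g') (hg' : LocallyIntegrable g')
    (hp : ∀ x y, g y - g x = ∫ t in x..y, g' t) (hwS : ∀ y, ‖w y‖ ≤ S) (hgS : ∀ y, ‖g y‖ ≤ S)
    {U : ℝ≥0} (hb : RegBound (sidePot s w g) (fun y => lowDeriv w g g' (s.sgn * y)) U) :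
    IsRegPot (sidePot s w g) (fun y => lowDeriv w g g' (s.sgn * y)) := by
  have hwc : Continuous w := continuous_iff_continuousAt.2 fun x => (hw x).continuousAt
  have hm : Measurable fun y => lowDeriv w g g' (s.sgn * y) :=
    (measurable_lowDeriv hwc.measurable hg.measurable hgm').comp (measurable_const_mul s.sgn)
  refine ⟨isPot_sidePot s hwc hg.measurable (hb.weighted.trans_lt ENNReal.coe_lt_top), fun y => ?_,
    ?_, ⟨S + S ^ 3, fun y => ?_⟩, hm, ⟨hm.aestronglyMeasurable,
    hb.deriv.trans_lt ENNReal.coe_lt_top⟩, fun x y => ?_⟩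
  · simp [sidePot, pot]
  · have : Continuous fun y => (s.sgn : ℂ) * ((1 / (2 * Complex.I)) * w (s.sgn * y)) := by fun_prop
    exact this
  · rw [sidePot, Matrix.smul_apply, norm_smul, s.norm_sgn, one_mul, pot, Matrix.smul_apply,
      norm_smul, norm_half_I]
    have h1 := hgS (s.sgn * y)
    have h2 := hwS (s.sgn * y)
    simp only [Matrix.of_apply, Matrix.cons_val', Matrix.cons_val_zero,
      Matrix.cons_val_fin_one, Matrix.cons_val_one]
    calc _ ≤ 1 / 2 * (2 * ‖g (s.sgn * y)‖ + ‖w (s.sgn * y)‖ * ‖w (s.sgn * y)‖ ^ 2) := by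
          gcongr
          refine (norm_sub_le _ _).trans_eq ?_
          rw [norm_mul _ (star (g _)), norm_mul (star (w _)), norm_star, norm_star]
          simp
      _ ≤ 1 / 2 * (2 * S + S * S ^ 2) := by gcongr
      _ ≤ _ := by nlinarith [pow_nonneg S.coe_nonneg 3]
  -- The sign in `sidePot` and the one from the chain rule multiply to 1, so the derivative carries
  -- no sign.
  · have h := lowDeriv_prim hw hg hg' hp (s.sgn * x) (s.sgn * y)
    rw [← intervalIntegral.smul_integral_comp_mul_left, Complex.real_smul] at h
    simp only [sidePot, Matrix.smul_apply, smul_eq_mul]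
    rw [← mul_sub]
    simp only [pot, Matrix.smul_apply, smul_eq_mul] at h ⊢
    rw [h, ← mul_assoc, s.ofReal_sgn_mul_sgn, one_mul]

/-! ### Representatives and Sobolev norms -/

theorem eLpNorm_le_ofReal {E : Type*} [NormedAddCommGroup E] {f : ℝ → E} {R : ℝ}
    (hf : MemLp f 2 volume) (h : l2Norm f ≤ R) : eLpNorm f 2 volume ≤ ENNReal.ofReal R :=
  (ENNReal.le_ofReal_iff_toReal_le hf.2.ne (ENNReal.toReal_nonneg.trans h)).2 h

/-- Sobolev embedding: |F(x)| ≤ |F(y)| + ∫|g| for y in (x, x+1], averaged over that interval. On a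
probability space L¹ ≤ L², and the two terms give the constant 2. -/
theorem norm_le_of_primitive {F g : ℝ → ℂ} {D : ℝ≥0} (hF : Continuous F)
    (hp : ∀ x y, F y - F x = ∫ t in x..y, g t) (hgm : MemLp g 2 volume)
    (hFD : eLpNorm F 2 volume ≤ D) (hgD : eLpNorm g 2 volume ≤ D) (x : ℝ) : ‖F x‖ ≤ 2 * D := by
  set ν : Measure ℝ := volume.restrict (Ioc x (x + 1)) with hν
  have hν1 : ν univ = 1 := by simp [hν]
  have : IsProbabilityMeasure ν := ⟨hν1⟩
  have h1 : ∀ f : ℝ → ℂ, AEStronglyMeasurable f volume → eLpNorm f 2 volume ≤ D →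
      ∫⁻ y, ‖f y‖ₑ ∂ν ≤ D := fun f hf hfD => by
    rw [← eLpNorm_one_eq_lintegral_enorm]
    exact ((eLpNorm_le_eLpNorm_of_exponent_le (by norm_num) hf.restrict).trans
      (eLpNorm_mono_measure _ Measure.restrict_le_self)).trans hfD
  have h2 : ∀ y ∈ Ioc x (x + 1), ‖F x‖ₑ ≤ ‖F y‖ₑ + ∫⁻ t, ‖g t‖ₑ ∂ν := fun y hy => by
    have e : F x = F y - ∫ t in Ioc x y, g t := by
      rw [← intervalIntegral.integral_of_le hy.1.le, ← hp x y]; ring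
    rw [e]
    refine enorm_sub_le.trans (add_le_add le_rfl ((enorm_integral_le_lintegral_enorm _).trans ?_))
    exact lintegral_mono_set (Ioc_subset_Ioc_right hy.2)
  have h3 : ‖F x‖ₑ ≤ D + D := by
    calc ‖F x‖ₑ = ∫⁻ _, ‖F x‖ₑ ∂ν := by simp
      _ ≤ ∫⁻ y, (‖F y‖ₑ + ∫⁻ t, ‖g t‖ₑ ∂ν) ∂ν := by
          refine lintegral_mono_ae ?_
          filter_upwards [ae_restrict_mem measurableSet_Ioc] with y hy using h2 y hy
      _ = (∫⁻ y, ‖F y‖ₑ ∂ν) + ∫⁻ t, ‖g t‖ₑ ∂ν := by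
          rw [lintegral_add_right _ measurable_const, lintegral_const, hν1, mul_one]
      _ ≤ _ := add_le_add (h1 F hF.aestronglyMeasurable hFD) (h1 g hgm.1 hgD)
  rw [enorm_eq_nnnorm, ← ENNReal.coe_add, ENNReal.coe_le_coe] at h3
  have : (‖F x‖₊ : ℝ) ≤ D + D := by exact_mod_cast h3
  rw [coe_nnnorm] at this
  linarith

theorem weighted_sub (f g : ℝ → ℂ) : weighted (f - g) = weighted f - weighted g := by
  ext y; simp [weighted, mul_sub]

theorem weighted_congr {f g : ℝ → ℂ} (h : f =ᵐ[volume] g) : weighted f =ᵐ[volume] weighted g := by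
  filter_upwards [h] with y hy
  rw [weighted, weighted, hy]

theorem MemL21.sub {f g : ℝ → ℂ} (hf : MemL21 f) (hg : MemL21 g) : MemL21 (f - g) := by
  rw [MemL21, weighted_sub]; exact MemLp.sub hf hg

theorem MemH11.sub {u v : ℝ → ℂ} (hu : MemH11 u) (hv : MemH11 v) : MemH11 (u - v) := by
  obtain ⟨h1, g, hg, hg'⟩ := hu
  obtain ⟨h2, k, hk, hk'⟩ := hv
  exact ⟨h1.sub h2, g - k, hg.sub hk, hg'.sub hk'⟩

theorem MemH1.sub {u v : ℝ → ℂ} (hu : MemH1 u) (hv : MemH1 v) : MemH1 (u - v) := by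
  obtain ⟨h1, g, hg, hg'⟩ := hu
  obtain ⟨h2, k, hk, hk'⟩ := hv
  exact ⟨h1.sub h2, g - k, hg.sub hk, hg'.sub hk'⟩

theorem MemH2.sub {u v : ℝ → ℂ} (hu : MemH2 u) (hv : MemH2 v) : MemH2 (u - v) := by
  obtain ⟨h1, g, hg, hg'⟩ := hu
  obtain ⟨h2, k, hk, hk'⟩ := hv
  exact ⟨h1.sub h2, g - k, hg.sub hk, hg'.sub hk'⟩

theorem hasWeakDeriv_zero : HasWeakDeriv (0 : ℝ → ℂ) 0 :=
  hasWeakDeriv_of_primitive (locallyIntegrable_zero) (by simp)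

theorem memH11_zero : MemH11 (0 : ℝ → ℂ) := by
  have h : MemL21 (0 : ℝ → ℂ) := by
    have : weighted (0 : ℝ → ℂ) = 0 := by ext; simp [weighted]
    rw [MemL21, this]; exact MemLp.zero
  exact ⟨h, 0, hasWeakDeriv_zero, h⟩

theorem memH2_zero : MemH2 (0 : ℝ → ℂ) :=
  ⟨MemLp.zero, 0, hasWeakDeriv_zero, MemLp.zero, 0, hasWeakDeriv_zero, MemLp.zero⟩

theorem HasWeakDeriv.weakDeriv_congr {u v : ℝ → ℂ} {g : ℝ → ℂ} (h : u =ᵐ[volume] v)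
    (hu : HasWeakDeriv u g) : weakDeriv u =ᵐ[volume] weakDeriv v :=
  hu.weakDeriv_ae_eq.trans (hu.congr h (ae_eq_refl g)).weakDeriv_ae_eq.symm

theorem MemH11.memL21_weakDeriv {u : ℝ → ℂ} (hu : MemH11 u) : MemL21 (weakDeriv u) := by
  obtain ⟨-, g, hg, hg'⟩ := hu
  exact (memLp_congr_ae (weighted_congr hg.weakDeriv_ae_eq)).2 hg'

theorem MemH11.eLpNorm_weighted_le {u : ℝ → ℂ} (hu : MemH11 u) :
    eLpNorm (weighted u) 2 volume ≤ ENNReal.ofReal (h11Norm u) :=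
  eLpNorm_le_ofReal hu.1 (Real.le_sqrt_of_sq_le (le_add_of_nonneg_right (sq_nonneg _)))

theorem MemH11.eLpNorm_weighted_weakDeriv_le {u : ℝ → ℂ} (hu : MemH11 u) :
    eLpNorm (weighted (weakDeriv u)) 2 volume ≤ ENNReal.ofReal (h11Norm u) :=
  eLpNorm_le_ofReal hu.memL21_weakDeriv
    (Real.le_sqrt_of_sq_le (le_add_of_nonneg_left (sq_nonneg _)))

theorem MemH2.memLp_weakDeriv_weakDeriv {u : ℝ → ℂ} (hu : MemH2 u) :
    MemLp (weakDeriv (weakDeriv u)) 2 volume := by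
  obtain ⟨-, g, hg, -, k, hk, hk'⟩ := hu
  have h := (hk.congr hg.weakDeriv_ae_eq.symm (ae_eq_refl k)).weakDeriv_ae_eq
  exact (memLp_congr_ae h).2 hk'

theorem MemH2.hasWeakDeriv_weakDeriv {u : ℝ → ℂ} (hu : MemH2 u) :
    HasWeakDeriv (weakDeriv u) (weakDeriv (weakDeriv u)) := by
  obtain ⟨-, g, hg, -, k, hk, -⟩ := hu
  exact KaupNewell.hasWeakDeriv_weakDeriv
    ⟨k, hk.congr hg.weakDeriv_ae_eq.symm (ae_eq_refl k)⟩

theorem MemH2.eLpNorm_weakDeriv_weakDeriv_le {u : ℝ → ℂ} (hu : MemH2 u) :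
    eLpNorm (weakDeriv (weakDeriv u)) 2 volume ≤ ENNReal.ofReal (h2Norm u) :=
  eLpNorm_le_ofReal hu.memLp_weakDeriv_weakDeriv
    (Real.le_sqrt_of_sq_le (le_add_of_nonneg_left (by positivity)))

theorem h11Norm_nonneg (u : ℝ → ℂ) : 0 ≤ h11Norm u := Real.sqrt_nonneg _

theorem h2Norm_nonneg (u : ℝ → ℂ) : 0 ≤ h2Norm u := Real.sqrt_nonneg _

/-- A continuous representative, as a primitive of a representative of the weak derivative. -/
structure PrimRep (u w g : ℝ → ℂ) : Prop extends Rep u w g where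
  cont : Continuous w
  meas : Measurable g
  prim : ∀ x y, w y - w x = ∫ t in x..y, g t

/-- The given u is arbitrary on null sets, while `IsPot` wants a continuous diagonal and measurable
entries. The Jost equation does not see the change of representative. -/
theorem MemH11.exists_primRep {u : ℝ → ℂ} (hu : MemH11 u) : ∃ w g, PrimRep u w g := by
  have h := KaupNewell.hasWeakDeriv_weakDeriv (Exists.imp (fun _ h => h.1) hu.2)
  have hm := h.2.1.aestronglyMeasurable
  have hg := h.congr (ae_eq_refl u) hm.ae_eq_mk
  obtain ⟨w, hw, huw, hp⟩ := hg.exists_primitive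
  exact ⟨w, _, ⟨huw, hm.ae_eq_mk⟩, hw, hm.stronglyMeasurable_mk.measurable, hp⟩

theorem primRep_zero : PrimRep 0 0 0 :=
  ⟨⟨ae_eq_refl _, hasWeakDeriv_zero.weakDeriv_ae_eq⟩, continuous_zero, measurable_zero, by simp⟩

namespace PrimRep

variable {u v w g f k : ℝ → ℂ}

theorem memLp_deriv (h : PrimRep u w g) (hu : MemH11 u) : MemLp g 2 volume := by
  refine ⟨h.meas.aestronglyMeasurable, (eLpNorm_le_weighted g).trans_lt ?_⟩
  rw [← eLpNorm_congr_ae (weighted_congr h.deriv_ae_eq)]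
  exact hu.memL21_weakDeriv.2

theorem eLpNorm_weighted_sub_le (h : PrimRep u w g) (h' : PrimRep v f k) (hu : MemH11 u)
    (hv : MemH11 v) :
    eLpNorm (weighted (w - f)) 2 volume ≤ ENNReal.ofReal (h11Norm (u - v)) := by
  rw [← eLpNorm_congr_ae (weighted_congr (h.ae_eq.sub h'.ae_eq))]
  exact (hu.sub hv).eLpNorm_weighted_le

theorem eLpNorm_weighted_deriv_sub_le (h : PrimRep u w g) (h' : PrimRep v f k) (hu : MemH11 u)
    (hv : MemH11 v) :
    eLpNorm (weighted (g - k)) 2 volume ≤ ENNReal.ofReal (h11Norm (u - v)) := by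
  have e := weakDeriv_sub_ae_eq (Exists.imp (fun _ h => h.1) hu.2) (Exists.imp (fun _ h => h.1) hv.2)
  rw [← eLpNorm_congr_ae (weighted_congr (e.trans (h.deriv_ae_eq.sub h'.deriv_ae_eq)))]
  exact (hu.sub hv).eLpNorm_weighted_weakDeriv_le

theorem norm_sub_le (h : PrimRep u w g) (h' : PrimRep v f k) (hu : MemH11 u) (hv : MemH11 v)
    (x : ℝ) : ‖w x - f x‖ ≤ 2 * h11Norm (u - v) := by
  have hg := h.memLp_deriv hu
  have hk := h'.memLp_deriv hv
  have := norm_le_of_primitive (F := w - f) (g := g - k) (D := (h11Norm (u - v)).toNNReal)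
    (h.cont.sub h'.cont) (fun x y => ?_) (hg.sub hk)
    ((eLpNorm_le_weighted _).trans (h.eLpNorm_weighted_sub_le h' hu hv))
    ((eLpNorm_le_weighted _).trans (h.eLpNorm_weighted_deriv_sub_le h' hu hv)) x
  · rwa [Real.coe_toNNReal _ (h11Norm_nonneg _)] at this
  · have i1 := intervalIntegrable_of_locallyIntegrable (hg.locallyIntegrable (by norm_num)) x y
    have i2 := intervalIntegrable_of_locallyIntegrable (hk.locallyIntegrable (by norm_num)) x y
    simp only [Pi.sub_apply]
    rw [intervalIntegral.integral_sub i1 i2, ← h.prim, ← h'.prim]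
    ring

theorem norm_le (h : PrimRep u w g) (hu : MemH11 u) (x : ℝ) : ‖w x‖ ≤ 2 * h11Norm u := by
  simpa using h.norm_sub_le primRep_zero hu memH11_zero x

end PrimRep

/-- The data attached to a continuous function in `H² ∩ H^{1,1}`: its derivative, which is
continuous, and a representative of its second derivative. -/
structure SmoothRep (u g g' : ℝ → ℂ) : Prop extends PrimRep u u g where
  cont_deriv : Continuous g
  hasDerivAt : ∀ x, HasDerivAt u (g x) x
  meas' : Measurable g'
  memLp' : MemLp g' 2 volume
  deriv_ae_eq' : weakDeriv (weakDeriv u) =ᵐ[volume] g'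
  prim' : ∀ x y, g y - g x = ∫ t in x..y, g' t

theorem MemH2.exists_smoothRep {u : ℝ → ℂ} (hu : MemH2 u) (huc : Continuous u) :
    ∃ g g', SmoothRep u g g' := by
  have h1 := KaupNewell.hasWeakDeriv_weakDeriv (Exists.imp (fun _ h => h.1) hu.2)
  have h2 := hu.hasWeakDeriv_weakDeriv
  have hm := hu.memLp_weakDeriv_weakDeriv.1
  have h2' := h2.congr (ae_eq_refl _) hm.ae_eq_mk
  obtain ⟨g, hg, hug, hp'⟩ := h2'.exists_primitive
  obtain ⟨w, hw, huw, hp⟩ := (h1.congr (ae_eq_refl u) hug).exists_primitive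
  -- The continuous u and its continuous representative agree a.e., hence everywhere, so u itself is
  -- a primitive of the continuous g and is C¹.
  obtain rfl : u = w := (huc.ae_eq_iff_eq volume hw).1 huw
  refine ⟨g, hm.mk _, ⟨⟨ae_eq_refl u, hug⟩, huc, hg.measurable, hp⟩, hg, fun x => ?_,
    hm.stronglyMeasurable_mk.measurable, (memLp_congr_ae hm.ae_eq_mk).1
    hu.memLp_weakDeriv_weakDeriv, hm.ae_eq_mk, hp'⟩
  have e : u = fun y => u 0 + ∫ t in (0 : ℝ)..y, g t := by
    ext y; rw [← hp 0 y]; ring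
  rw [e]
  exact (intervalIntegral.integral_hasDerivAt_right (hg.intervalIntegrable _ _)
    (hg.stronglyMeasurableAtFilter _ _) hg.continuousAt).const_add _

theorem smoothRep_zero : SmoothRep 0 0 0 where
  toPrimRep := primRep_zero
  cont_deriv := continuous_zero
  hasDerivAt x := hasDerivAt_const x 0
  meas' := measurable_zero
  memLp' := MemLp.zero
  deriv_ae_eq' := (hasWeakDeriv_zero.congr hasWeakDeriv_zero.weakDeriv_ae_eq.symm
    (ae_eq_refl _)).weakDeriv_ae_eq
  prim' := by simp

namespace SmoothRep

variable {u v g g' k k' : ℝ → ℂ}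

theorem close (h : SmoothRep u g g') (h' : SmoothRep v k k') (hu : MemH2 u) (hv : MemH2 v)
    (hu' : MemH11 u) (hv' : MemH11 v) :
    Close u v g k g' k' (h2h11Norm (u - v)).toNNReal := by
  have hle : ENNReal.ofReal (h11Norm (u - v)) ≤ ((h2h11Norm (u - v)).toNNReal : ℝ≥0∞) :=
    ENNReal.ofReal_le_ofReal (le_add_of_nonneg_left (h2Norm_nonneg _))
  refine ⟨(h.eLpNorm_weighted_sub_le h'.toPrimRep hu' hv').trans hle,
    (h.eLpNorm_weighted_deriv_sub_le h'.toPrimRep hu' hv').trans hle, ?_, fun y => ?_⟩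
  · have e1 := weakDeriv_sub_ae_eq (Exists.imp (fun _ h => h.1) hu.2)
      (Exists.imp (fun _ h => h.1) hv.2)
    have e2 := ((hu.sub hv).hasWeakDeriv_weakDeriv.weakDeriv_congr e1).trans
      (weakDeriv_sub_ae_eq ⟨_, hu.hasWeakDeriv_weakDeriv⟩ ⟨_, hv.hasWeakDeriv_weakDeriv⟩)
    rw [← eLpNorm_congr_ae (e2.trans (h.deriv_ae_eq'.sub h'.deriv_ae_eq'))]
    exact (hu.sub hv).eLpNorm_weakDeriv_weakDeriv_le.trans
      (ENNReal.ofReal_le_ofReal (le_add_of_nonneg_right (h11Norm_nonneg _)))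
  · refine (h.norm_sub_le h'.toPrimRep hu' hv' y).trans ?_
    rw [Real.coe_toNNReal (h2h11Norm _) (add_nonneg (h2Norm_nonneg _) (h11Norm_nonneg _)), h2h11Norm]
    linarith [h2Norm_nonneg (u - v)]

theorem norm_deriv_le (h : SmoothRep u g g') (hu : MemH2 u) (hu' : MemH11 u) (x : ℝ) :
    ‖g x‖ ≤ 2 * (h2h11Norm u).toNNReal := by
  have hc := h.close smoothRep_zero hu memH2_zero hu' memH11_zero
  simp only [sub_zero] at hc
  exact norm_le_of_primitive h.cont_deriv h.prim' h.memLp'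
    ((eLpNorm_le_weighted g).trans (by simpa using hc.wt_deriv)) (by simpa using hc.deriv2) x

end SmoothRep

/-! ### Assembly of the four statements -/

theorem rmd_zero {m : ℝ → ℝ → C2} (hm : IsSol 0 m) (x z : ℝ) : rmd 0 m x z = 0 := by
  rw [rmd, hm.eq, vint, mu]
  simp [vker]

theorem rho_zero {m : ℝ → ℝ → C2} (hm : IsSol 0 m) (x z : ℝ) : rho 0 m x z = 0 := by
  rw [rho, rmd_zero hm, corr]
  simp

/-- Bound for the potentials of functions bounded by `U` in `H^{1,1}`. -/
noncomputable def potBound (U : ℝ≥0) : ℝ≥0 := potConst (2 * U) * U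

namespace PrimRep

variable {u v w g f k : ℝ → ℂ} {U : ℝ≥0}

theorem wN_le (h : PrimRep u w g) (hu : MemH11 u) (hU : h11Norm u ≤ U) (s : Side) :
    wN (sidePot s w g) ≤ potBound U := by
  have h1 := h.eLpNorm_weighted_sub_le primRep_zero hu memH11_zero
  have h2 := h.eLpNorm_weighted_deriv_sub_le primRep_zero hu memH11_zero
  have hU' : ENNReal.ofReal (h11Norm u) ≤ U := ENNReal.ofReal_le_of_le_toReal (by simpa using hU)
  simp only [sub_zero] at h1 h2
  refine wN_sidePot_le s h.cont.measurable h.meas (fun y => (h.norm_le hu y).trans ?_)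
    (h1.trans hU') (h2.trans hU')
  push_cast; gcongr

theorem wN_sub_le (h : PrimRep u w g) (h' : PrimRep v f k) (hu : MemH11 u) (hv : MemH11 v)
    (hU : h11Norm u ≤ U) (hV : h11Norm v ≤ U) (s : Side) :
    wN (sidePot s w g - sidePot s f k) ≤
      (potConst (2 * U) * (h11Norm (u - v)).toNNReal : ℝ≥0) := by
  refine wN_sidePot_sub_le s h.cont.measurable h'.cont.measurable h.meas h'.meas
    (fun y => (h.norm_le hu y).trans ?_) (fun y => (h'.norm_le hv y).trans ?_)
    (h.eLpNorm_weighted_sub_le h' hu hv) (h.eLpNorm_weighted_deriv_sub_le h' hu hv)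
  all_goals push_cast; gcongr

theorem isPot (h : PrimRep u w g) (hu : MemH11 u) (s : Side) : IsPot (sidePot s w g) :=
  isPot_sidePot s h.cont h.meas
    ((h.wN_le hu (U := (h11Norm u).toNNReal) (Real.le_coe_toNNReal _) s).trans_lt
      ENNReal.coe_lt_top)

end PrimRep

/-- An isometric image of `D ∘ (± ·)` inherits the bounds on `D` and its difference quotients. -/
theorem memH1_of_isometry {D : ℝ → C2} {K : ℝ≥0} (s : Side) (L : C2 ≃ₗᵢ[ℝ] C2)
    (hD : Continuous D) (h : eLpNorm D 2 volume ≤ K)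
    (hK : ∀ k : ℝ, k ≠ 0 → eLpNorm (fun z => D (z + k) - D z) 2 volume ≤ ENNReal.ofReal |k| * K) :
    MemH1 (fun z => L (D (s.sgn * z))) ∧ h1Norm (fun z => L (D (s.sgn * z))) ≤ 2 * K := by
  have hnorm : ∀ {F : ℝ → C2}, Continuous F →
      eLpNorm (fun z => L (F (s.sgn * z))) 2 volume = eLpNorm F 2 volume := fun {F} hF => by
    rw [← eLpNorm_comp_measurePreserving hF.aestronglyMeasurable s.measurePreserving]
    exact eLpNorm_congr_norm_ae (Eventually.of_forall fun z => L.norm_map _)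
  refine memH1_and_h1Norm_le_of_diffQuotient (L.continuous.comp
    (hD.comp (continuous_const_mul s.sgn))) ((hnorm hD).trans_le h) fun k hk => ?_
  have e : (fun z => L (D (s.sgn * (z + k))) - L (D (s.sgn * z))) =
      fun z => L ((fun z => D (z + s.sgn * k) - D z) (s.sgn * z)) := by
    ext1 z
    simp only [map_sub, mul_add]
  have hs : s.sgn ≠ 0 := fun h0 => by simpa [h0] using s.abs_sgn
  have h1 := hK (s.sgn * k) (mul_ne_zero hs hk)
  rw [abs_mul, s.abs_sgn, one_mul] at h1
  have h2 := hnorm (F := fun z => D (z + s.sgn * k) - D z) (by fun_prop)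
  rw [← e] at h2
  exact h2.trans_le h1

/-- Lipschitz constant of the first order remainders in `H¹`. -/
noncomputable def remConst (U : ℝ≥0) : ℝ≥0 :=
  2 * (h1LipConst (potBound U) * potConst (2 * U))

/-- Membership and the Lipschitz bound come together from the estimates on difference quotients of
the difference of remainders. The reflection x ↦ σx brings both half-lines to x ≤ 0. -/
theorem memH1_rem_sub {u v : ℝ → ℂ} {U : ℝ≥0} (hu : MemH11 u) (hv : MemH11 v)
    (hU : h11Norm u ≤ U) (hV : h11Norm v ≤ U) {s : Side} {x : ℝ} (hx : x ∈ s.halfLine) :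
    (MemH1 (fun z => remM s u x z - remM s v x z) ∧
      h1Norm (fun z => remM s u x z - remM s v x z) ≤ remConst U * h11Norm (u - v)) ∧
    MemH1 (fun z => remN s u x z - remN s v x z) ∧
      h1Norm (fun z => remN s u x z - remN s v x z) ≤ remConst U * h11Norm (u - v) := by
  obtain ⟨w, g, h⟩ := hu.exists_primRep
  obtain ⟨f, k, h'⟩ := hv.exists_primRep
  have hP := h.isPot hu s
  have hQ := h'.isPot hv s
  obtain ⟨m, hm⟩ := exists_isSol hP.meas hP.fin
  obtain ⟨n, hn⟩ := exists_isSol hQ.meas hQ.fin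
  have hPU := h.wN_le hu hU s
  have hQU := h'.wN_le hv hV s
  have hΔ := h.wN_sub_le h' hu hv hU hV s
  have hx' := s.sgn_mul_nonpos hx
  -- The isometry is kept free: the identity gives the statement for m, and `conjSwap` the one for
  -- n.
  have key := fun L => memH1_of_isometry s L
    (((hm.adm_rmd hP).sub (hn.adm_rmd hQ)).continuous_right (s.sgn * x))
    (hm.eLpNorm_rmd_sub_le' hP hQ hn hPU hQU hΔ hx')
    fun k hk => hm.eLpNorm_diff_rmd_sub_le hP hQ hn hPU hQU hΔ hk hx'
  have hc : ∀ t : ℝ, t ≤ 2 * ((h1LipConst (potBound U) *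
      (potConst (2 * U) * (h11Norm (u - v)).toNNReal) : ℝ≥0) : ℝ) →
      t ≤ remConst U * h11Norm (u - v) := fun t ht => ht.trans_eq (by
    rw [remConst]
    push_cast
    rw [Real.coe_toNNReal _ (h11Norm_nonneg _)]
    ring)
  have eM : (fun z => remM s u x z - remM s v x z) = fun z =>
      LinearIsometryEquiv.refl ℝ C2 ((rmd (sidePot s w g) m - rmd (sidePot s f k) n)
        (s.sgn * x) (s.sgn * z)) := by
    ext1 z
    rw [h.remM_eq hP hm, h'.remM_eq hQ hn]
    rfl
  have eN : (fun z => remN s u x z - remN s v x z) = fun z =>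
      conjSwap ((rmd (sidePot s w g) m - rmd (sidePot s f k) n) (s.sgn * x) (s.sgn * z)) := by
    ext1 z
    rw [h.remN_eq hP hm, h'.remN_eq hQ hn, h.remM_eq hP hm, h'.remM_eq hQ hn, ← map_sub]
    rfl
  rw [eM, eN]
  exact ⟨(key _).imp_right (hc _), (key _).imp_right (hc _)⟩

theorem remM_zero (s : Side) (x z : ℝ) : remM s 0 x z = 0 := by
  have hP := primRep_zero.isPot memH11_zero s
  obtain ⟨m, hm⟩ := exists_isSol hP.meas hP.fin
  rw [primRep_zero.remM_eq hP hm]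
  rw [sidePot_zero] at hm ⊢
  exact rmd_zero hm _ _

theorem remN_zero (s : Side) (x z : ℝ) : remN s 0 x z = 0 := by
  have hP := primRep_zero.isPot memH11_zero s
  obtain ⟨m, hm⟩ := exists_isSol hP.meas hP.fin
  rw [primRep_zero.remN_eq hP hm, remM_zero, map_zero]

/-- Bound for the regular potentials of functions bounded by `U` in `H² ∩ H^{1,1}`. -/
noncomputable def regPotBound (U : ℝ≥0) : ℝ≥0 := regConst (2 * U) * U

/-- Lipschitz constant of the second order remainders. -/
noncomputable def hatConst (U : ℝ≥0) : ℝ≥0 := rhoLipConst (regPotBound U) * regConst (2 * U)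

theorem h2h11Norm_nonneg (u : ℝ → ℂ) : 0 ≤ h2h11Norm u :=
  add_nonneg (h2Norm_nonneg _) (h11Norm_nonneg _)

namespace SmoothRep

variable {u g g' : ℝ → ℂ} {U : ℝ≥0}

theorem norm_le (h : SmoothRep u g g') (hu' : MemH11 u) (hU : h2h11Norm u ≤ U) (y : ℝ) :
    ‖u y‖ ≤ (2 * U : ℝ≥0) := by
  refine (h.toPrimRep.norm_le hu' y).trans ?_
  push_cast
  have := h2Norm_nonneg u
  rw [h2h11Norm] at hU
  linarith

theorem norm_deriv_le' (h : SmoothRep u g g') (hu : MemH2 u) (hu' : MemH11 u)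
    (hU : h2h11Norm u ≤ U) (y : ℝ) : ‖g y‖ ≤ (2 * U : ℝ≥0) := by
  refine (h.norm_deriv_le hu hu' y).trans ?_
  rw [Real.coe_toNNReal _ (h2h11Norm_nonneg u)]
  push_cast; gcongr

theorem regBound (h : SmoothRep u g g') (hu : MemH2 u) (hu' : MemH11 u)
    (hU : h2h11Norm u ≤ U) (s : Side) :
    RegBound (sidePot s u g) (fun y => lowDeriv u g g' (s.sgn * y)) (regPotBound U) := by
  have hc := h.close smoothRep_zero hu memH2_zero hu' memH11_zero
  rw [sub_zero] at hc
  have hle : (h2h11Norm u).toNNReal ≤ U := Real.toNNReal_le_iff_le_coe.2 hU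
  have hle' : ((h2h11Norm u).toNNReal : ℝ≥0∞) ≤ U := by exact_mod_cast hle
  have hler : ((h2h11Norm u).toNNReal : ℝ) ≤ U := by exact_mod_cast hle
  exact regBound_sidePot s h.cont.measurable h.meas h.meas' (h.norm_le hu' hU)
    ⟨hc.wt_fun.trans hle', hc.wt_deriv.trans hle', hc.deriv2.trans hle',
      fun y => (hc.sup y).trans (by gcongr)⟩

theorem isRegPot (h : SmoothRep u g g') (hu : MemH2 u) (hu' : MemH11 u)
    (hU : h2h11Norm u ≤ U) (s : Side) :
    IsRegPot (sidePot s u g) (fun y => lowDeriv u g g' (s.sgn * y)) :=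
  isRegPot_sidePot s h.hasDerivAt h.cont_deriv h.meas' (h.memLp'.locallyIntegrable (by norm_num))
    h.prim' (h.norm_le hu' hU) (h.norm_deriv_le' hu hu' hU) (h.regBound hu hu' hU s)

end SmoothRep

/-- The hatted remainder is `rho` times σ/(2i), of modulus 1/2, evaluated at reflected arguments;
the reflection in z and `conjSwap` preserve L² norms. -/
theorem memLp_hat_sub {u v : ℝ → ℂ} {U : ℝ≥0} (huc : Continuous u) (hvc : Continuous v)
    (hu : MemH2 u) (hu' : MemH11 u) (hv : MemH2 v) (hv' : MemH11 v)
    (hU : h2h11Norm u ≤ U) (hV : h2h11Norm v ≤ U) (s : Side) (x : ℝ) :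
    (MemLp (fun z => hatM s u x z - hatM s v x z) 2 volume ∧
      l2Norm (fun z => hatM s u x z - hatM s v x z) ≤ hatConst U * h2h11Norm (u - v)) ∧
    MemLp (fun z => hatN s u x z - hatN s v x z) 2 volume ∧
      l2Norm (fun z => hatN s u x z - hatN s v x z) ≤ hatConst U * h2h11Norm (u - v) := by
  obtain ⟨g, g', h⟩ := hu.exists_smoothRep huc
  obtain ⟨k, k', h'⟩ := hv.exists_smoothRep hvc
  have hP := h.isRegPot hu hu' hU s
  have hQ := h'.isRegPot hv hv' hV s
  obtain ⟨m, hm⟩ := exists_isSol hP.meas hP.fin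
  obtain ⟨n, hn⟩ := exists_isSol hQ.meas hQ.fin
  have hd := regBound_sidePot_sub s h.cont.measurable h'.cont.measurable h.meas h'.meas h.meas'
    h'.meas' (h.norm_le hu' hU) (h'.norm_le hv' hV) (h'.norm_deriv_le' hv hv' hV)
    (h.close h' hu hv hu' hv')
  have key := hP.eLpNorm_rho_sub_le hQ hm hn (h.regBound hu hu' hU s) (h'.regBound hv hv' hV s) hd
    (s.sgn * x)
  set D := (rho (sidePot s u g) m - rho (sidePot s v k) n) (s.sgn * x) with hD
  have hDc : Continuous D := ((hP.adm_rho hm).sub (hQ.adm_rho hn)).continuous_right (s.sgn * x)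
  have eM : ∀ z, hatM s u x z - hatM s v x z =
      ((s.sgn : ℂ) / (2 * Complex.I)) • D (s.sgn * z) := fun z => by
    rw [h.toRep.hatM_eq h.hasDerivAt hP.toIsPot hm, h'.toRep.hatM_eq h'.hasDerivAt hQ.toIsPot hn,
      ← smul_sub]
    rfl
  have hcM : Continuous fun z => hatM s u x z - hatM s v x z := by
    simp only [eM]
    exact (hDc.comp (continuous_const_mul s.sgn)).const_smul ((s.sgn : ℂ) / (2 * Complex.I))
  have hc : ‖(s.sgn : ℂ) / (2 * Complex.I)‖ ≤ 1 := by
    rw [norm_div, s.norm_sgn]; norm_num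
  have hM : eLpNorm (fun z => hatM s u x z - hatM s v x z) 2 volume ≤
      (hatConst U * (h2h11Norm (u - v)).toNNReal : ℝ≥0) := by
    calc _ ≤ eLpNorm (D ∘ fun z => s.sgn * z) 2 volume := eLpNorm_mono fun z => by
          rw [eM, norm_smul]
          exact mul_le_of_le_one_left (norm_nonneg _) hc
      _ = eLpNorm D 2 volume :=
          eLpNorm_comp_measurePreserving hDc.aestronglyMeasurable s.measurePreserving
      _ ≤ _ := key.trans_eq (by rw [hatConst, mul_assoc])
  have eN : (fun z => hatN s u x z - hatN s v x z) = fun z =>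
      conjSwap (hatM s u x z - hatM s v x z) := by
    ext1 z
    rw [map_sub, h.toRep.hatN_eq hP.toIsPot hm, h'.toRep.hatN_eq hQ.toIsPot hn]
  have fin : ∀ F : ℝ → C2, Continuous F → eLpNorm F 2 volume ≤
      (hatConst U * (h2h11Norm (u - v)).toNNReal : ℝ≥0) →
      MemLp F 2 volume ∧ l2Norm F ≤ hatConst U * h2h11Norm (u - v) := fun F hF hb => by
    refine ⟨⟨hF.aestronglyMeasurable, hb.trans_lt ENNReal.coe_lt_top⟩,
      (ENNReal.toReal_mono ENNReal.coe_ne_top hb).trans_eq ?_⟩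
    rw [ENNReal.coe_toReal, NNReal.coe_mul, Real.coe_toNNReal _ (h2h11Norm_nonneg _)]
  refine ⟨fin _ hcM hM, fin _ ?_ ?_⟩
  · rw [eN]; exact conjSwap.continuous.comp hcM
  · rw [eN]
    exact (eLpNorm_congr_norm_ae (Eventually.of_forall fun z => conjSwap.norm_map _)).trans_le hM

theorem hatM_zero (s : Side) (x z : ℝ) : hatM s 0 x z = 0 := by
  have hP := primRep_zero.isPot memH11_zero s
  obtain ⟨m, hm⟩ := exists_isSol hP.meas hP.fin
  rw [primRep_zero.hatM_eq smoothRep_zero.hasDerivAt hP hm]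
  rw [sidePot_zero] at hm ⊢
  rw [rho_zero hm, smul_zero]

theorem hatN_zero (s : Side) (x z : ℝ) : hatN s 0 x z = 0 := by
  have hP := primRep_zero.isPot memH11_zero s
  obtain ⟨m, hm⟩ := exists_isSol hP.meas hP.fin
  rw [primRep_zero.hatN_eq hP hm, hatM_zero, map_zero]

theorem h11Norm_zero : h11Norm (0 : ℝ → ℂ) = 0 := by
  have h0 : weighted (0 : ℝ → ℂ) = 0 := by ext; simp [weighted]
  have h1 : eLpNorm (weighted (weakDeriv (0 : ℝ → ℂ))) 2 volume = 0 := by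
    rw [eLpNorm_congr_ae (weighted_congr hasWeakDeriv_zero.weakDeriv_ae_eq), h0]; simp
  simp [h11Norm, l2Norm, h0, h1]

theorem h2h11Norm_zero : h2h11Norm (0 : ℝ → ℂ) = 0 := by
  have h1 : eLpNorm (weakDeriv (0 : ℝ → ℂ)) 2 volume = 0 := by
    rw [eLpNorm_congr_ae hasWeakDeriv_zero.weakDeriv_ae_eq]; simp
  have h2 : eLpNorm (weakDeriv (weakDeriv (0 : ℝ → ℂ))) 2 volume = 0 := by
    rw [eLpNorm_congr_ae smoothRep_zero.deriv_ae_eq']; simp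
  simp [h2h11Norm, h11Norm_zero, h2Norm, l2Norm, h1, h2]

end

end KaupNewell

open KaupNewell
/-- Regularity in `z` of the Jost functions of `u ∈ H^{1,1}` and `u ∈ H² ∩ H^{1,1}` (in the latter
case `u` denotes the continuous representative), and Lipschitz continuity in `u`. -/
theorem lemma2p4 :
    (∀ u : ℝ → ℂ, MemH11 u → ∀ s : Side, ∀ x ∈ s.halfLine,
      MemH1 (remM s u x) ∧ MemH1 (remN s u x)) ∧
    (∀ u : ℝ → ℂ, Continuous u → MemH2 u → MemH11 u → ∀ (s : Side) (x : ℝ),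
      MemLp (hatM s u x) 2 volume ∧ MemLp (hatN s u x) 2 volume) ∧
    (∀ U : ℝ, 0 < U → ∃ C : ℝ, 0 < C ∧ ∀ u v : ℝ → ℂ, MemH11 u → MemH11 v →
      h11Norm u ≤ U → h11Norm v ≤ U → ∀ s : Side, ∀ x ∈ s.halfLine,
        h1Norm (fun z => remM s u x z - remM s v x z) ≤ C * h11Norm (u - v) ∧
        h1Norm (fun z => remN s u x z - remN s v x z) ≤ C * h11Norm (u - v)) ∧
    (∀ U : ℝ, 0 < U → ∃ C : ℝ, 0 < C ∧ ∀ u v : ℝ → ℂ, Continuous u → Continuous v →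
      MemH2 u → MemH11 u → MemH2 v → MemH11 v →
      h2h11Norm u ≤ U → h2h11Norm v ≤ U → ∀ (s : Side) (x : ℝ),
        l2Norm (fun z => hatM s u x z - hatM s v x z) +
          l2Norm (fun z => hatN s u x z - hatN s v x z) ≤ C * h2h11Norm (u - v)) := by
  refine ⟨fun u hu s x hx => ?_, fun u huc hu hu' s x => ?_, fun U hU => ?_, fun U hU => ?_⟩
  -- Membership is the Lipschitz statement with v = 0, whose remainders vanish identically.
  · have h := memH1_rem_sub (U := (h11Norm u).toNNReal) hu memH11_zero (Real.le_coe_toNNReal _)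
      (by rw [h11Norm_zero]; exact NNReal.coe_nonneg _) hx
    simp only [remM_zero, remN_zero, sub_zero] at h
    exact ⟨h.1.1, h.2.1⟩
  · have h := memLp_hat_sub (U := (h2h11Norm u).toNNReal) huc continuous_zero hu hu' memH2_zero
      memH11_zero (Real.le_coe_toNNReal _)
      (by rw [h2h11Norm_zero]; exact NNReal.coe_nonneg _) s x
    simp only [hatM_zero, hatN_zero, sub_zero] at h
    exact ⟨h.1.1, h.2.1⟩
  -- The added 1 serves only to make the constant strictly positive, here and in the last statement.
  · refine ⟨remConst U.toNNReal + 1, by positivity, fun u v hu hv hu' hv' s x hx => ?_⟩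
    rw [← Real.coe_toNNReal U hU.le] at hu' hv'
    have h := memH1_rem_sub hu hv hu' hv' hx
    rw [add_mul, one_mul]
    have := h11Norm_nonneg (u - v)
    exact ⟨by linarith [h.1.2], by linarith [h.2.2]⟩
  · refine ⟨2 * hatConst U.toNNReal + 1, by positivity,
      fun u v huc hvc hu hu' hv hv' hU' hV' s x => ?_⟩
    rw [← Real.coe_toNNReal U hU.le] at hU' hV'
    have h := memLp_hat_sub huc hvc hu hu' hv hv' hU' hV' s x
    have := h2h11Norm_nonneg (u - v)
    linarith [h.1.2, h.2.2]
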